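/- \textbf{Theorem.} Let $s>1$, $1\le p<\infty$ and $r\in\mathbb R$ satisfy $2-s<r+\frac2p<s$. \emph{Setting.} Let $G=\{\begin{pmatrix}a&b\\0&a^{-1}\end{pmatrix} : a>0,\ b\in\mathbb R\}\subset \mathrm{SL}_2(\mathbb R)$ with left Haar measure $a^{-2}\,da\,db$. Put $\alpha=\frac12(a+a^{-1}+ib)$ and $\beta=\frac12(b+i(a-a^{-1}))$, so that $(a,b)\mapsto\begin{pmatrix}\alpha&\beta\\ \bar\beta&\bar\alpha\end{pmatrix}$ embeds $G$ in $\mathrm{SU}(1,1)$ (Cayley transform). Let $\mathcal H_s$ be the Hilbert space of holomorphic functions $v$ on the unit disc $\mathbb D$ with $(v,v)_s<\infty$, where $(v,w)_s=\frac{s-1}{\pi}\int_{\mathbb D}v(z)\overline{w(z)}(1-|z|^2)^{s-2}\,dz$. Let $\pi_s$ be the discrete series representation $$\pi_s\begin{pmatrix}\alpha&\beta\\ \bar\beta&\bar\alpha\end{pmatrix}v(z)=(-\bar\beta z+\alpha)^{-s}\,v\Big(\frac{\bar\alpha z-\beta}{-\bar\beta z+\alpha}\Big)$$ (of the universal covering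 group of $\mathrm{SU}(1,1)$, which contains $G$; on $G$ the power is the principal one). Let $\mathcal H_s^\infty$ be the Fréchet space of its smooth vectors, that is, of the $v\in\mathcal H_s$ whose orbit map on the covering group is $C^\infty$, with the topology of locally uniform convergence of all derivatives of orbit maps. Let $(\mathcal H_s^\infty)^*$ be the space of continuous conjugate linear functionals on $\mathcal H_s^\infty$, with $\langle\pi_s^*(x)\phi,v\rangle=\langle\phi,\pi_s(x^{-1})v\rangle$ for $x\in G$. Let $u\in\mathcal H_s^\infty$ be the constant function $1$, and let $W_u(\phi)(x)=\langle\phi,\pi_s(x)u\rangle$ for $x\in G$. Let $w_r(a,b)=2^r[(a+a^{-1})^2+b^2]^{r/2}$, let $L^p_r(G)$ be the space of measurable $f$ on $G$ with $\|f\|_{L^p_r}=\big(\int_G|f\,w_r|^p\,a^{-2}\,da\,db\big)^{1/p}<\infty$, and let $$\mathrm{Co}^u_{\mathcal H_s^\infty}L^p_r(G)=\{\phi\in(\mathcal H_s^\infty)^* : W_u(\phi)\in L^p_r(G)\},\qquad \|\phi\|=\|W_u(\phi)\|_{L^p_r}.$$ \emph{Conclusion.} $\|\cdot\|$ is a norm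 on the vector space $\mathrm{Co}^u_{\mathcal H_s^\infty}L^p_r(G)$, for which it is a Banach space; this space is non-zero; and it is invariant under $\pi_s$, that is, $\pi_s^*(x)\phi\in\mathrm{Co}^u_{\mathcal H_s^\infty}L^p_r(G)$ for all $x\in G$ and all $\phi$ in the space. This includes the parameters $1<s\le2$, for which the coefficient $x\mapsto(u,\pi_s(x)u)_s$ is not integrable on $G$. -/

import Mathlib

namespace BergmanCoorbit

open scoped MatrixGroups ComplexConjugate ContDiff
open MeasureTheory

noncomputable section

/-! ### The group -/

/-- The connected group of upper triangular matrices `(a, b; 0, a⁻¹)`, `a > 0`, in `SL(2, ℝ)`. -/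
def triangularGroup : Subgroup SL(2, ℝ) where
  carrier := {g | g 1 0 = 0 ∧ 0 < g 0 0}
  one_mem' := by simp
  mul_mem' := by
    rintro g h ⟨hg, hg'⟩ ⟨hh, hh'⟩
    simp [Matrix.mul_apply, Fin.sum_univ_two, hg, hh, hg', hh']
  inv_mem' := by
    rintro g ⟨hg, hg'⟩
    have hd := g.det_coe
    rw [Matrix.det_fin_two, hg] at hd
    have : 0 < g 1 1 := by
      by_contra hcon
      push Not at hcon
      nlinarith [mul_nonneg hg'.le (neg_nonneg.mpr hcon)]
    simp [Matrix.SpecialLinearGroup.coe_inv, Matrix.adjugate_fin_two, hg, this]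

/-- The group `G`. -/
abbrev G : Type := ↥triangularGroup

/-- The coordinate `a` of `(a, b; 0, a⁻¹)`. -/
def G.a (x : G) : ℝ := (x : SL(2, ℝ)) 0 0

/-- The coordinate `b` of `(a, b; 0, a⁻¹)`. -/
def G.b (x : G) : ℝ := (x : SL(2, ℝ)) 0 1

lemma G.a_pos (x : G) : 0 < x.a := x.2.2

lemma G.a_mul (x y : G) : (x * y).a = x.a * y.a := by
  simp [G.a, Matrix.mul_apply, Fin.sum_univ_two, show (y : SL(2, ℝ)) 1 0 = 0 from y.2.1]

lemma G.entry_one_one (x : G) : (x : SL(2, ℝ)) 1 1 = x.a⁻¹ := by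
  have hd := (x : SL(2, ℝ)).det_coe
  rw [Matrix.det_fin_two, show (x : SL(2, ℝ)) 1 0 = 0 from x.2.1] at hd
  have := x.a_pos
  refine eq_inv_of_mul_eq_one_right ?_
  simp only [G.a]
  linarith

lemma G.b_mul (x y : G) : (x * y).b = x.a * y.b + x.b * y.a⁻¹ := by
  rw [← y.entry_one_one]
  simp [G.a, G.b, Matrix.mul_apply, Fin.sum_univ_two]

/-- The element `(a, b; 0, a⁻¹)` of `G`. -/
def G.mk (a b : ℝ) (ha : 0 < a) : G :=
  ⟨⟨!![a, b; 0, a⁻¹], by simp [Matrix.det_fin_two, ha.ne']⟩, by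
    change _ = (0 : ℝ) ∧ 0 < _
    simp [ha]⟩

@[simp] lemma G.mk_a (a b : ℝ) (ha : 0 < a) : (G.mk a b ha).a = a := by simp [G.mk, G.a]

@[simp] lemma G.mk_b (a b : ℝ) (ha : 0 < a) : (G.mk a b ha).b = b := by simp [G.mk, G.b]

lemma G.ext {x y : G} (ha : x.a = y.a) (hb : x.b = y.b) : x = y := by
  apply Subtype.ext
  apply Subtype.ext
  ext i j
  have h0 : (x : SL(2, ℝ)) 1 0 = (y : SL(2, ℝ)) 1 0 := by rw [x.2.1, y.2.1]
  have h1 : (x : SL(2, ℝ)) 1 1 = (y : SL(2, ℝ)) 1 1 := by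
    rw [x.entry_one_one, y.entry_one_one, ha]
  fin_cases i <;> fin_cases j
  · exact ha
  · exact hb
  · exact h0
  · exact h1

instance : MeasurableSpace G := MeasurableSpace.comap (fun x : G => (x.a, x.b)) inferInstance

/-- The left Haar measure `da db / a²` of `G`. -/
def haar : Measure G :=
  (Measure.comap (fun x : G => (x.a, x.b)) volume).withDensity
    (fun x => ENNReal.ofReal (1 / x.a ^ 2))

/-- The entry `α` of the image `(α, β; conj β, conj α)` in `SU(1,1)` of an element of `G`
under the Cayley transform. -/
def G.α (x : G) : ℂ := ((x.a : ℂ) + (x.a : ℂ)⁻¹ + Complex.I * x.b) / 2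

/-- The entry `β` of the image `(α, β; conj β, conj α)` in `SU(1,1)` of an element of `G`
under the Cayley transform. -/
def G.β (x : G) : ℂ := ((x.b : ℂ) + Complex.I * ((x.a : ℂ) - (x.a : ℂ)⁻¹)) / 2

lemma G.norm_sub (x : G) : ‖x.α‖ ^ 2 - ‖x.β‖ ^ 2 = 1 := by
  have ha := x.a_pos.ne'
  rw [← Complex.normSq_eq_norm_sq, ← Complex.normSq_eq_norm_sq]
  have h1 : x.α = ⟨(x.a + x.a⁻¹) / 2, x.b / 2⟩ := by
    apply Complex.ext <;> simp [G.α, ← Complex.ofReal_inv]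
  have h2 : x.β = ⟨x.b / 2, (x.a - x.a⁻¹) / 2⟩ := by
    apply Complex.ext <;> simp [G.β, ← Complex.ofReal_inv]
  rw [h1, h2, Complex.normSq_mk, Complex.normSq_mk]
  field_simp
  ring

/-! ### The Hilbert spaces -/

/-- The unit disc. -/
def disc : Set ℂ := Metric.ball 0 1

/-- The measure `(s - 1) / π * (1 - |z|²) ^ (s - 2) dz` on the unit disc. -/
def discMeasure (s : ℝ) : Measure ℂ :=
  (volume.restrict disc).withDensity
    (fun z => ENNReal.ofReal ((s - 1) / Real.pi * (1 - ‖z‖ ^ 2) ^ (s - 2)))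

/-- The Hilbert space `H_s = A²_s(𝔻)`: the classes in `L²(discMeasure s)` of the holomorphic
functions on the disc, with the norm and the inner product of `L²`. -/
def Hilb (s : ℝ) : Submodule ℂ (Lp ℂ 2 (discMeasure s)) where
  carrier := {f | ∃ F : ℂ → ℂ, DifferentiableOn ℂ F disc ∧ f =ᵐ[discMeasure s] F}
  zero_mem' := ⟨0, differentiableOn_const 0, Lp.coeFn_zero _ _ _⟩
  add_mem' := by
    rintro f g ⟨F, hF, hf⟩ ⟨K, hK, hg⟩
    exact ⟨F + K, hF.add hK, (Lp.coeFn_add f g).trans (hf.add hg)⟩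
  smul_mem' := by
    rintro c f ⟨F, hF, hf⟩
    exact ⟨c • F, hF.const_smul c, (Lp.coeFn_smul c f).trans (hf.const_smul c)⟩

/-- The holomorphic function on the disc that represents an element of `H_s` (for `s > 1` it is
unique on the disc; the values outside of the disc play no role). -/
def hol {s : ℝ} (v : Hilb s) : ℂ → ℂ := v.2.choose

lemma hol_diff {s : ℝ} (v : Hilb s) : DifferentiableOn ℂ (hol v) disc := v.2.choose_spec.1

lemma hol_ae {s : ℝ} (v : Hilb s) : (v : Lp ℂ 2 (discMeasure s)) =ᵐ[discMeasure s] hol v :=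
  v.2.choose_spec.2

lemma isOpen_disc : IsOpen disc := Metric.isOpen_ball

lemma mem_disc {z : ℂ} : z ∈ disc ↔ ‖z‖ < 1 := by simp [disc]

lemma measurable_density (s : ℝ) : Measurable (fun z : ℂ =>
    ENNReal.ofReal ((s - 1) / Real.pi * (1 - ‖z‖ ^ 2) ^ (s - 2))) := by
  fun_prop

lemma ae_discMeasure_iff (s : ℝ) [hs : Fact (1 < s)] {p : ℂ → Prop} :
    (∀ᵐ z ∂discMeasure s, p z) ↔ ∀ᵐ z ∂(volume.restrict disc), p z := by
  rw [discMeasure, ae_withDensity_iff (measurable_density s)]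
  have h : ∀ᵐ z ∂(volume.restrict disc), z ∈ disc := ae_restrict_mem isOpen_disc.measurableSet
  have hpos : ∀ z ∈ disc, ENNReal.ofReal ((s - 1) / Real.pi * (1 - ‖z‖ ^ 2) ^ (s - 2)) ≠ 0 := by
    intro z hz
    rw [mem_disc] at hz
    have h1 : 0 < s - 1 := sub_pos.mpr hs.out
    have h2 : 0 < 1 - ‖z‖ ^ 2 := by nlinarith [norm_nonneg z]
    have := Real.pi_pos
    simp only [ne_eq, ENNReal.ofReal_eq_zero, not_le]
    positivity
  constructor
  · intro h1
    filter_upwards [h1, h] with z hz hzd using hz (hpos z hzd)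
  · intro h1
    filter_upwards [h1] with z hz _ using hz

lemma eqOn_of_ae {s : ℝ} [Fact (1 < s)] {F K : ℂ → ℂ} (hF : DifferentiableOn ℂ F disc)
    (hK : DifferentiableOn ℂ K disc) (h : F =ᵐ[discMeasure s] K) : Set.EqOn F K disc :=
  Measure.eqOn_open_of_ae_eq ((ae_discMeasure_iff s).mp h) isOpen_disc hF.continuousOn
    hK.continuousOn

lemma ae_of_eqOn {s : ℝ} [Fact (1 < s)] {F K : ℂ → ℂ} (h : Set.EqOn F K disc) :
    F =ᵐ[discMeasure s] K := by
  refine (ae_discMeasure_iff s).mpr ?_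
  filter_upwards [ae_restrict_mem isOpen_disc.measurableSet] with z hz using h hz

lemma hol_eqOn {s : ℝ} [Fact (1 < s)] (v : Hilb s) {F : ℂ → ℂ} (hF : DifferentiableOn ℂ F disc)
    (h : (v : Lp ℂ 2 (discMeasure s)) =ᵐ[discMeasure s] F) : Set.EqOn (hol v) F disc :=
  eqOn_of_ae (hol_diff v) hF ((hol_ae v).symm.trans h)

lemma hol_add {s : ℝ} [Fact (1 < s)] (v w : Hilb s) :
    Set.EqOn (hol (v + w)) (hol v + hol w) disc :=
  hol_eqOn _ ((hol_diff v).add (hol_diff w))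
    ((Lp.coeFn_add (v : Lp ℂ 2 (discMeasure s)) w).trans ((hol_ae v).add (hol_ae w)))

lemma hol_smul {s : ℝ} [Fact (1 < s)] (c : ℂ) (v : Hilb s) :
    Set.EqOn (hol (c • v)) (c • hol v) disc :=
  hol_eqOn _ ((hol_diff v).const_smul c)
    ((Lp.coeFn_smul c (v : Lp ℂ 2 (discMeasure s))).trans ((hol_ae v).const_smul c))

lemma memLp_hol {s : ℝ} (v : Hilb s) : MemLp (hol v) 2 (discMeasure s) :=
  (memLp_congr_ae (hol_ae v)).mp (Lp.memLp _)

/-- The element of `H_s` given by a square integrable holomorphic function. -/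
def ofHol {s : ℝ} (F : ℂ → ℂ) (hF : DifferentiableOn ℂ F disc)
    (hL : MemLp F 2 (discMeasure s)) : Hilb s :=
  ⟨hL.toLp F, F, hF, hL.coeFn_toLp⟩

lemma hol_ofHol {s : ℝ} [Fact (1 < s)] {F : ℂ → ℂ} (hF : DifferentiableOn ℂ F disc)
    (hL : MemLp F 2 (discMeasure s)) : Set.EqOn (hol (ofHol F hF hL)) F disc :=
  hol_eqOn _ hF hL.coeFn_toLp

lemma hilb_ext {s : ℝ} [Fact (1 < s)] {v w : Hilb s} (h : Set.EqOn (hol v) (hol w) disc) :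
    v = w :=
  Subtype.ext (Lp.ext ((hol_ae v).trans ((ae_of_eqOn h).trans (hol_ae w).symm)))

/-! ### The representations -/

/-- The denominator of the inverse of `(α, β; conj β, conj α)` acting on the disc. -/
def den (α β z : ℂ) : ℂ := -conj β * z + α

/-- The inverse of `(α, β; conj β, conj α)` acting on the disc. -/
def mob (α β z : ℂ) : ℂ := (conj α * z - β) / den α β z

lemma den_ne {α β : ℂ} (h : ‖α‖ ^ 2 - ‖β‖ ^ 2 = 1) {z : ℂ} (hz : z ∈ disc) : den α β z ≠ 0 := by
  rw [mem_disc] at hz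
  intro h0
  have h1 : α = conj β * z := by rw [den] at h0; linear_combination h0
  have h2 : ‖α‖ = ‖β‖ * ‖z‖ := by rw [h1, norm_mul, Complex.norm_conj]
  have h3 : ‖β‖ * ‖z‖ ≤ ‖β‖ := mul_le_of_le_one_right (norm_nonneg _) hz.le
  nlinarith [norm_nonneg α, norm_nonneg β]

lemma one_sub_mob {α β : ℂ} (h : ‖α‖ ^ 2 - ‖β‖ ^ 2 = 1) {z : ℂ} (hz : z ∈ disc) :
    1 - ‖mob α β z‖ ^ 2 = (1 - ‖z‖ ^ 2) / ‖den α β z‖ ^ 2 := by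
  have h0 : ‖den α β z‖ ≠ 0 := norm_ne_zero_iff.mpr (den_ne h hz)
  rw [mob, norm_div]
  field_simp
  simp only [← Complex.normSq_eq_norm_sq, den, Complex.normSq_apply] at h ⊢
  simp
  linear_combination (1 - z.re * z.re - z.im * z.im) * h

lemma mob_mem {α β : ℂ} (h : ‖α‖ ^ 2 - ‖β‖ ^ 2 = 1) {z : ℂ} (hz : z ∈ disc) :
    mob α β z ∈ disc := by
  have h1 := one_sub_mob h hz
  have h0 : 0 < ‖den α β z‖ := norm_pos_iff.mpr (den_ne h hz)
  rw [mem_disc] at hz ⊢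
  have h2 : 0 < (1 - ‖z‖ ^ 2) / ‖den α β z‖ ^ 2 := by
    have : 0 < 1 - ‖z‖ ^ 2 := by nlinarith [norm_nonneg z]
    positivity
  rw [← h1] at h2
  nlinarith [norm_nonneg (mob α β z)]

lemma mob_hasDerivAt {α β : ℂ} (h : ‖α‖ ^ 2 - ‖β‖ ^ 2 = 1) {z : ℂ} (hz : z ∈ disc) :
    HasDerivAt (mob α β) (1 / den α β z ^ 2) z := by
  have h0 := den_ne h hz
  have h1 : HasDerivAt (fun z => conj α * z - β) (conj α) z := by
    simpa using ((hasDerivAt_id z).const_mul (conj α)).sub_const β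
  have h2 : HasDerivAt (den α β) (-conj β) z := by
    have := ((hasDerivAt_id z).const_mul (-conj β)).add_const α
    rw [mul_one] at this
    exact this
  refine (h1.div h2 h0).congr_deriv ?_
  congr 1
  have h3 : (α * conj α - β * conj β : ℂ) = 1 := by
    rw [Complex.mul_conj', Complex.mul_conj']
    exact_mod_cast h
  simp only [den]
  linear_combination h3

lemma mob_injOn {α β : ℂ} (h : ‖α‖ ^ 2 - ‖β‖ ^ 2 = 1) : Set.InjOn (mob α β) disc := by
  intro z hz w hw hzw
  have h0 := den_ne h hz
  have h1 := den_ne h hw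
  have h3 : (α * conj α - β * conj β : ℂ) = 1 := by
    rw [Complex.mul_conj', Complex.mul_conj']
    exact_mod_cast h
  simp only [mob] at hzw
  rw [div_eq_div_iff h0 h1] at hzw
  simp only [den] at hzw
  linear_combination hzw - (z - w) * h3

lemma mob_diff {α β : ℂ} (h : ‖α‖ ^ 2 - ‖β‖ ^ 2 = 1) : DifferentiableOn ℂ (mob α β) disc :=
  fun _ hz => (mob_hasDerivAt h hz).differentiableAt.differentiableWithinAt

lemma lintegral_discMeasure (s : ℝ) (f : ℂ → ENNReal) :
    ∫⁻ z, f z ∂discMeasure s = ∫⁻ z in disc,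
      ENNReal.ofReal ((s - 1) / Real.pi * (1 - ‖z‖ ^ 2) ^ (s - 2)) * f z := by
  rw [discMeasure, lintegral_withDensity_eq_lintegral_mul_non_measurable _ (measurable_density s)
    (Filter.Eventually.of_forall fun _ => ENNReal.ofReal_lt_top)]
  rfl

/-- A weighted composition with an automorphism of the disc does not increase square integrals. -/
lemma transform_memLp {s : ℝ} [hs : Fact (1 < s)] {α β : ℂ} (h : ‖α‖ ^ 2 - ‖β‖ ^ 2 = 1)
    {m F : ℂ → ℂ} (hm : DifferentiableOn ℂ m disc)
    (hn : ∀ z ∈ disc, ‖m z‖ = ‖den α β z‖ ^ (-s)) (hF : DifferentiableOn ℂ F disc)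
    (hL : MemLp F 2 (discMeasure s)) :
    MemLp (fun z => m z * F (mob α β z)) 2 (discMeasure s) := by
  have hd : DifferentiableOn ℂ (fun z => m z * F (mob α β z)) disc :=
    hm.mul (hF.comp (mob_diff h) fun z hz => mob_mem h hz)
  refine ⟨?_, ?_⟩
  · have h1 : AEStronglyMeasurable (fun z => m z * F (mob α β z)) (volume.restrict disc) :=
      hd.continuousOn.aestronglyMeasurable isOpen_disc.measurableSet
    exact h1.mono_ac (withDensity_absolutelyContinuous _ _)
  · have hL2 := hL.2
    rw [eLpNorm_lt_top_iff_lintegral_rpow_enorm_lt_top (by simp) (by simp)] at hL2 ⊢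
    refine lt_of_le_of_lt ?_ hL2
    rw [lintegral_discMeasure, lintegral_discMeasure]
    calc _ = ∫⁻ z in disc, ENNReal.ofReal |(((1 : ℂ →L[ℂ] ℂ).smulRight
              (1 / den α β z ^ 2)).restrictScalars ℝ).det| *
            (fun w => ENNReal.ofReal ((s - 1) / Real.pi * (1 - ‖w‖ ^ 2) ^ (s - 2)) *
              ‖F w‖ₑ ^ (2 : ENNReal).toReal) (mob α β z) := by
          refine setLIntegral_congr_fun isOpen_disc.measurableSet fun z hz => ?_
          have h0 : 0 < ‖den α β z‖ := norm_pos_iff.mpr (den_ne h hz)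
          have hz1 : 0 < 1 - ‖z‖ ^ 2 := by
            rw [mem_disc] at hz
            nlinarith [norm_nonneg z]
          have hs1 : 0 < s - 1 := sub_pos.mpr hs.out
          have hpi := Real.pi_pos
          have hdet : |(((1 : ℂ →L[ℂ] ℂ).smulRight
              (1 / den α β z ^ 2)).restrictScalars ℝ).det| = ‖den α β z‖ ^ (-4 : ℝ) := by
            simp [ContinuousLinearMap.det, LinearMap.det_restrictScalars,
              Algebra.norm_complex_eq, Complex.normSq_eq_norm_sq, ← pow_mul]
          simp only [hdet, one_sub_mob h hz]
          rw [enorm_mul, ← ofReal_norm (m z), ENNReal.mul_rpow_of_nonneg _ _ (by simp),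
            ← mul_assoc, ← mul_assoc, hn z hz, ENNReal.ofReal_rpow_of_pos (by positivity),
            ← ENNReal.ofReal_mul (by positivity), ← ENNReal.ofReal_mul (by positivity)]
          congr 2
          rw [Real.div_rpow hz1.le (by positivity), ← Real.rpow_natCast ‖den α β z‖ 2,
            ← Real.rpow_mul h0.le, ← Real.rpow_mul h0.le]
          have : ‖den α β z‖ ^ (-s * (2 : ENNReal).toReal) =
              ‖den α β z‖ ^ (-4 : ℝ) / ‖den α β z‖ ^ (((2 : ℕ) : ℝ) * (s - 2)) := by
            rw [← Real.rpow_sub h0]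
            congr 1
            simp
            ring
          rw [this]
          ring
      _ = ∫⁻ w in mob α β '' disc, ENNReal.ofReal
            ((s - 1) / Real.pi * (1 - ‖w‖ ^ 2) ^ (s - 2)) * ‖F w‖ₑ ^ (2 : ENNReal).toReal := by
          rw [lintegral_image_eq_lintegral_abs_det_fderiv_mul volume isOpen_disc.measurableSet
            (fun z hz => ((mob_hasDerivAt h hz).hasFDerivAt.restrictScalars ℝ).hasFDerivWithinAt)
            (mob_injOn h)]
          rfl
      _ ≤ _ := lintegral_mono_set (by
          rintro _ ⟨z, hz, rfl⟩
          exact mob_mem h hz)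

/-- The operator `v ↦ m · (v ∘ g⁻¹)` on `H_s`, where `g = (α, β; conj β, conj α)` and `m` is a
holomorphic multiplier with `|m(z)| = |-conj β z + α| ^ (-s)`. -/
def transform {s : ℝ} [Fact (1 < s)] {α β : ℂ} (h : ‖α‖ ^ 2 - ‖β‖ ^ 2 = 1)
    {m : ℂ → ℂ} (hm : DifferentiableOn ℂ m disc)
    (hn : ∀ z ∈ disc, ‖m z‖ = ‖den α β z‖ ^ (-s)) : Hilb s →ₗ[ℂ] Hilb s where
  toFun v := ofHol (fun z => m z * hol v (mob α β z))
    (hm.mul ((hol_diff v).comp (mob_diff h) fun _ hz => mob_mem h hz))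
    (transform_memLp h hm hn (hol_diff v) (memLp_hol v))
  map_add' v w := by
    apply hilb_ext
    intro z hz
    rw [hol_add _ _ hz, hol_ofHol _ _ hz, Pi.add_apply, hol_ofHol _ _ hz, hol_ofHol _ _ hz,
      hol_add _ _ (mob_mem h hz), Pi.add_apply, mul_add]
  map_smul' c v := by
    apply hilb_ext
    intro z hz
    simp only [RingHom.id_apply]
    rw [hol_smul _ _ hz, hol_ofHol _ _ hz, Pi.smul_apply, hol_ofHol _ _ hz,
      hol_smul _ _ (mob_mem h hz), Pi.smul_apply, smul_eq_mul, smul_eq_mul]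
    ring

lemma hol_transform {s : ℝ} [Fact (1 < s)] {α β : ℂ} (h : ‖α‖ ^ 2 - ‖β‖ ^ 2 = 1)
    {m : ℂ → ℂ} (hm : DifferentiableOn ℂ m disc)
    (hn : ∀ z ∈ disc, ‖m z‖ = ‖den α β z‖ ^ (-s)) (v : Hilb s) {z : ℂ} (hz : z ∈ disc) :
    hol (transform h hm hn v) z = m z * hol v (mob α β z) :=
  hol_ofHol (hm.mul ((hol_diff v).comp (mob_diff h) fun _ hz => mob_mem h hz))
    (transform_memLp h hm hn (hol_diff v) (memLp_hol v)) hz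

lemma G.α_mul (x y : G) : (x * y).α = x.α * y.α + x.β * conj y.β := by
  have ha : (x.a : ℂ) ≠ 0 := by exact_mod_cast x.a_pos.ne'
  have hb : (y.a : ℂ) ≠ 0 := by exact_mod_cast y.a_pos.ne'
  simp only [G.α, G.β, G.a_mul, G.b_mul]
  simp only [map_div₀, map_add, map_sub, map_mul, Complex.conj_I, Complex.conj_ofReal, map_inv₀,
    Complex.ofReal_mul, Complex.ofReal_add, Complex.ofReal_inv, map_ofNat]
  field_simp
  ring_nf
  simp only [Complex.I_sq]
  ring

lemma G.β_mul (x y : G) : (x * y).β = x.α * y.β + x.β * conj y.α := by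
  have ha : (x.a : ℂ) ≠ 0 := by exact_mod_cast x.a_pos.ne'
  have hb : (y.a : ℂ) ≠ 0 := by exact_mod_cast y.a_pos.ne'
  simp only [G.α, G.β, G.a_mul, G.b_mul]
  simp only [map_div₀, map_add, map_mul, Complex.conj_I, Complex.conj_ofReal, map_inv₀,
    Complex.ofReal_mul, Complex.ofReal_add, Complex.ofReal_inv, map_ofNat]
  field_simp
  ring_nf
  simp only [Complex.I_sq]
  ring

lemma den_mul (x y : G) {z : ℂ} (hz : z ∈ disc) :
    den (x * y).α (x * y).β z = den x.α x.β z * den y.α y.β (mob x.α x.β z) := by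
  have h0 := den_ne x.norm_sub hz
  rw [G.α_mul, G.β_mul, den, den.eq_1 y.α, mob]
  field_simp
  simp only [den, map_add, map_mul, Complex.conj_conj]
  ring

lemma mob_mul (x y : G) {z : ℂ} (hz : z ∈ disc) :
    mob (x * y).α (x * y).β z = mob y.α y.β (mob x.α x.β z) := by
  have h0 := den_ne x.norm_sub hz
  have h1 := den_ne y.norm_sub (mob_mem x.norm_sub hz)
  rw [mob, den_mul x y hz, mob.eq_1 y.α, div_eq_div_iff (mul_ne_zero h0 h1) h1, mob]
  field_simp
  rw [G.α_mul, G.β_mul]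
  simp only [den, map_add, map_mul, Complex.conj_conj]
  ring

lemma re_pos_of_disc {z : ℂ} (hz : z ∈ disc) : 0 < (1 + Complex.I * z).re := by
  rw [mem_disc] at hz
  have := (abs_le.mp (Complex.abs_im_le_norm z)).2
  simp
  linarith

lemma log_den (x : G) {z : ℂ} (hz : z ∈ disc) :
    Complex.log (den x.α x.β z) = (Real.log x.a : ℂ) + Complex.log (1 + Complex.I * z) -
      Complex.log (1 + Complex.I * mob x.α x.β z) ∧ den x.α x.β z ∈ Complex.slitPlane := by
  have h0 := den_ne x.norm_sub hz
  have h1 := re_pos_of_disc hz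
  have h2 := re_pos_of_disc (mob_mem x.norm_sub hz)
  have n1 : 1 + Complex.I * z ≠ 0 := fun h => by rw [h] at h1; simp at h1
  have n2 : 1 + Complex.I * mob x.α x.β z ≠ 0 := fun h => by rw [h] at h2; simp at h2
  have ha : (x.a : ℂ) ≠ 0 := by exact_mod_cast x.a_pos.ne'
  have key : den x.α x.β z * (1 + Complex.I * mob x.α x.β z) = x.a * (1 + Complex.I * z) := by
    rw [mob]
    field_simp
    simp only [den, G.α, G.β, map_div₀, map_add, map_sub, map_mul, Complex.conj_I,
      Complex.conj_ofReal, map_inv₀, map_ofNat]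
    field_simp
    ring_nf
    simp only [Complex.I_sq]
    ring
  have hexp : den x.α x.β z = Complex.exp ((Real.log x.a : ℂ) + Complex.log (1 + Complex.I * z) -
      Complex.log (1 + Complex.I * mob x.α x.β z)) := by
    rw [Complex.exp_sub, Complex.exp_add, Complex.exp_log n1, Complex.exp_log n2,
      Complex.ofReal_log x.a_pos.le, Complex.exp_log ha, eq_div_iff n2, key]
  have a1 := Complex.abs_arg_lt_pi_div_two_iff.mpr (Or.inl h1)
  have a2 := Complex.abs_arg_lt_pi_div_two_iff.mpr (Or.inl h2)
  rw [abs_lt] at a1 a2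
  have him : ((Real.log x.a : ℂ) + Complex.log (1 + Complex.I * z) -
      Complex.log (1 + Complex.I * mob x.α x.β z)).im =
      (1 + Complex.I * z).arg - (1 + Complex.I * mob x.α x.β z).arg := by
    simp [Complex.log_im]
  have hlog : Complex.log (den x.α x.β z) = (Real.log x.a : ℂ) + Complex.log (1 + Complex.I * z) -
      Complex.log (1 + Complex.I * mob x.α x.β z) := by
    conv_lhs => rw [hexp]
    rw [Complex.log_exp]
    · rw [him]; linarith
    · rw [him]; linarith
  refine ⟨hlog, Complex.mem_slitPlane_iff_arg.mpr ⟨?_, h0⟩⟩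
  rw [← Complex.log_im, hlog, him]
  linarith

lemma den_diff (α β : ℂ) : Differentiable ℂ (den α β) := by
  unfold den
  fun_prop

/-- The discrete series representation on `H_s`, restricted to `G`:
`π_s(x) v(z) = (-conj β z + α) ^ (-s) * v ((conj α z - β) / (-conj β z + α))`.
The numbers `-conj β z + α` with `x ∈ G` and `|z| < 1` are never in `(-∞, 0]`, so that the
principal branch of the power is the branch that is continuous in `x` and `z`. -/
def rep (s : ℝ) [Fact (1 < s)] (x : G) : Hilb s →ₗ[ℂ] Hilb s :=
  transform (α := x.α) (β := x.β) (m := fun z => den x.α x.β z ^ (-(s : ℂ))) x.norm_sub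
    (fun z hz => (((den_diff x.α x.β) z).cpow_const (log_den x hz).2).differentiableWithinAt)
    (fun z _ => by
      rw [← Complex.ofReal_neg]
      exact Complex.norm_cpow_real _ _)

lemma hol_rep {s : ℝ} [Fact (1 < s)] (x : G) (v : Hilb s) {z : ℂ} (hz : z ∈ disc) :
    hol (rep s x v) z = (-conj x.β * z + x.α) ^ (-(s : ℂ)) *
      hol v ((conj x.α * z - x.β) / (-conj x.β * z + x.α)) :=
  hol_transform _ _ _ v hz

lemma hol_rep' {s : ℝ} [Fact (1 < s)] (x : G) (v : Hilb s) {z : ℂ} (hz : z ∈ disc) :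
    hol (rep s x v) z = den x.α x.β z ^ (-(s : ℂ)) * hol v (mob x.α x.β z) :=
  hol_rep x v hz

lemma rep_mul {s : ℝ} [Fact (1 < s)] (x y : G) (v : Hilb s) :
    rep s (x * y) v = rep s x (rep s y v) := by
  apply hilb_ext
  intro z hz
  have h0 := den_ne x.norm_sub hz
  have h1 := den_ne y.norm_sub (mob_mem x.norm_sub hz)
  rw [hol_rep' _ _ hz, hol_rep' _ _ hz, hol_rep' _ _ (mob_mem x.norm_sub hz), mob_mul x y hz,
    ← mul_assoc]
  congr 1
  rw [Complex.cpow_def_of_ne_zero (den_ne (x * y).norm_sub hz), Complex.cpow_def_of_ne_zero h0,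
    Complex.cpow_def_of_ne_zero h1, ← Complex.exp_add, (log_den (x * y) hz).1, (log_den x hz).1,
    (log_den y (mob_mem x.norm_sub hz)).1, mob_mul x y hz, G.a_mul,
    Real.log_mul x.a_pos.ne' y.a_pos.ne']
  congr 1
  push_cast
  ring

/-- The action on `H_s` of the rotation with `α = exp (iθ)`, `β = 0`, as an element of the
universal covering group of `SU(1,1)`: `v(z) ↦ exp (-isθ) * v (exp (-2iθ) z)`. -/
def rot (s : ℝ) [Fact (1 < s)] (θ : ℝ) : Hilb s →ₗ[ℂ] Hilb s :=
  transform (α := Complex.exp (θ * Complex.I)) (β := 0)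
    (m := fun _ => Complex.exp (-(s * θ : ℝ) * Complex.I))
    (by rw [Complex.norm_exp_ofReal_mul_I]; simp)
    (differentiableOn_const _)
    (fun z _ => by
      rw [← Complex.ofReal_neg, Complex.norm_exp_ofReal_mul_I, den, map_zero, neg_zero, zero_mul,
        zero_add, Complex.norm_exp_ofReal_mul_I, Real.one_rpow])

lemma hol_rot {s : ℝ} [Fact (1 < s)] (θ : ℝ) (v : Hilb s) {z : ℂ} (hz : z ∈ disc) :
    hol (rot s θ v) z = Complex.exp (-(s * θ : ℝ) * Complex.I) *
      hol v (Complex.exp (-(2 * θ : ℝ) * Complex.I) * z) := by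
  rw [rot, hol_transform _ _ _ v hz]
  congr 2
  rw [mob, den, ← Complex.exp_conj, map_zero, neg_zero, zero_mul, zero_add, sub_zero,
    mul_div_right_comm, ← Complex.exp_sub]
  congr 2
  simp
  ring

/-! ### Smooth vectors -/

/-- The orbit map of `v` under the universal covering group of `SU(1,1)` in the global Iwasawa
coordinates `(θ, t, b)` of the group, which stand for the product of the rotation by `θ` and the
element `(exp t, b; 0, exp (-t))` of `G`. -/
def orbit {s : ℝ} [Fact (1 < s)] (v : Hilb s) (q : ℝ × ℝ × ℝ) : Lp ℂ 2 (discMeasure s) :=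
  (rot s q.1 (rep s (G.mk (Real.exp q.2.1) q.2.2 (Real.exp_pos _)) v) : Hilb s)

lemma orbit_add {s : ℝ} [Fact (1 < s)] (v w : Hilb s) : orbit (v + w) = orbit v + orbit w := by
  funext q
  simp [orbit]

lemma orbit_smul {s : ℝ} [Fact (1 < s)] (c : ℂ) (v : Hilb s) : orbit (c • v) = c • orbit v := by
  funext q
  simp [orbit]

/-- The smooth vectors of the discrete series representation: the vectors whose orbit map is
`C^∞`. -/
def smoothVectors (s : ℝ) [Fact (1 < s)] : Submodule ℂ (Hilb s) where
  carrier := {v | ContDiff ℝ ∞ (orbit v)}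
  zero_mem' := by
    have : orbit (0 : Hilb s) = 0 := by
      funext q
      simp [orbit]
    rw [Set.mem_ofPred_eq, this]
    exact contDiff_const
  add_mem' := by
    intro v w hv hw
    rw [Set.mem_ofPred_eq] at hv hw
    rw [Set.mem_ofPred_eq, orbit_add]
    exact hv.add hw
  smul_mem' := by
    intro c v hv
    rw [Set.mem_ofPred_eq] at hv
    rw [Set.mem_ofPred_eq, orbit_smul]
    exact hv.const_smul c

/-- The space `H_s^∞` of smooth vectors (with its own topology, see below). -/
def SmoothVec (s : ℝ) [Fact (1 < s)] : Type := ↥(smoothVectors s)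

instance (s : ℝ) [Fact (1 < s)] : AddCommGroup (SmoothVec s) :=
  inferInstanceAs (AddCommGroup ↥(smoothVectors s))

instance (s : ℝ) [Fact (1 < s)] : Module ℂ (SmoothVec s) :=
  inferInstanceAs (Module ℂ ↥(smoothVectors s))

/-- The inclusion of the smooth vectors in `H_s`. -/
def SmoothVec.toHilb {s : ℝ} [Fact (1 < s)] : SmoothVec s →ₗ[ℂ] Hilb s :=
  (smoothVectors s).subtype

lemma SmoothVec.contDiff {s : ℝ} [Fact (1 < s)] (v : SmoothVec s) :
    ContDiff ℝ ∞ (orbit v.toHilb) := v.2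

/-- The norm of the `n`-th derivative of the orbit map at a point. -/
def jetSeminorm (s : ℝ) [Fact (1 < s)] (n : ℕ) (q : ℝ × ℝ × ℝ) : Seminorm ℂ (SmoothVec s) :=
  Seminorm.of (fun v => ‖iteratedFDeriv ℝ n (orbit v.toHilb) q‖)
    (fun v w => by
      have hn : ((n : ℕ∞) : WithTop ℕ∞) ≤ ∞ := by exact_mod_cast le_top
      rw [map_add, orbit_add, iteratedFDeriv_add (v.contDiff.of_le hn) (w.contDiff.of_le hn)]
      exact norm_add_le _ _)
    (fun c v => by
      have hn : ((n : ℕ∞) : WithTop ℕ∞) ≤ ∞ := by exact_mod_cast le_top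
      rw [map_smul, orbit_smul, iteratedFDeriv_const_smul_apply (v.contDiff.of_le hn).contDiffAt,
        norm_smul])

/-- The seminorms `v ↦ sup {‖Dⁿ(orbit v)(q)‖ : ‖q‖ ≤ R}`, `n, R ∈ ℕ`, on the smooth vectors. -/
def smoothSeminorm (s : ℝ) [Fact (1 < s)] : SeminormFamily ℂ (SmoothVec s) (ℕ × ℕ) :=
  fun k => ⨆ q : Metric.closedBall (0 : ℝ × ℝ × ℝ) k.2, jetSeminorm s k.1 q

lemma smoothSeminorm_apply (s : ℝ) [Fact (1 < s)] (n R : ℕ) (v : SmoothVec s) :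
    BddAbove (Set.range fun q : Metric.closedBall (0 : ℝ × ℝ × ℝ) R =>
      ‖iteratedFDeriv ℝ n (orbit v.toHilb) q‖) ∧
    smoothSeminorm s (n, R) v = ⨆ q : Metric.closedBall (0 : ℝ × ℝ × ℝ) R,
      ‖iteratedFDeriv ℝ n (orbit v.toHilb) q‖ := by
  have hb : ∀ w : SmoothVec s, BddAbove (Set.range fun q : Metric.closedBall (0 : ℝ × ℝ × ℝ) R =>
      ‖iteratedFDeriv ℝ n (orbit w.toHilb) q‖) := by
    intro w
    have hn : ((n : ℕ∞) : WithTop ℕ∞) ≤ ∞ := by exact_mod_cast le_top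
    have hc : Continuous (iteratedFDeriv ℝ n (orbit w.toHilb)) :=
      w.contDiff.continuous_iteratedFDeriv hn
    have := (isCompact_closedBall (0 : ℝ × ℝ × ℝ) R).bddAbove_image hc.norm.continuousOn
    rwa [Set.image_eq_range] at this
  refine ⟨hb v, ?_⟩
  rw [smoothSeminorm, Seminorm.iSup_apply]
  · rfl
  · exact Seminorm.bddAbove_range_iff.mpr hb

/-- The Fréchet topology of `H_s^∞`: the one induced by the `C^∞` topology on orbit maps, that is,
by uniform convergence on compact sets of all derivatives. -/
instance (s : ℝ) [Fact (1 < s)] : TopologicalSpace (SmoothVec s) :=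
  (smoothSeminorm s).moduleFilterBasis.topology

lemma withSeminorms (s : ℝ) [Fact (1 < s)] : WithSeminorms (smoothSeminorm s) := ⟨rfl⟩

lemma orbit_rep {s : ℝ} [Fact (1 < s)] (x : G) (v : Hilb s) (q : ℝ × ℝ × ℝ) :
    orbit (rep s x v) q = orbit v (q.1, q.2.1 + Real.log x.a,
      Real.exp q.2.1 * x.b + q.2.2 * x.a⁻¹) := by
  rw [orbit, orbit, ← rep_mul]
  congr 3
  congr 1
  apply G.ext
  · simp [G.a_mul, Real.exp_add, Real.exp_log x.a_pos]
  · simp [G.b_mul]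

lemma rep_smooth {s : ℝ} [Fact (1 < s)] (x : G) {v : Hilb s} (hv : ContDiff ℝ ∞ (orbit v)) :
    ContDiff ℝ ∞ (orbit (rep s x v)) := by
  have : orbit (rep s x v) = orbit v ∘ fun q : ℝ × ℝ × ℝ => (q.1, q.2.1 + Real.log x.a,
      Real.exp q.2.1 * x.b + q.2.2 * x.a⁻¹) := funext fun q => orbit_rep x v q
  rw [this]
  refine hv.comp ?_
  fun_prop

/-- The representation of `G` on the smooth vectors. -/
def smoothRep (s : ℝ) [Fact (1 < s)] (x : G) : SmoothVec s →ₗ[ℂ] SmoothVec s :=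
  (rep s x).restrict fun _ hv => rep_smooth x hv

lemma smoothRep_toHilb {s : ℝ} [Fact (1 < s)] (x : G) (v : SmoothVec s) :
    (smoothRep s x v).toHilb = rep s x v.toHilb := rfl

/-! ### The wavelet -/

lemma isFiniteMeasure_disc (s : ℝ) [hs : Fact (1 < s)] : IsFiniteMeasure (discMeasure s) := by
  have h1 : IntegrableOn (fun y : ℝ => (s - 1) / Real.pi * (1 - y ^ 2) ^ (s - 2) * y)
      (Set.Ioo 0 1) := by
    have h2 : IntegrableOn (fun y : ℝ => (1 - y) ^ (s - 2)) (Set.Ioo 0 1) := by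
      have := (intervalIntegral.intervalIntegrable_rpow' (a := 0) (b := 1)
        (r := s - 2) (by linarith [hs.out])).comp_sub_left 1
      simp only [sub_zero, sub_self] at this
      exact (intervalIntegrable_iff_integrableOn_Ioo_of_le zero_le_one).mp this.symm
    have h4 : IntegrableOn (fun y : ℝ => (1 - y) ^ (s - 2) *
        ((s - 1) / Real.pi * (1 + y) ^ (s - 2) * y)) (Set.Icc 0 1) := by
      refine IntegrableOn.mul_continuousOn ((integrableOn_Icc_iff_integrableOn_Ioo).mpr h2) ?_
        isCompact_Icc
      refine ContinuousOn.mul (ContinuousOn.mul continuousOn_const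
        (ContinuousOn.rpow_const (by fun_prop) ?_)) continuousOn_id
      intro y hy
      left
      linarith [hy.1]
    refine ((integrableOn_Icc_iff_integrableOn_Ioo).mp h4).congr_fun (fun y hy => ?_)
      measurableSet_Ioo
    have h5 : (1 - y ^ 2) = (1 - y) * (1 + y) := by ring
    simp only [h5]
    rw [Real.mul_rpow (by linarith [hy.2]) (by linarith [hy.1])]
    ring
  have h3 : IntegrableOn (fun z : ℂ => (s - 1) / Real.pi * (1 - ‖z‖ ^ 2) ^ (s - 2)) disc := by
    have := (integrableOn_fun_norm_addHaar (volume : Measure ℂ)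
      (f := fun y : ℝ => (s - 1) / Real.pi * (1 - y ^ 2) ^ (s - 2)) (r := 1)).mpr (by
        simpa [Complex.finrank_real_complex, mul_comm] using h1)
    exact this
  constructor
  rw [discMeasure, withDensity_apply _ MeasurableSet.univ, Measure.restrict_univ]
  exact h3.lintegral_lt_top

lemma exists_analytic (s : ℝ) [Fact (1 < s)] : ∃ E : ℂ → Lp ℂ 2 (discMeasure s),
    DifferentiableOn ℂ E (Metric.ball 0 1) ∧ ∀ q ∈ Metric.ball (0 : ℂ) 1,
      E q =ᵐ[discMeasure s] fun z => (1 - q * z) ^ (-(s : ℂ)) := by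
  have := isFiniteMeasure_disc s
  have hd : ∀ z : ℂ, ‖((max 1 ‖z‖ : ℝ) : ℂ)⁻¹ * z‖ ≤ 1 := by
    intro z
    have : (0 : ℝ) < max 1 ‖z‖ := by positivity
    rw [norm_mul, norm_inv, Complex.norm_real, Real.norm_of_nonneg this.le, inv_mul_le_one₀ this]
    exact le_max_right _ _
  have hcont : Continuous fun z : ℂ => ((max 1 ‖z‖ : ℝ) : ℂ)⁻¹ * z := by
    refine Continuous.mul (Continuous.inv₀ (by fun_prop) ?_) continuous_id
    intro z
    have : (0 : ℝ) < max 1 ‖z‖ := by positivity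
    exact_mod_cast this.ne'
  let Z : BoundedContinuousFunction ℂ ℂ := BoundedContinuousFunction.ofNormedAddCommGroup
    (fun z : ℂ => ((max 1 ‖z‖ : ℝ) : ℂ)⁻¹ * z) hcont 1 hd
  have hZ : ‖Z‖ ≤ 1 := BoundedContinuousFunction.norm_ofNormedAddCommGroup_le _ zero_le_one hd
  have hZn : ∀ n : ℕ, ‖Z ^ n‖ ≤ 1 := fun n =>
    (norm_pow_le Z n).trans (pow_le_one₀ (norm_nonneg _) hZ)
  have hZz : ∀ z ∈ disc, Z z = z := by
    intro z hz
    rw [mem_disc] at hz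
    change ((max 1 ‖z‖ : ℝ) : ℂ)⁻¹ * z = z
    rw [max_eq_left hz.le]
    simp
  let c : ℕ → ℂ := fun n => Ring.choose ((s : ℂ) + n - 1) n
  have hser := Complex.one_div_one_sub_cpow_hasFPowerSeriesOnBall_zero (s : ℂ)
  have hsum : ∀ ρ : NNReal, ρ < 1 → Summable fun n => ‖c n‖ * (ρ : ℝ) ^ n := by
    intro ρ hρ
    have h1 : (ρ : ENNReal) < (FormalMultilinearSeries.ofScalars ℂ
        fun n : ℕ => (Ring.choose ((s : ℂ) + n - 1) n : ℂ)).radius :=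
      lt_of_lt_of_le (by exact_mod_cast hρ) hser.r_le
    have := FormalMultilinearSeries.summable_norm_mul_pow _ h1
    simpa [FormalMultilinearSeries.ofScalars_norm] using this
  let E' : ℂ → BoundedContinuousFunction ℂ ℂ := fun q => ∑' n, (c n * q ^ n) • Z ^ n
  have hterm : ∀ ρ : NNReal, ∀ q ∈ Metric.ball (0 : ℂ) ρ, ∀ n,
      ‖(c n * q ^ n) • Z ^ n‖ ≤ ‖c n‖ * (ρ : ℝ) ^ n := by
    intro ρ q hq n
    rw [norm_smul, norm_mul, norm_pow]
    have hq' : ‖q‖ ≤ ρ := by simpa using (Metric.mem_ball.mp hq).le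
    calc ‖c n‖ * ‖q‖ ^ n * ‖Z ^ n‖ ≤ ‖c n‖ * (ρ : ℝ) ^ n * 1 := by
          gcongr
          exact hZn n
      _ = _ := mul_one _
  have hE' : DifferentiableOn ℂ E' (Metric.ball 0 1) := by
    intro q hq
    rw [Metric.mem_ball, dist_zero_right] at hq
    obtain ⟨ρ, h1, h2⟩ := exists_between hq
    lift ρ to NNReal using (norm_nonneg q).trans h1.le
    have h3 := Complex.differentiableOn_tsum_of_summable_norm (hsum ρ (by exact_mod_cast h2))
      (fun n => (((differentiableOn_id.pow n).const_mul (c n)).smul_const (Z ^ n)))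
      (Metric.isOpen_ball (x := (0 : ℂ)) (ε := ρ)) (fun n q hq => hterm ρ q hq n)
    exact ((h3 q (by simpa using h1)).differentiableAt
      (Metric.isOpen_ball.mem_nhds (by simpa using h1))).differentiableWithinAt
  have hval : ∀ q ∈ Metric.ball (0 : ℂ) 1, ∀ z ∈ disc, E' q z = (1 - q * z) ^ (-(s : ℂ)) := by
    intro q hq z hz
    rw [Metric.mem_ball, dist_zero_right] at hq
    obtain ⟨ρ, h1, h2⟩ := exists_between hq
    lift ρ to NNReal using (norm_nonneg q).trans h1.le
    have h3 : HasSum (fun n => (c n * q ^ n) • Z ^ n) (E' q) :=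
      (Summable.of_norm_bounded (hsum ρ (by exact_mod_cast h2))
        (hterm ρ q (by simpa using h1))).hasSum
    have h4 := h3.mapL (BoundedContinuousFunction.evalCLM ℂ z)
    have hqz : q * z ∈ Metric.eball (0 : ℂ) 1 := by
      rw [mem_disc] at hz
      have : ‖q * z‖ < 1 := by
        rw [norm_mul]
        exact mul_lt_one_of_nonneg_of_lt_one_left (norm_nonneg _) hq hz.le
      rw [← ENNReal.ofReal_one, Metric.eball_ofReal]
      simpa using this
    have h5 := hser.hasSum hqz
    have h6 : (fun n => BoundedContinuousFunction.evalCLM ℂ z ((c n * q ^ n) • Z ^ n)) =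
        fun n => (FormalMultilinearSeries.ofScalars ℂ
          fun n : ℕ => (Ring.choose ((s : ℂ) + n - 1) n : ℂ)) n fun _ => q * z := by
      funext n
      simp [c, hZz z hz, mul_pow]
      ring
    rw [h6] at h4
    have h7 := h4.unique h5
    simp only [BoundedContinuousFunction.evalCLM_apply, zero_add] at h7
    rw [h7, Complex.cpow_neg, one_div]
  refine ⟨fun q => BoundedContinuousFunction.toLp 2 (discMeasure s) ℂ (E' q), ?_, ?_⟩
  · exact (BoundedContinuousFunction.toLp 2 (discMeasure s) ℂ).differentiable.comp_differentiableOn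
      hE'
  · intro q hq
    exact (BoundedContinuousFunction.coeFn_toLp _ _ ℂ (E' q)).trans
      (ae_of_eqOn fun z hz => hval q hq z hz)

/-- The wavelet `u = 1` as an element of `H_s`. -/
def one (s : ℝ) [Fact (1 < s)] : Hilb s :=
  ofHol (fun _ => 1) (differentiableOn_const _)
    (by
      have := isFiniteMeasure_disc s
      exact memLp_const 1)

lemma hol_one (s : ℝ) [Fact (1 < s)] {z : ℂ} (hz : z ∈ disc) : hol (one s) z = 1 :=
  hol_ofHol (F := fun _ => 1) (differentiableOn_const _)
    (by
      have := isFiniteMeasure_disc s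
      exact memLp_const 1) hz

lemma G.α_re (x : G) : 0 < x.α.re := by
  have := x.a_pos
  have h : x.α.re = (x.a + x.a⁻¹) / 2 := by simp [G.α, ← Complex.ofReal_inv]
  rw [h]
  positivity

lemma G.α_ne (x : G) : x.α ≠ 0 := fun h => by
  have := x.α_re
  rw [h] at this
  simp at this

lemma G.norm_κ (x : G) : ‖conj x.β / x.α‖ < 1 := by
  rw [norm_div, Complex.norm_conj, div_lt_one (norm_pos_iff.mpr x.α_ne)]
  nlinarith [x.norm_sub, norm_nonneg x.α, norm_nonneg x.β]

lemma den_cpow (x : G) (c : ℂ) {z : ℂ} (hz : z ∈ disc) :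
    den x.α x.β z ^ c = x.α ^ c * (1 - conj x.β / x.α * z) ^ c := by
  have h0 := x.α_ne
  have h2 : den x.α x.β z = x.α * (1 - conj x.β / x.α * z) := by
    rw [den]
    field_simp
    ring
  have h3 : 0 < (1 - conj x.β / x.α * z).re := by
    rw [mem_disc] at hz
    have h4 : ‖conj x.β / x.α * z‖ < 1 := by
      rw [norm_mul]
      exact mul_lt_one_of_nonneg_of_lt_one_left (norm_nonneg _) x.norm_κ hz.le
    have := (abs_le.mp (Complex.abs_re_le_norm (conj x.β / x.α * z))).2
    rw [Complex.sub_re, Complex.one_re]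
    linarith
  have h4 : 1 - conj x.β / x.α * z ≠ 0 := fun h => by rw [h] at h3; simp at h3
  have a1 := abs_lt.mp (Complex.abs_arg_lt_pi_div_two_iff.mpr (Or.inl x.α_re))
  have a2 := abs_lt.mp (Complex.abs_arg_lt_pi_div_two_iff.mpr (Or.inl h3))
  rw [h2, Complex.cpow_def_of_ne_zero (mul_ne_zero h0 h4), Complex.cpow_def_of_ne_zero h0,
    Complex.cpow_def_of_ne_zero h4, ← Complex.exp_add, Complex.log_mul h0 h4]
  · ring_nf
  · constructor <;> linarith

lemma one_smooth (s : ℝ) [Fact (1 < s)] : one s ∈ smoothVectors s := by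
  obtain ⟨E, hE, hEv⟩ := exists_analytic s
  let g : ℝ × ℝ × ℝ → G := fun q => G.mk (Real.exp q.2.1) q.2.2 (Real.exp_pos _)
  let A : ℝ × ℝ × ℝ → ℂ := fun q => Complex.exp (-(s * q.1 : ℝ) * Complex.I) *
    (g q).α ^ (-(s : ℂ))
  let K : ℝ × ℝ × ℝ → ℂ := fun q => conj (g q).β / (g q).α *
    Complex.exp (-(2 * q.1 : ℝ) * Complex.I)
  have hK1 : ∀ q, K q ∈ Metric.ball (0 : ℂ) 1 := by
    intro q
    rw [Metric.mem_ball, dist_zero_right]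
    change ‖conj (g q).β / (g q).α * Complex.exp (-(2 * q.1 : ℝ) * Complex.I)‖ < 1
    rw [norm_mul, ← Complex.ofReal_neg, Complex.norm_exp_ofReal_mul_I, mul_one]
    exact (g q).norm_κ
  have horb : orbit (one s) = fun q => A q • E (K q) := by
    funext q
    refine Lp.ext ?_
    refine ((hol_ae _).trans ?_).trans (Lp.coeFn_smul (A q) (E (K q))).symm
    have h1 : (A q • (E (K q) : ℂ → ℂ)) =ᵐ[discMeasure s]
        A q • fun z => (1 - K q * z) ^ (-(s : ℂ)) := (hEv _ (hK1 q)).const_smul (A q)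
    refine Filter.EventuallyEq.trans ?_ h1.symm
    refine ae_of_eqOn fun z hz => ?_
    have hz' : Complex.exp (-(2 * q.1 : ℝ) * Complex.I) * z ∈ disc := by
      rw [mem_disc] at hz ⊢
      rwa [norm_mul, ← Complex.ofReal_neg, Complex.norm_exp_ofReal_mul_I, one_mul]
    rw [hol_rot _ _ hz, hol_rep' _ _ hz', hol_one s (mob_mem (g q).norm_sub hz'), mul_one,
      den_cpow _ _ hz', Pi.smul_apply, smul_eq_mul, mul_assoc, mul_assoc]
  have hα : ContDiff ℝ ∞ fun q => (g q).α := by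
    simp only [g, G.α, G.mk_a, G.mk_b, ← Complex.ofReal_inv, ← Real.exp_neg]
    have h1 : ContDiff ℝ ∞ (fun x : ℝ => (x : ℂ)) := Complex.ofRealCLM.contDiff
    fun_prop
  have hβ : ContDiff ℝ ∞ fun q => conj (g q).β := by
    have h1 : ContDiff ℝ ∞ (fun x : ℝ => (x : ℂ)) := Complex.ofRealCLM.contDiff
    have h2 : ContDiff ℝ ∞ fun q => (g q).β := by
      simp only [g, G.β, G.mk_a, G.mk_b, ← Complex.ofReal_inv, ← Real.exp_neg]
      fun_prop
    exact Complex.conjCLE.contDiff.comp h2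
  have hexp : ∀ c : ℝ, ContDiff ℝ ∞ fun q : ℝ × ℝ × ℝ =>
      Complex.exp (-(c * q.1 : ℝ) * Complex.I) := by
    intro c
    have h1 : ContDiff ℝ ∞ (fun x : ℝ => (x : ℂ)) := Complex.ofRealCLM.contDiff
    refine ContDiff.cexp ?_
    fun_prop
  have hA : ContDiff ℝ ∞ A := by
    refine (hexp s).mul ?_
    have hlog : ContDiff ℝ ∞ fun q => Complex.exp (Complex.log (g q).α * (-(s : ℂ))) := by
      refine ContDiff.cexp (ContDiff.mul ?_ contDiff_const)
      refine contDiff_iff_contDiffAt.mpr fun q => ?_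
      have h1 : ContDiffAt ℂ ∞ Complex.log (g q).α :=
        Complex.contDiffAt_log (Or.inl (g q).α_re)
      exact (h1.restrict_scalars ℝ).comp q hα.contDiffAt
    have hpow : (fun q => (g q).α ^ (-(s : ℂ))) =
        fun q => Complex.exp (Complex.log (g q).α * (-(s : ℂ))) :=
      funext fun q => Complex.cpow_def_of_ne_zero (g q).α_ne _
    rw [hpow]
    exact hlog
  have hK : ContDiff ℝ ∞ K := (hβ.mul (hα.inv fun q => (g q).α_ne)).mul (hexp 2)
  have hE2 : ContDiffOn ℝ ∞ E (Metric.ball 0 1) :=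
    (hE.contDiffOn Metric.isOpen_ball).restrict_scalars ℝ
  change ContDiff ℝ ∞ (orbit (one s))
  rw [horb]
  refine hA.smul ?_
  refine contDiff_iff_contDiffAt.mpr fun q => ?_
  exact (hE2.contDiffAt (Metric.isOpen_ball.mem_nhds (hK1 q))).comp q hK.contDiffAt

/-- The wavelet `u = 1` as a smooth vector. -/
def wavelet (s : ℝ) [Fact (1 < s)] : SmoothVec s := ⟨one s, one_smooth s⟩

lemma smoothSeminorm_bound {s : ℝ} [Fact (1 < s)] (n R : ℕ) (v : SmoothVec s) {q : ℝ × ℝ × ℝ}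
    (hq : ‖q‖ ≤ R) : ‖iteratedFDeriv ℝ n (orbit v.toHilb) q‖ ≤ smoothSeminorm s (n, R) v := by
  obtain ⟨h1, h2⟩ := smoothSeminorm_apply s n R v
  rw [h2]
  exact le_ciSup h1 ⟨q, by simpa using hq⟩

lemma smoothRep_continuous {s : ℝ} [Fact (1 < s)] (x : G) : Continuous (smoothRep s x) := by
  refine WithSeminorms.continuous_of_isBounded (withSeminorms s) (withSeminorms s) (smoothRep s x) ?_
  rintro ⟨n, R⟩
  let T : ℝ × ℝ × ℝ → ℝ × ℝ × ℝ := fun q => (q.1, q.2.1 + Real.log x.a,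
      Real.exp q.2.1 * x.b + q.2.2 * x.a⁻¹)
  have hT : ContDiff ℝ ∞ T := by
    simp only [T]
    fun_prop
  have hle : ∀ i : ℕ, ((i : ℕ∞) : WithTop ℕ∞) ≤ ∞ := fun i => by exact_mod_cast le_top
  have hK := isCompact_closedBall (0 : ℝ × ℝ × ℝ) R
  obtain ⟨R', hR'⟩ := hK.exists_bound_of_continuousOn hT.continuous.continuousOn
  obtain ⟨M, hM⟩ := exists_nat_ge R'
  have hD : ∀ i : ℕ, ∃ C, ∀ q ∈ Metric.closedBall (0 : ℝ × ℝ × ℝ) R,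
      ‖iteratedFDeriv ℝ i T q‖ ≤ C := fun i =>
    hK.exists_bound_of_continuousOn (hT.continuous_iteratedFDeriv (hle i)).continuousOn
  choose C hC using hD
  let D : ℝ := 1 + ∑ i ∈ Finset.range (n + 1), |C i|
  have hD1 : 1 ≤ D := le_add_of_nonneg_right (Finset.sum_nonneg fun _ _ => abs_nonneg _)
  have hDi : ∀ i ≤ n, C i ≤ D := fun i hi =>
    (le_abs_self _).trans ((Finset.single_le_sum (f := fun i => |C i|) (fun _ _ => abs_nonneg _)
      (Finset.mem_range.mpr (Nat.lt_succ_of_le hi))).trans (by simp [D]))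
  let F : Finset (ℕ × ℕ) := (Finset.range (n + 1)).image fun i => (i, M)
  refine ⟨F, ⟨(n.factorial : ℝ) * D ^ n, by positivity⟩, ?_⟩
  intro v
  rw [Seminorm.comp_apply, (smoothSeminorm_apply s n R _).2]
  have : Nonempty (Metric.closedBall (0 : ℝ × ℝ × ℝ) R) := ⟨⟨0, by simp⟩⟩
  refine ciSup_le ?_
  rintro ⟨q, hq⟩
  have horb : orbit (smoothRep s x v).toHilb = orbit v.toHilb ∘ T :=
    funext fun q => orbit_rep x _ q
  rw [horb]
  have h1 := norm_iteratedFDeriv_comp_le (n := n) v.contDiff hT (hle n) q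
    (C := F.sup (smoothSeminorm s) v) (D := D)
    (fun i hi => (smoothSeminorm_bound i M v ((hR' q hq).trans hM)).trans
      (Seminorm.le_finset_sup_apply (Finset.mem_image_of_mem (fun i => (i, M))
        (Finset.mem_range.mpr (Nat.lt_succ_of_le hi)))))
    (fun i hi1 hi => ((hC i q hq).trans (hDi i hi)).trans (le_self_pow₀ hD1 (by omega)))
  refine h1.trans (le_of_eq ?_)
  change _ = ((n.factorial : ℝ) * D ^ n) * (F.sup (smoothSeminorm s)) v
  ring

/-! ### Coorbit spaces -/

/-- The conjugate dual `(H_s^∞)^*`: the continuous conjugate linear functionals on `H_s^∞`. -/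
abbrev DistVec (s : ℝ) [Fact (1 < s)] : Type := SmoothVec s →L⋆[ℂ] ℂ

/-- The contragredient representation of `G` on `(H_s^∞)^*`:
`⟨π_s^*(x) φ, v⟩ = ⟨φ, π_s(x⁻¹) v⟩`. -/
def distRep {s : ℝ} [Fact (1 < s)] (x : G) (φ : DistVec s) : DistVec s :=
  φ.comp ⟨smoothRep s x⁻¹, smoothRep_continuous x⁻¹⟩

/-- The voice transform `W_u(φ)(x) = ⟨φ, π_s(x) u⟩`. -/
def voice {s : ℝ} [Fact (1 < s)] (φ : DistVec s) (x : G) : ℂ := φ (smoothRep s x (wavelet s))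

/-- The weight `w_r(a, b) = 2 ^ r * ((a + a⁻¹)² + b²) ^ (r / 2)`. -/
def weight (r : ℝ) (x : G) : ℝ := 2 ^ r * ((x.a + x.a⁻¹) ^ 2 + x.b ^ 2) ^ (r / 2)

/-- Membership of a function on `G` in the weighted space `L^p_r(G)`. -/
def MemLpr (p r : ℝ) (f : G → ℂ) : Prop :=
  MemLp (fun x => f x * weight r x) (ENNReal.ofReal p) haar

/-- The norm `(∫ |f w_r|^p da db / a²) ^ (1 / p)` of `L^p_r(G)`. -/
def lprNorm (p r : ℝ) (f : G → ℂ) : ℝ :=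
  (eLpNorm (fun x => f x * weight r x) (ENNReal.ofReal p) haar).toReal

/-- The coorbit space of `L^p_r(G)` related to `u` and `H_s^∞`. -/
def Coorbit (s p r : ℝ) [Fact (1 < s)] : Submodule ℂ (DistVec s) where
  carrier := {φ | MemLpr p r (voice φ)}
  zero_mem' := by
    simp [MemLpr, voice]
  add_mem' := by
    intro φ ψ hφ hψ
    rw [Set.mem_ofPred_eq] at hφ hψ ⊢
    have h := MemLp.add hφ hψ
    refine (memLp_congr_ae (Filter.Eventually.of_forall fun x => ?_)).mp h
    simp [voice, add_mul]
  smul_mem' := by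
    intro c φ hφ
    rw [Set.mem_ofPred_eq] at hφ ⊢
    have h := MemLp.const_smul hφ c
    refine (memLp_congr_ae (Filter.Eventually.of_forall fun x => ?_)).mp h
    simp [voice, mul_assoc]

/-- The norm `‖φ‖ = ‖W_u(φ)‖` of the coorbit space. -/
def coorbitNorm {s p r : ℝ} [Fact (1 < s)] (φ : Coorbit s p r) : ℝ :=
  lprNorm p r (voice (φ : DistVec s))

/-- `N` is a norm on the complex vector space `E` for which `E` is complete. -/
structure IsBanachNorm {E : Type*} [AddCommGroup E] [Module ℂ E] (N : E → ℝ) : Prop where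
  add_le : ∀ v w, N (v + w) ≤ N v + N w
  smul : ∀ (c : ℂ) v, N (c • v) = ‖c‖ * N v
  eq_zero : ∀ v, N v = 0 → v = 0
  complete : ∀ f : ℕ → E, (∀ ε > 0, ∃ k, ∀ m ≥ k, ∀ n ≥ k, N (f m - f n) < ε) →
    ∃ v, Filter.Tendsto (fun n => N (f n - v)) Filter.atTop (nhds 0)

end

end BergmanCoorbit

open BergmanCoorbit

namespace BergmanCoorbit

open scoped MatrixGroups ComplexConjugate ContDiff
open MeasureTheory

noncomputable section

open scoped BoundedContinuousFunction

/-! The coorbit space is a weighted Bergman space on the disc in disguise. Taylor coefficients turn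
smooth vectors and their functionals into sequences, and the orbit of the origin turns the group
into the disc.

Sequences: `z ^ m` is a weight vector for rotations with frequency of size `s + 2m`. Differentiating
an orbit map along rotations therefore forces the Taylor coefficients of a smooth vector to decay
rapidly (`coefL_decay`). Conversely, the derivatives of the orbit map of `z ^ m` grow only
polynomially in `m`, locally uniformly (`exists_orbit_mon_bound`). Hence smooth vectors are sums of
their Taylor series in the Fréchet topology (`hasSum_smoothMon`), and functionals correspond to
sequences `φ(z ^ m)` of polynomial growth (`exists_distVec`).

Disc: `π_s(x) 1` is, up to the factor `α ^ (-s)`, a kernel `(1 - conj w z) ^ (-s)` with `w` the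
image of `0` under `x`. So the voice transform is an elementary factor times a holomorphic function
of `w`, the symbol (`voice_eq`). Haar measure becomes `2 (1 - |w|²)⁻² dw` (`lintegral_haar_pt`) and
`|α|⁻² = 1 - |w|²`, so the coorbit norm is a weighted Bergman norm of the symbol.

Banach space: orthogonality of monomials on discs and Hölder's inequality bound `φ(z ^ n)` by the
norm times a polynomial in `n` (`norm_distVec_smoothMon_le`). This gives definiteness, and for a
Cauchy sequence a limit functional to which the voice transforms converge pointwise; Fatou's lemma
upgrades this to norm convergence.

Non-zero: the functional with constant symbol has finite norm, since `(1 - |w|²) ^ (p (s - r) / 2 -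
2)` is integrable when `r + 2 / p < s`. Invariance: `distRep x` translates voice transforms on the
left, and the weight changes by at most a constant factor. Non-integrability: the coefficient has
size `|α| ^ (-s)`, which for `s ≤ 2` decays too slowly. -/

/-! ### Binomial coefficients -/

/-- The coefficients of the binomial series `(1 - w) ^ (-s) = ∑ binom s m * w ^ m`. -/
def binom (s : ℝ) (m : ℕ) : ℂ := Ring.choose ((s : ℂ) + m - 1) m

lemma hasSum_binom (s : ℝ) {w : ℂ} (hw : ‖w‖ < 1) :
    HasSum (fun m => binom s m * w ^ m) ((1 - w) ^ (-(s : ℂ))) := by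
  have hser := Complex.one_div_one_sub_cpow_hasFPowerSeriesOnBall_zero (s : ℂ)
  have h : w ∈ Metric.eball (0 : ℂ) 1 := by
    rw [← ENNReal.ofReal_one, Metric.eball_ofReal]
    simpa using hw
  have h5 := hser.hasSum h
  rw [zero_add, one_div, ← Complex.cpow_neg] at h5
  have h6 : (fun m => binom s m * w ^ m) = fun m => (FormalMultilinearSeries.ofScalars ℂ
      fun n : ℕ => (Ring.choose ((s : ℂ) + n - 1) n : ℂ)) m fun _ => w := by
    funext m
    simp [binom, mul_comm]
  rw [h6]
  exact h5

/-- The coefficient is `s (s + 1) ⋯ (s + m - 1) / m!`, and `s + j ≥ 1 + j`. This allows binomial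
factors to be dropped from lower bounds on symbol coefficients. -/
lemma one_le_norm_binom {s : ℝ} (hs : 1 < s) (m : ℕ) : 1 ≤ ‖binom s m‖ := by
  have h0 := Ring.factorial_nsmul_multichoose_eq_ascPochhammer (s : ℂ) m
  rw [Ring.multichoose_eq, Polynomial.ascPochhammer_smeval_eq_eval, nsmul_eq_mul] at h0
  have h1 : (m.factorial : ℝ) ≤ ‖(ascPochhammer ℂ m).eval (s : ℂ)‖ := by
    induction m with
    | zero => simp
    | succ m ih =>
      rw [ascPochhammer_succ_eval, norm_mul, Nat.factorial_succ, Nat.cast_mul, mul_comm]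
      refine mul_le_mul (ih ?_) ?_ (by positivity) (norm_nonneg _)
      · have := Ring.factorial_nsmul_multichoose_eq_ascPochhammer (s : ℂ) m
        rwa [Ring.multichoose_eq, Polynomial.ascPochhammer_smeval_eq_eval, nsmul_eq_mul] at this
      · rw [← Complex.ofReal_natCast m, ← Complex.ofReal_add, Complex.norm_real]
        refine le_trans ?_ (Real.le_norm_self _)
        push_cast
        linarith
  have h2 : (m.factorial : ℝ) * 1 ≤ m.factorial * ‖binom s m‖ := by
    rw [binom, mul_one, ← Complex.norm_natCast, ← norm_mul, h0, Complex.norm_natCast]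
    exact h1
  exact le_of_mul_le_mul_left h2 (by positivity)

/-! ### Rotation invariant measures -/

/-- Invariance of a measure on `ℂ` under rotations about the origin. -/
def RotInv (μ : Measure ℂ) : Prop := ∀ c : ℂ, ‖c‖ = 1 → MeasurePreserving (c * ·) μ μ

lemma rotInv_volume : RotInv volume := by
  intro c hc
  have := (rotation (⟨c, by simpa [Submonoid.unitSphere] using hc⟩ : Circle)).measurePreserving
  exact this

lemma RotInv.restrict {μ : Measure ℂ} (h : RotInv μ) {t : Set ℂ} (ht : MeasurableSet t)
    (hc : ∀ c z : ℂ, ‖c‖ = 1 → (c * z ∈ t ↔ z ∈ t)) : RotInv (μ.restrict t) := by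
  intro c hc'
  have := (h c hc').restrict_preimage ht
  rwa [show (c * ·) ⁻¹' t = t from Set.ext fun z => hc c z hc'] at this

lemma RotInv.withDensity {μ : Measure ℂ} (h : RotInv μ) {g : ℂ → ENNReal} (hg : Measurable g)
    (hc : ∀ c z : ℂ, ‖c‖ = 1 → g (c * z) = g z) : RotInv (μ.withDensity g) := by
  intro c hc'
  refine ⟨by fun_prop, Measure.ext fun t ht => ?_⟩
  have hm : Measurable fun z : ℂ => c * z := by fun_prop
  rw [Measure.map_apply hm ht, withDensity_apply _ (hm ht), withDensity_apply _ ht,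
    ← (h c hc').setLIntegral_comp_preimage ht hg]
  simp only [hc c _ hc']

lemma rotInv_discMeasure (s : ℝ) : RotInv (discMeasure s) := by
  refine (rotInv_volume.restrict isOpen_disc.measurableSet fun c z hc => ?_).withDensity
    (measurable_density s) fun c z hc => ?_
  · simp [mem_disc, hc]
  · simp [hc]

lemma RotInv.restrict_closedBall {μ : Measure ℂ} (h : RotInv μ) (ρ : ℝ) :
    RotInv (μ.restrict (Metric.closedBall 0 ρ)) :=
  h.restrict measurableSet_closedBall fun c z hc => by simp [hc]

/-- A rotation by the angle `π / (m - n)` multiplies the integrand by `-1`, so the integral equals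
its own negative. -/
lemma RotInv.integral_pow_mul_conj_pow {μ : Measure ℂ} (h : RotInv μ) {m n : ℕ} (hmn : m ≠ n) :
    ∫ w, w ^ m * conj (w ^ n) ∂μ = 0 := by
  have hd : ((m : ℂ) - n) ≠ 0 := sub_ne_zero.mpr (by exact_mod_cast hmn)
  let θ : ℝ := Real.pi / (m - n)
  let c : ℂ := Complex.exp (θ * Complex.I)
  have hc : ‖c‖ = 1 := Complex.norm_exp_ofReal_mul_I θ
  have h1 : c ^ m * conj (c ^ n) = -1 := by
    rw [← Complex.exp_nat_mul, ← Complex.exp_nat_mul, ← Complex.exp_conj, ← Complex.exp_add,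
      ← Complex.exp_pi_mul_I]
    congr 1
    simp only [θ, map_mul, Complex.conj_ofReal, Complex.conj_I, map_natCast]
    push_cast
    field_simp
    ring
  have hemb : MeasurableEmbedding (c * ·) :=
    (Homeomorph.mulLeft₀ c (by rw [← norm_ne_zero_iff, hc]; simp)).measurableEmbedding
  have h2 := (h c hc).integral_comp hemb (fun w => w ^ m * conj (w ^ n))
  have h3 : ∀ w : ℂ, (c * w) ^ m * conj ((c * w) ^ n) = -1 * (w ^ m * conj (w ^ n)) := by
    intro w
    rw [← h1]
    simp only [mul_pow, map_mul]
    ring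
  simp only [h3, integral_const_mul] at h2
  linear_combination (-1 / 2 : ℂ) * h2

/-- Termwise integration leaves only the term `m = n`, by orthogonality. Summability at the radius
`ρ` justifies the exchange, and `ρ ≤ 1` keeps `conj (w ^ n)` bounded by one. -/
lemma RotInv.integral_powerSeries {μ : Measure ℂ} [IsFiniteMeasure μ] (hμ : RotInv μ) {ρ : ℝ}
    (hρ : ∀ᵐ w ∂μ, ‖w‖ ≤ ρ) (hρ1 : ρ ≤ 1) {h : ℕ → ℂ} (hs : Summable fun m => ‖h m‖ * ρ ^ m)
    {H : ℂ → ℂ} (hH : ∀ᵐ w ∂μ, HasSum (fun m => h m * w ^ m) (H w)) (n : ℕ) :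
    ∫ w, H w * conj (w ^ n) ∂μ = h n * (∫ w, ‖w‖ ^ (2 * n) ∂μ : ℝ) := by
  have hb : ∀ m, ∀ᵐ w ∂μ, ‖h m * w ^ m * conj (w ^ n)‖ ≤ ‖h m‖ * ρ ^ m := by
    intro m
    filter_upwards [hρ] with w hw
    rw [norm_mul, norm_mul, Complex.norm_conj, norm_pow, norm_pow]
    have hρ0 : 0 ≤ ρ := (norm_nonneg w).trans hw
    have h1 : ‖w‖ ^ n ≤ 1 := pow_le_one₀ (norm_nonneg _) (hw.trans hρ1)
    calc ‖h m‖ * ‖w‖ ^ m * ‖w‖ ^ n ≤ ‖h m‖ * ρ ^ m * 1 := by gcongr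
      _ = _ := mul_one _
  have hint : ∀ m, Integrable (fun w => h m * w ^ m * conj (w ^ n)) μ := fun m =>
    Integrable.of_bound (by fun_prop) _ (hb m)
  have hsum : Summable fun m => ∫ w, ‖h m * w ^ m * conj (w ^ n)‖ ∂μ := by
    refine Summable.of_nonneg_of_le (fun m => integral_nonneg fun w => norm_nonneg _) (fun m => ?_)
      (hs.mul_right (μ.real Set.univ))
    refine (integral_mono_ae (hint m).norm (integrable_const _) (hb m)).trans ?_
    rw [integral_const, smul_eq_mul, mul_comm]
  have h1 := hasSum_integral_of_summable_integral_norm hint hsum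
  have h2 : ∫ w, H w * conj (w ^ n) ∂μ = ∫ w, ∑' m, h m * w ^ m * conj (w ^ n) ∂μ := by
    refine integral_congr_ae ?_
    filter_upwards [hH] with w hw
    exact (hw.mul_right _).tsum_eq.symm
  rw [h2, ← h1.tsum_eq, tsum_eq_single n]
  · simp only [mul_assoc, integral_const_mul]
    congr 1
    rw [← integral_complex_ofReal]
    refine integral_congr_ae (Filter.Eventually.of_forall fun w => ?_)
    simp only [map_pow]
    rw [← mul_pow, Complex.mul_conj', ← pow_mul]
    push_cast
    rfl
  · intro m hm
    simp only [mul_assoc, integral_const_mul, hμ.integral_pow_mul_conj_pow hm, mul_zero]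

/-! ### Taylor coefficients of the elements of `H_s` -/

/-- A radius such that `|z| ^ n` is bounded below near the circle of that radius. -/
def rad (n : ℕ) : ℝ := 1 - 1 / (8 * (n + 1))

lemma rad_lt_one (n : ℕ) : rad n < 1 := by
  have : (0 : ℝ) < 1 / (8 * (n + 1)) := by positivity
  rw [rad]
  linarith

lemma rad_pos (n : ℕ) : 0 < rad n := by
  have : (1 : ℝ) / (8 * (n + 1)) ≤ 1 / 8 := by
    rw [div_le_div_iff₀ (by positivity) (by positivity)]
    nlinarith [(Nat.cast_nonneg n : (0 : ℝ) ≤ n)]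
  rw [rad]
  linarith

lemma one_sub_sq_mem {n : ℕ} {z : ℂ} (hz : ‖z‖ ≤ rad n) :
    1 / (8 * (n + 1) : ℝ) ≤ 1 - ‖z‖ ^ 2 ∧ 1 - ‖z‖ ^ 2 ≤ 1 := by
  have h1 := rad_lt_one n
  have h2 : 1 / (8 * (n + 1) : ℝ) = 1 - rad n := by rw [rad]; ring
  refine ⟨?_, by nlinarith [norm_nonneg z]⟩
  rw [h2]
  nlinarith [norm_nonneg z]

/-- On the disc of radius `rad n`, replacing one power of `1 - |z|²` by another costs only a factor
polynomial in `n`. Rounding the exponent up makes that factor a natural power. -/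
lemma rpow_bounds {n : ℕ} {z : ℂ} (hz : ‖z‖ ≤ rad n) (e : ℝ) :
    1 / (8 * (n + 1) : ℝ) ^ ⌈|e|⌉₊ ≤ (1 - ‖z‖ ^ 2) ^ e ∧
      (1 - ‖z‖ ^ 2) ^ e ≤ (8 * (n + 1) : ℝ) ^ ⌈|e|⌉₊ := by
  obtain ⟨h1, h2⟩ := one_sub_sq_mem hz
  set x := 1 - ‖z‖ ^ 2
  have hp : (0 : ℝ) < 8 * (n + 1) := by positivity
  have hx : 0 < x := lt_of_lt_of_le (by positivity) h1
  have hx1 : x⁻¹ ≤ 8 * (n + 1) := by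
    rw [inv_le_comm₀ hx hp]
    simpa using h1
  have hx2 : 1 ≤ x⁻¹ := (one_le_inv₀ hx).mpr h2
  have key : ∀ e : ℝ, x⁻¹ ^ e ≤ (8 * (n + 1) : ℝ) ^ ⌈|e|⌉₊ := by
    intro e
    calc x⁻¹ ^ e ≤ x⁻¹ ^ ((⌈|e|⌉₊ : ℕ) : ℝ) :=
          Real.rpow_le_rpow_of_exponent_le hx2 ((le_abs_self e).trans (Nat.le_ceil _))
      _ = x⁻¹ ^ ⌈|e|⌉₊ := Real.rpow_natCast _ _
      _ ≤ _ := pow_le_pow_left₀ (by positivity) hx1 _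
  constructor
  · rw [one_div, inv_le_comm₀ (by positivity) (by positivity), ← Real.inv_rpow hx.le]
    exact key e
  · have := key (-e)
    rwa [Real.inv_rpow hx.le, Real.rpow_neg hx.le, inv_inv, abs_neg] at this

/-- The square integral of `z ^ n` over a disc of radius `rad n`. -/
def sqInt (s : ℝ) (n : ℕ) : ℝ :=
  ∫ z in Metric.closedBall 0 (rad n), ‖z‖ ^ (2 * n) ∂discMeasure s

/-- An annulus just inside the circle of radius `rad n` suffices: there `|z| ^ (2n) ≥ 1/2`, the area
is at least a multiple of `1 / (n + 1)`, and the density is at least a negative power of `n + 1`. -/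
lemma exists_le_sqInt (s : ℝ) [hs : Fact (1 < s)] :
    ∃ C > 0, ∃ N : ℕ, ∀ n : ℕ, C * ((n : ℝ) + 1)⁻¹ ^ N ≤ sqInt s n := by
  have := isFiniteMeasure_disc s
  have hs1 : 0 < s - 1 := sub_pos.mpr hs.out
  have hpi := Real.pi_pos
  set k := ⌈|s - 2|⌉₊
  refine ⟨(s - 1) / Real.pi * (1 / 8) ^ k * (Real.pi / 8) * (1 / 2), by positivity, k + 1,
    fun n => ?_⟩
  have hn : (0 : ℝ) < n + 1 := by positivity
  let ρ : ℝ := 1 - 1 / (4 * (n + 1))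
  have hρ4 : (1 : ℝ) / (4 * (n + 1)) ≤ 1 / 4 := by
    rw [div_le_div_iff₀ (by positivity) (by positivity)]
    linarith
  have hρ0 : 0 ≤ ρ := by simp only [ρ]; linarith
  have hρr : ρ + 1 / (8 * (n + 1)) = rad n := by
    simp only [ρ, rad]
    field_simp
    ring
  have hρr' : ρ ≤ rad n := by
    rw [← hρr]
    have : (0 : ℝ) ≤ 1 / (8 * (n + 1)) := by positivity
    linarith
  let A : Set ℂ := Metric.closedBall 0 (rad n) \ Metric.closedBall 0 ρ
  have hA : MeasurableSet A := measurableSet_closedBall.diff measurableSet_closedBall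
  have hAd : A ⊆ disc := fun z hz => by
    have h1 := hz.1
    rw [mem_closedBall_zero_iff] at h1
    exact mem_disc.mpr (h1.trans_lt (rad_lt_one n))
  have hbern : (1 / 2 : ℝ) ≤ ρ ^ (2 * n) := by
    -- Bernoulli's inequality: `ρ ^ (2n) ≥ 1 - 2n / (4 (n + 1)) ≥ 1/2`.
    have h1 := one_add_mul_le_pow (a := -(1 / (4 * (n + 1) : ℝ))) (by linarith) (2 * n)
    have h2 : (1 / 2 : ℝ) ≤ 1 + (2 * n : ℕ) * -(1 / (4 * (n + 1) : ℝ)) := by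
      push_cast
      rw [mul_neg, mul_one_div, ← sub_eq_add_neg, le_sub_comm, div_le_iff₀ (by positivity)]
      linarith
    refine h2.trans (h1.trans (le_of_eq ?_))
    simp only [ρ]
    ring
  have hvol : Real.pi / 8 * (n + 1 : ℝ)⁻¹ ≤ volume.real A := by
    rw [measureReal_sdiff (Metric.closedBall_subset_closedBall hρr') measurableSet_closedBall
      measure_closedBall_lt_top.ne]
    simp only [measureReal_def, Complex.volume_closedBall]
    rw [ENNReal.toReal_mul, ENNReal.toReal_mul, ENNReal.toReal_pow, ENNReal.toReal_pow,
      ENNReal.toReal_ofReal hρ0, ENNReal.toReal_ofReal (rad_pos n).le]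
    simp only [ENNReal.coe_toReal, NNReal.coe_real_pi]
    have h3 : Real.pi / 8 * (n + 1 : ℝ)⁻¹ = Real.pi * (rad n - ρ) := by
      rw [← hρr]
      field_simp
      ring
    rw [h3]
    -- The area `π (rad n ² - ρ²)` is then at least `π (rad n - ρ)`.
    have h4 : 1 ≤ rad n + ρ := by
      have h5 : ρ = 1 - 1 / (4 * (n + 1)) := rfl
      linarith
    nlinarith [mul_nonneg hpi.le (mul_nonneg (sub_nonneg.mpr hρr') (sub_nonneg.mpr h4))]
  have hmeas : (s - 1) / Real.pi * (1 / (8 * (n + 1)) ^ k) * volume.real A ≤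
      (discMeasure s).real A := by
    have h1 : ENNReal.ofReal ((s - 1) / Real.pi * (1 / (8 * (n + 1)) ^ k)) * volume A ≤
        discMeasure s A := by
      rw [discMeasure, withDensity_apply _ hA, Measure.restrict_restrict hA,
        Set.inter_eq_left.mpr hAd, ← setLIntegral_const]
      refine setLIntegral_mono (measurable_density s) fun z hz => ENNReal.ofReal_le_ofReal ?_
      gcongr
      exact (rpow_bounds (mem_closedBall_zero_iff.mp hz.1) _).1
    have h2 := ENNReal.toReal_mono (measure_ne_top _ _) h1
    rwa [ENNReal.toReal_mul, ENNReal.toReal_ofReal (by positivity)] at h2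
  calc _ = (1 / 2) * ((s - 1) / Real.pi * (1 / (8 * (n + 1)) ^ k) *
        (Real.pi / 8 * (n + 1 : ℝ)⁻¹)) := by
        rw [mul_pow, pow_succ, inv_pow, one_div_pow]
        field_simp
    _ ≤ (1 / 2) * (discMeasure s).real A := by
        gcongr
        refine le_trans ?_ hmeas
        gcongr
    _ = ∫ z in A, (1 / 2 : ℝ) ∂discMeasure s := by
        rw [setIntegral_const, smul_eq_mul, mul_comm]
    _ ≤ ∫ z in A, ‖z‖ ^ (2 * n) ∂discMeasure s := by
        refine setIntegral_mono_on (integrableOn_const (measure_ne_top _ _)) ?_ hA fun z hz => ?_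
        · refine Integrable.of_bound (C := 1) (by fun_prop) ?_
          filter_upwards [ae_restrict_mem hA] with z hz
          simpa using pow_le_one₀ (norm_nonneg z) (mem_disc.mp (hAd hz)).le
        · have h6 := hz.2
          rw [mem_closedBall_zero_iff, not_le] at h6
          exact hbern.trans (pow_le_pow_left₀ hρ0 h6.le _)
    _ ≤ _ := by
        refine setIntegral_mono_set ?_ (Filter.Eventually.of_forall fun z => by positivity)
          (Filter.Eventually.of_forall fun z hz => hz.1)
        refine Integrable.of_bound (C := 1) (by fun_prop) ?_
        filter_upwards [ae_restrict_mem measurableSet_closedBall] with z hz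
        rw [mem_closedBall_zero_iff] at hz
        simpa using pow_le_one₀ (norm_nonneg z) (hz.trans (rad_lt_one n).le)

lemma sqInt_pos (s : ℝ) [Fact (1 < s)] (n : ℕ) : 0 < sqInt s n := by
  obtain ⟨C, hC, N, h⟩ := exists_le_sqInt s
  exact lt_of_lt_of_le (by positivity) (h n)

lemma ae_norm_le_rad (s : ℝ) (n : ℕ) :
    ∀ᵐ w ∂(discMeasure s).restrict (Metric.closedBall 0 (rad n)), ‖w‖ ≤ rad n := by
  filter_upwards [ae_restrict_mem measurableSet_closedBall] with z hz
  simpa using hz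

lemma memLp_coefVec (s : ℝ) [Fact (1 < s)] (n : ℕ) :
    MemLp ((Metric.closedBall 0 (rad n)).indicator fun z : ℂ => z ^ n) 2 (discMeasure s) ∧
      ∀ z, ‖(Metric.closedBall 0 (rad n)).indicator (fun z : ℂ => z ^ n) z‖ ≤ 1 := by
  have := isFiniteMeasure_disc s
  have h1 : ∀ z, ‖(Metric.closedBall 0 (rad n)).indicator (fun z : ℂ => z ^ n) z‖ ≤ 1 := by
    intro z
    by_cases hz : z ∈ Metric.closedBall (0 : ℂ) (rad n)
    · rw [Set.indicator_of_mem hz, norm_pow]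
      rw [mem_closedBall_zero_iff] at hz
      exact pow_le_one₀ (norm_nonneg z) (hz.trans (rad_lt_one n).le)
    · rw [Set.indicator_of_notMem hz, norm_zero]
      exact zero_le_one
  refine ⟨MemLp.of_bound ?_ 1 (Filter.Eventually.of_forall h1), h1⟩
  exact ((measurable_id.pow_const n).indicator measurableSet_closedBall).aestronglyMeasurable

/-- The `n`-th Taylor coefficient at `0` of the elements of `H_s`, extended to `L²`. -/
def coefL (s : ℝ) [Fact (1 < s)] (n : ℕ) : Lp ℂ 2 (discMeasure s) →L[ℂ] ℂ :=
  (sqInt s n : ℂ)⁻¹ • innerSL ℂ ((memLp_coefVec s n).1.toLp)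

lemma coefL_apply {s : ℝ} [Fact (1 < s)] (n : ℕ) {f : Lp ℂ 2 (discMeasure s)} {F : ℂ → ℂ}
    (h : f =ᵐ[discMeasure s] F) : coefL s n f = (sqInt s n : ℂ)⁻¹ *
      ∫ z in Metric.closedBall 0 (rad n), F z * conj (z ^ n) ∂discMeasure s := by
  rw [coefL, smul_apply, smul_eq_mul, innerSL_apply_apply, L2.inner_def,
    ← integral_indicator measurableSet_closedBall]
  congr 1
  refine integral_congr_ae ?_
  filter_upwards [h, (memLp_coefVec s n).1.coeFn_toLp] with z hz1 hz2
  rw [hz1, hz2, RCLike.inner_apply]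
  by_cases hz : z ∈ Metric.closedBall (0 : ℂ) (rad n)
  · simp only [Set.indicator_of_mem hz]
  · simp only [Set.indicator_of_notMem hz, map_zero, mul_zero]

/-- The integral runs over a disc of radius less than one, on which the series converges absolutely,
so no growth condition on `a` is needed. As `coefL` is continuous on all of `L²`, it can be composed
with orbit maps and differentiated. -/
lemma coefL_eq {s : ℝ} [Fact (1 < s)] {f : Lp ℂ 2 (discMeasure s)} {F : ℂ → ℂ}
    (h : f =ᵐ[discMeasure s] F) {a : ℕ → ℂ}
    (ha : ∀ z ∈ disc, HasSum (fun m => a m * z ^ m) (F z)) (n : ℕ) : coefL s n f = a n := by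
  have := isFiniteMeasure_disc s
  have hr : ((rad n : ℝ) : ℂ) ∈ disc := by
    rw [mem_disc, Complex.norm_real, Real.norm_of_nonneg (rad_pos n).le]
    exact rad_lt_one n
  have hs : Summable fun m => ‖a m‖ * rad n ^ m := by
    refine (ha _ hr).summable.norm.congr fun m => ?_
    rw [norm_mul, norm_pow, Complex.norm_real, Real.norm_of_nonneg (rad_pos n).le]
  have hp : (sqInt s n : ℂ) ≠ 0 := by exact_mod_cast (sqInt_pos s n).ne'
  rw [coefL_apply n h, ((rotInv_discMeasure s).restrict_closedBall (rad n)).integral_powerSeries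
    (ae_norm_le_rad s n) (rad_lt_one n).le hs]
  · change _ * (_ * (sqInt s n : ℂ)) = _
    field_simp
  · filter_upwards [ae_norm_le_rad s n] with z hz
    exact ha z (mem_disc.mpr (hz.trans_lt (rad_lt_one n)))

lemma hasSum_coefL {s : ℝ} [Fact (1 < s)] (v : Hilb s) {z : ℂ} (hz : z ∈ disc) :
    HasSum (fun m => coefL s m v * z ^ m) (hol v z) := by
  have h : ∀ z ∈ disc, HasSum (fun m : ℕ => ((m.factorial : ℂ)⁻¹ * iteratedDeriv m (hol v) 0) *
      z ^ m) (hol v z) := by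
    intro z hz
    have h1 := Complex.hasSum_taylorSeries_on_ball (hol_diff v) hz
    have h2 : (fun m : ℕ => (m.factorial : ℂ)⁻¹ * iteratedDeriv m (hol v) 0 * z ^ m) =
        fun m : ℕ => (m.factorial : ℂ)⁻¹ • (z - 0) ^ m • iteratedDeriv m (hol v) 0 := by
      funext m
      simp only [sub_zero, smul_eq_mul]
      ring
    rw [h2]
    exact h1
  simpa only [coefL_eq (hol_ae v) h] using h z hz

/-- The representing function is bounded by one on a finite measure space, so only the normalisation
`1 / sqInt s n` can grow. -/
lemma exists_norm_coefL_le (s : ℝ) [Fact (1 < s)] :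
    ∃ C, ∃ N : ℕ, ∀ n, ‖coefL s n‖ ≤ C * ((n : ℝ) + 1) ^ N := by
  have := isFiniteMeasure_disc s
  obtain ⟨C, hC, N, h⟩ := exists_le_sqInt s
  refine ⟨C⁻¹ * (measureUnivNNReal (discMeasure s) : ℝ) ^ (2 : ENNReal).toReal⁻¹, N, fun n => ?_⟩
  have h1 : ‖(memLp_coefVec s n).1.toLp‖ ≤ (measureUnivNNReal (discMeasure s) : ℝ) ^ (2 : ENNReal).toReal⁻¹ := by
    have := Lp.norm_le_of_ae_bound (f := (memLp_coefVec s n).1.toLp) zero_le_one (by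
      filter_upwards [(memLp_coefVec s n).1.coeFn_toLp] with z hz
      rw [hz]
      exact (memLp_coefVec s n).2 z)
    simpa using this
  rw [coefL, norm_smul, norm_inv, Complex.norm_real, Real.norm_of_nonneg (sqInt_pos s n).le,
    innerSL_apply_norm]
  have h2 : (sqInt s n)⁻¹ ≤ C⁻¹ * ((n : ℝ) + 1) ^ N := by
    refine (inv_anti₀ (by positivity) (h n)).trans (le_of_eq ?_)
    rw [mul_inv, inv_pow, inv_inv]
  calc _ ≤ C⁻¹ * ((n : ℝ) + 1) ^ N *
        (measureUnivNNReal (discMeasure s) : ℝ) ^ (2 : ENNReal).toReal⁻¹ := by gcongr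
    _ = _ := by ring

/-! ### Orbit maps as maps to the bounded continuous functions -/

/-- Orbit maps are studied in the bounded continuous functions because these form a Banach algebra,
where powers can be differentiated. The retraction represents `z` on the disc by an element of norm
at most one. -/
lemma norm_clip_le (z : ℂ) : ‖((max 1 ‖z‖ : ℝ) : ℂ)⁻¹ * z‖ ≤ 1 := by
  have : (0 : ℝ) < max 1 ‖z‖ := by positivity
  rw [norm_mul, norm_inv, Complex.norm_real, Real.norm_of_nonneg this.le, inv_mul_le_one₀ this]
  exact le_max_right _ _

lemma continuous_clip : Continuous fun z : ℂ => ((max 1 ‖z‖ : ℝ) : ℂ)⁻¹ * z := by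
  refine Continuous.mul (Continuous.inv₀ (by fun_prop) ?_) continuous_id
  intro z
  have : (0 : ℝ) < max 1 ‖z‖ := by positivity
  exact_mod_cast this.ne'

/-- The radial retraction of `ℂ` to the closed disc, as a bounded continuous function. -/
def clip : ℂ →ᵇ ℂ :=
  BoundedContinuousFunction.ofNormedAddCommGroup
    (fun z : ℂ => ((max 1 ‖z‖ : ℝ) : ℂ)⁻¹ * z) continuous_clip 1 norm_clip_le

lemma norm_clip : ‖clip‖ ≤ 1 :=
  BoundedContinuousFunction.norm_ofNormedAddCommGroup_le _ zero_le_one norm_clip_le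

lemma norm_clip_apply (z : ℂ) : ‖clip z‖ ≤ 1 := norm_clip_le z

lemma clip_apply {z : ℂ} (hz : z ∈ disc) : clip z = z := by
  rw [mem_disc] at hz
  change ((max 1 ‖z‖ : ℝ) : ℂ)⁻¹ * z = z
  rw [max_eq_left hz.le]
  simp

/-- The binomial series in powers of `clip` converges in norm, uniformly for `|q| ≤ ρ < 1`, hence is
holomorphic in `q`. -/
lemma exists_differentiableOn_binomial (s : ℝ) : ∃ E : ℂ → ℂ →ᵇ ℂ,
    DifferentiableOn ℂ E (Metric.ball 0 1) ∧ ∀ q ∈ Metric.ball (0 : ℂ) 1, ∀ z ∈ disc,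
      E q z = (1 - q * z) ^ (-(s : ℂ)) := by
  have hZn : ∀ n : ℕ, ‖clip ^ n‖ ≤ 1 := fun n =>
    (norm_pow_le clip n).trans (pow_le_one₀ (norm_nonneg _) norm_clip)
  have hsum : ∀ ρ : NNReal, ρ < 1 → Summable fun n => ‖binom s n‖ * (ρ : ℝ) ^ n := by
    intro ρ hρ
    have h1 : ‖((ρ : ℝ) : ℂ)‖ < 1 := by simpa using hρ
    simpa using (hasSum_binom s h1).summable.norm
  let E : ℂ → ℂ →ᵇ ℂ := fun q => ∑' n, (binom s n * q ^ n) • clip ^ n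
  have hterm : ∀ ρ : NNReal, ∀ q ∈ Metric.ball (0 : ℂ) ρ, ∀ n,
      ‖(binom s n * q ^ n) • clip ^ n‖ ≤ ‖binom s n‖ * (ρ : ℝ) ^ n := by
    intro ρ q hq n
    rw [norm_smul, norm_mul, norm_pow]
    have hq' : ‖q‖ ≤ ρ := by simpa using (Metric.mem_ball.mp hq).le
    calc ‖binom s n‖ * ‖q‖ ^ n * ‖clip ^ n‖ ≤ ‖binom s n‖ * (ρ : ℝ) ^ n * 1 := by
          gcongr
          exact hZn n
      _ = _ := mul_one _
  refine ⟨E, ?_, ?_⟩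
  · intro q hq
    rw [Metric.mem_ball, dist_zero_right] at hq
    obtain ⟨ρ, h1, h2⟩ := exists_between hq
    lift ρ to NNReal using (norm_nonneg q).trans h1.le
    have h3 := Complex.differentiableOn_tsum_of_summable_norm (hsum ρ (by exact_mod_cast h2))
      (fun n => (((differentiableOn_id.pow n).const_mul (binom s n)).smul_const (clip ^ n)))
      (Metric.isOpen_ball (x := (0 : ℂ)) (ε := ρ)) (fun n q hq => hterm ρ q hq n)
    exact ((h3 q (by simpa using h1)).differentiableAt
      (Metric.isOpen_ball.mem_nhds (by simpa using h1))).differentiableWithinAt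
  · intro q hq z hz
    rw [Metric.mem_ball, dist_zero_right] at hq
    obtain ⟨ρ, h1, h2⟩ := exists_between hq
    lift ρ to NNReal using (norm_nonneg q).trans h1.le
    have h3 : HasSum (fun n => (binom s n * q ^ n) • clip ^ n) (E q) :=
      (Summable.of_norm_bounded (hsum ρ (by exact_mod_cast h2))
        (hterm ρ q (by simpa using h1))).hasSum
    have h4 := h3.mapL (BoundedContinuousFunction.evalCLM ℂ z)
    have hqz : ‖q * z‖ < 1 := by
      rw [mem_disc] at hz
      rw [norm_mul]
      exact mul_lt_one_of_nonneg_of_lt_one_left (norm_nonneg _) hq hz.le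
    have h6 : (fun n => BoundedContinuousFunction.evalCLM ℂ z ((binom s n * q ^ n) • clip ^ n)) =
        fun n => binom s n * (q * z) ^ n := by
      funext n
      simp [clip_apply hz, mul_pow]
      ring
    rw [h6] at h4
    exact h4.unique (hasSum_binom s hqz)

/-- The Moebius transformation of the closed disc has values in the closed disc. -/
lemma norm_mob_le {α β z : ℂ} (h : ‖α‖ ^ 2 - ‖β‖ ^ 2 = 1) (hz : ‖z‖ ≤ 1) :
    ‖conj α * z - β‖ ≤ ‖den α β z‖ := by
  have h1 : 0 ≤ 1 - ‖z‖ ^ 2 := by nlinarith [norm_nonneg z]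
  refine le_of_sq_le_sq ?_ (norm_nonneg _)
  have h2 : ‖den α β z‖ ^ 2 - ‖conj α * z - β‖ ^ 2 = (‖α‖ ^ 2 - ‖β‖ ^ 2) * (1 - ‖z‖ ^ 2) := by
    simp only [← Complex.normSq_eq_norm_sq, den, Complex.normSq_apply]
    simp
    ring
  rw [h, one_mul] at h2
  linarith

/-- The group acts by `v ↦ M · (v ∘ B)`, and both factors depend smoothly on the group coordinates
as elements of the Banach algebra. On `z ^ m` the action is `M · B ^ m`, so `‖B‖ ≤ 1` prevents
exponential growth in `m`. -/
lemma exists_orbit_factors (s : ℝ) [Fact (1 < s)] : ∃ M B : ℝ × ℝ × ℝ → ℂ →ᵇ ℂ,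
    ContDiff ℝ ∞ M ∧ ContDiff ℝ ∞ B ∧ (∀ q, ‖B q‖ ≤ 1) ∧
    ∀ (q : ℝ × ℝ × ℝ), ∀ z ∈ disc, B q z ∈ disc ∧ ∀ v : Hilb s,
      hol (rot s q.1 (rep s (G.mk (Real.exp q.2.1) q.2.2 (Real.exp_pos _)) v)) z =
        M q z * hol v (B q z) := by
  obtain ⟨E, hE, hEv⟩ := exists_differentiableOn_binomial s
  let g : ℝ × ℝ × ℝ → G := fun q => G.mk (Real.exp q.2.1) q.2.2 (Real.exp_pos _)
  let e : ℝ × ℝ × ℝ → ℂ := fun q => Complex.exp (-(2 * q.1 : ℝ) * Complex.I)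
  let A : ℝ × ℝ × ℝ → ℂ := fun q => Complex.exp (-(s * q.1 : ℝ) * Complex.I) *
    (g q).α ^ (-(s : ℂ))
  let K : ℝ × ℝ × ℝ → ℂ := fun q => conj (g q).β / (g q).α * e q
  have he : ∀ q, ‖e q‖ = 1 := fun q => by
    simp only [e]
    rw [← Complex.ofReal_neg, Complex.norm_exp_ofReal_mul_I]
  have hK0 : ∀ q, ‖K q‖ < 1 := by
    intro q
    simp only [K]
    rw [norm_mul, he, mul_one]
    exact (g q).norm_κ
  have hK1 : ∀ q, K q ∈ Metric.ball (0 : ℂ) 1 := fun q => by simpa using hK0 q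
  have hα : ContDiff ℝ ∞ fun q => (g q).α := by
    simp only [g, G.α, G.mk_a, G.mk_b, ← Complex.ofReal_inv, ← Real.exp_neg]
    have h1 : ContDiff ℝ ∞ (fun x : ℝ => (x : ℂ)) := Complex.ofRealCLM.contDiff
    fun_prop
  have hβ : ContDiff ℝ ∞ fun q => (g q).β := by
    have h1 : ContDiff ℝ ∞ (fun x : ℝ => (x : ℂ)) := Complex.ofRealCLM.contDiff
    simp only [g, G.β, G.mk_a, G.mk_b, ← Complex.ofReal_inv, ← Real.exp_neg]
    fun_prop
  have hconj : ∀ {f : ℝ × ℝ × ℝ → ℂ}, ContDiff ℝ ∞ f → ContDiff ℝ ∞ fun q => conj (f q) :=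
    fun hf => Complex.conjCLE.contDiff.comp hf
  have hexp : ∀ c : ℝ, ContDiff ℝ ∞ fun q : ℝ × ℝ × ℝ =>
      Complex.exp (-(c * q.1 : ℝ) * Complex.I) := by
    intro c
    have h1 : ContDiff ℝ ∞ (fun x : ℝ => (x : ℂ)) := Complex.ofRealCLM.contDiff
    refine ContDiff.cexp ?_
    fun_prop
  have hA : ContDiff ℝ ∞ A := by
    refine (hexp s).mul ?_
    have hlog : ContDiff ℝ ∞ fun q => Complex.exp (Complex.log (g q).α * (-(s : ℂ))) := by
      refine ContDiff.cexp (ContDiff.mul ?_ contDiff_const)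
      refine contDiff_iff_contDiffAt.mpr fun q => ?_
      have h1 : ContDiffAt ℂ ∞ Complex.log (g q).α :=
        Complex.contDiffAt_log (Or.inl (g q).α_re)
      exact (h1.restrict_scalars ℝ).comp q hα.contDiffAt
    have hpow : (fun q => (g q).α ^ (-(s : ℂ))) =
        fun q => Complex.exp (Complex.log (g q).α * (-(s : ℂ))) :=
      funext fun q => Complex.cpow_def_of_ne_zero (g q).α_ne _
    rw [hpow]
    exact hlog
  have hK : ContDiff ℝ ∞ K := ((hconj hβ).mul (hα.inv fun q => (g q).α_ne)).mul (hexp 2)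
  have hE2 : ContDiffOn ℝ ∞ E (Metric.ball 0 1) :=
    (hE.contDiffOn Metric.isOpen_ball).restrict_scalars ℝ
  -- Numerator and denominator of the Moebius transformation after the rotation, both divided by
  -- `α`. The denominator becomes one minus an element of norm below one, so it is invertible by the
  -- Neumann series, and inversion is smooth on units.
  let N : ℝ × ℝ × ℝ → ℂ →ᵇ ℂ := fun q => (conj (g q).α * e q / (g q).α) • clip -
    ((g q).β / (g q).α) • 1
  let D : ℝ × ℝ × ℝ → ℂ →ᵇ ℂ := fun q => 1 - K q • clip
  have hDu : ∀ q, IsUnit (D q) := fun q => isUnit_one_sub_of_norm_lt_one (by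
    rw [norm_smul]
    exact (mul_le_of_le_one_right (norm_nonneg _) norm_clip).trans_lt (hK0 q))
  have hDi : ∀ q z, Ring.inverse (D q) z = (1 - K q * clip z)⁻¹ := by
    intro q z
    have h1 := congrArg (fun f : ℂ →ᵇ ℂ => f z) (Ring.mul_inverse_cancel _ (hDu q))
    exact eq_inv_of_mul_eq_one_right h1
  have hN : ContDiff ℝ ∞ N :=
    ((((hconj hα).mul (hexp 2)).mul (hα.inv fun q => (g q).α_ne)).smul contDiff_const).sub
      ((hβ.mul (hα.inv fun q => (g q).α_ne)).smul contDiff_const)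
  have hD : ContDiff ℝ ∞ D := contDiff_const.sub (hK.smul contDiff_const)
  have hB : ∀ q z, (N q * Ring.inverse (D q)) z =
      (conj (g q).α * (e q * clip z) - (g q).β) / den (g q).α (g q).β (e q * clip z) ∧
      den (g q).α (g q).β (e q * clip z) ≠ 0 := by
    intro q z
    have h0 := (g q).α_ne
    have h1 : 1 - K q * clip z ≠ 0 := by
      refine sub_ne_zero.mpr fun h => ?_
      have h2 : ‖K q * clip z‖ < 1 := by
        rw [norm_mul]
        exact (mul_le_of_le_one_right (norm_nonneg _) (norm_clip_apply z)).trans_lt (hK0 q)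
      rw [← h, norm_one] at h2
      exact lt_irrefl _ h2
    have h2 : den (g q).α (g q).β (e q * clip z) = (g q).α * (1 - K q * clip z) := by
      simp only [den, K]
      field_simp
      ring
    refine ⟨?_, by rw [h2]; exact mul_ne_zero h0 h1⟩
    rw [BoundedContinuousFunction.mul_apply, hDi, h2]
    change ((conj (g q).α * e q / (g q).α) * clip z - ((g q).β / (g q).α) * 1) * _ = _
    field_simp
  refine ⟨fun q => A q • E (K q), fun q => N q * Ring.inverse (D q), hA.smul ?_, hN.mul ?_, ?_, ?_⟩
  · refine contDiff_iff_contDiffAt.mpr fun q => ?_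
    exact (hE2.contDiffAt (Metric.isOpen_ball.mem_nhds (hK1 q))).comp q hK.contDiffAt
  · refine contDiff_iff_contDiffAt.mpr fun q => ?_
    have h1 : ContDiffAt ℝ ∞ Ring.inverse (D q) := contDiffAt_ringInverse ℝ (hDu q).unit
    exact h1.comp q hD.contDiffAt
  · intro q
    refine (BoundedContinuousFunction.norm_le zero_le_one).mpr fun z => ?_
    rw [(hB q z).1, norm_div, div_le_one (norm_pos_iff.mpr (hB q z).2)]
    exact norm_mob_le (g q).norm_sub (by rw [norm_mul, he, one_mul]; exact norm_clip_apply z)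
  · intro q z hz
    have hz' : e q * z ∈ disc := by
      rw [mem_disc] at hz ⊢
      rwa [norm_mul, he, one_mul]
    have hBz : (N q * Ring.inverse (D q)) z = mob (g q).α (g q).β (e q * z) := by
      rw [(hB q z).1, clip_apply hz, mob]
    refine ⟨?_, fun v => ?_⟩
    · change (N q * Ring.inverse (D q)) z ∈ disc
      rw [hBz]
      exact mob_mem (g q).norm_sub hz'
    · change _ = (A q • E (K q) z) * hol v ((N q * Ring.inverse (D q)) z)
      rw [hBz, hol_rot _ _ hz, hol_rep' _ _ hz', den_cpow _ _ hz', hEv _ (hK1 q) z hz, smul_eq_mul]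
      simp only [A, K, g, e]
      ring_nf

/-! ### Iterated derivatives of powers and of series -/

lemma natCast_le_infty (n : ℕ) : ((n : ℕ∞) : WithTop ℕ∞) ≤ ∞ := by exact_mod_cast le_top

/-- The Leibniz rule and the binomial theorem give `∑ (i choose j) (m D) ^ j D ^ (i - j) = ((m + 1)
D) ^ i`. The case `i = 0` of the assumption is `‖B x‖ ≤ 1`, which makes the growth in `m`
polynomial. -/
theorem norm_iteratedFDeriv_pow_le {E A : Type*} [NormedAddCommGroup E] [NormedSpace ℝ E]
    [NormedCommRing A] [NormedAlgebra ℝ A] [NormOneClass A] {B : E → A} (hB : ContDiff ℝ ∞ B)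
    {x : E} {D : ℝ} (hD : 0 ≤ D) {n : ℕ} (h : ∀ i ≤ n, ‖iteratedFDeriv ℝ i B x‖ ≤ D ^ i) (m : ℕ) :
    ∀ i ≤ n, ‖iteratedFDeriv ℝ i (fun y => B y ^ m) x‖ ≤ (m * D) ^ i := by
  induction m with
  | zero =>
    intro i hi
    -- For `i = 0` the bound is `0 ^ 0 = 1`, the norm of the constant `1`; for `i > 0` both sides
    -- vanish.
    rcases Nat.eq_zero_or_pos i with rfl | hi0
    · simp
    · simp only [pow_zero]
      rw [iteratedFDeriv_const_of_ne hi0.ne']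
      simp [hi0.ne']
  | succ m ih =>
    intro i hi
    simp only [pow_succ]
    refine (norm_iteratedFDeriv_mul_le (hB.pow m) hB x (natCast_le_infty i)).trans ?_
    push_cast
    rw [add_mul, one_mul, add_pow]
    refine Finset.sum_le_sum fun j hj => ?_
    have hj' : j ≤ i := Nat.lt_succ_iff.mp (Finset.mem_range.mp hj)
    calc (i.choose j : ℝ) * ‖iteratedFDeriv ℝ j (fun y => B y ^ m) x‖ *
          ‖iteratedFDeriv ℝ (i - j) B x‖ ≤ (i.choose j : ℝ) * (m * D) ^ j * D ^ (i - j) := by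
          gcongr
          · exact ih j (hj'.trans hi)
          · exact h _ ((Nat.sub_le _ _).trans hi)
      _ = _ := by ring

/-- The majorants are required only on `t`, because the derivatives of orbit maps are controlled
only on bounded sets. The induction differentiates the series once more, the formula for order `k`
being valid in a neighbourhood of the point. -/
theorem iteratedFDeriv_tsum_of_isPreconnected {E F : Type*} [NormedAddCommGroup E]
    [NormedSpace ℝ E] [NormedAddCommGroup F] [NormedSpace ℝ F] [CompleteSpace F]
    {t : Set E} (ht : IsOpen t) (h't : IsPreconnected t) {f : ℕ → E → F} {u : ℕ → ℕ → ℝ}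
    (hf : ∀ i, ContDiff ℝ ∞ (f i)) (hu : ∀ k, Summable (u k))
    (h : ∀ k i, ∀ x ∈ t, ‖iteratedFDeriv ℝ k (f i) x‖ ≤ u k i) (k : ℕ) :
    ∀ x ∈ t, iteratedFDeriv ℝ k (fun y => ∑' n, f n y) x = ∑' n, iteratedFDeriv ℝ k (f n) x := by
  induction k with
  | zero =>
    intro x _
    simp_rw [iteratedFDeriv_zero_eq_comp]
    exact (continuousMultilinearCurryFin0 ℝ E F).symm.toContinuousLinearEquiv.map_tsum
  | succ k ih =>
    intro x hx
    have hd : ∀ n, ∀ y ∈ t, HasFDerivAt (iteratedFDeriv ℝ k (f n))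
        (fderiv ℝ (iteratedFDeriv ℝ k (f n)) y) y := fun n y _ =>
      ((hf n).differentiable_iteratedFDeriv
        (by exact_mod_cast WithTop.coe_lt_top k) y).hasFDerivAt
    have hb : ∀ n, ∀ y ∈ t, ‖fderiv ℝ (iteratedFDeriv ℝ k (f n)) y‖ ≤ u (k + 1) n := by
      intro n y hy
      simpa only [iteratedFDeriv_succ_eq_comp_left, LinearIsometryEquiv.norm_map,
        Function.comp_apply] using h (k + 1) n y hy
    have h1 := hasFDerivAt_tsum_of_isPreconnected (hu (k + 1)) ht h't hd hb hx
      (Summable.of_norm_bounded (hu k) fun n => h k n x hx) hx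
    have h2 : iteratedFDeriv ℝ k (fun y => ∑' n, f n y) =ᶠ[nhds x]
        fun y => ∑' n, iteratedFDeriv ℝ k (f n) y :=
      Filter.eventually_of_mem (ht.mem_nhds hx) ih
    simp_rw [iteratedFDeriv_succ_eq_comp_left, Function.comp_apply]
    rw [h2.fderiv_eq, h1.fderiv]
    exact (continuousMultilinearCurryLeftEquiv ℝ
      (fun _ : Fin (k + 1) => E) F).symm.toContinuousLinearEquiv.map_tsum

/-! ### Monomials -/

/-- The monomial `z ^ m` as an element of `H_s`. -/
def mon (s : ℝ) [Fact (1 < s)] (m : ℕ) : Hilb s :=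
  ofHol (fun z => z ^ m) (differentiable_pow m).differentiableOn (by
    have := isFiniteMeasure_disc s
    refine MemLp.of_bound (by fun_prop) 1 ((ae_discMeasure_iff s).mpr ?_)
    filter_upwards [ae_restrict_mem isOpen_disc.measurableSet] with z hz
    rw [norm_pow]
    exact pow_le_one₀ (norm_nonneg z) (mem_disc.mp hz).le)

lemma hol_mon (s : ℝ) [Fact (1 < s)] (m : ℕ) {z : ℂ} (hz : z ∈ disc) : hol (mon s m) z = z ^ m :=
  hol_ofHol _ _ hz

lemma coefL_mon (s : ℝ) [Fact (1 < s)] (m n : ℕ) :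
    coefL s n (mon s m) = if n = m then 1 else 0 := by
  refine coefL_eq (hol_ae (mon s m)) (a := fun n => if n = m then 1 else 0) (fun z hz => ?_) n
  rw [hol_mon s m hz]
  have h : (fun n => (if n = m then (1 : ℂ) else 0) * z ^ n) =
      fun n => if n = m then z ^ m else 0 := by
    funext n
    split_ifs with h
    · rw [h, one_mul]
    · rw [zero_mul]
  rw [h]
  exact hasSum_ite_eq m (z ^ m)

/-- The map that sends a bounded continuous function to its class in `L²`. -/
def bcfToLp (s : ℝ) [Fact (1 < s)] : (ℂ →ᵇ ℂ) →L[ℂ] Lp ℂ 2 (discMeasure s) :=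
  have := isFiniteMeasure_disc s
  BoundedContinuousFunction.toLp 2 (discMeasure s) ℂ

lemma bcfToLp_ae (s : ℝ) [Fact (1 < s)] (f : ℂ →ᵇ ℂ) : bcfToLp s f =ᵐ[discMeasure s] f := by
  have := isFiniteMeasure_disc s
  exact BoundedContinuousFunction.coeFn_toLp _ _ ℂ f

lemma eq_bcfToLp {s : ℝ} [Fact (1 < s)] {v : Hilb s} {f : ℂ →ᵇ ℂ} (h : Set.EqOn (hol v) f disc) :
    (v : Lp ℂ 2 (discMeasure s)) = bcfToLp s f :=
  Lp.ext ((hol_ae v).trans ((ae_of_eqOn h).trans (bcfToLp_ae s f).symm))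

/-- With absolutely summable coefficients the Taylor series, transported by the group element,
converges already in sup norm. It is identified pointwise on the disc and then mapped to `L²`. -/
lemma orbit_mon_aux (s : ℝ) [Fact (1 < s)] : ∃ M B : ℝ × ℝ × ℝ → ℂ →ᵇ ℂ,
    ContDiff ℝ ∞ M ∧ ContDiff ℝ ∞ B ∧ (∀ q, ‖B q‖ ≤ 1) ∧
    (∀ m, orbit (mon s m) = fun q => bcfToLp s (M q * B q ^ m)) ∧
    ∀ (v : Hilb s) (q : ℝ × ℝ × ℝ), (Summable fun m => ‖coefL s m v‖) →
      HasSum (fun m => coefL s m v • orbit (mon s m) q) (orbit v q) := by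
  obtain ⟨M, B, hM, hB, hB1, h⟩ := exists_orbit_factors s
  have h1 : ∀ m, orbit (mon s m) = fun q => bcfToLp s (M q * B q ^ m) := by
    intro m
    funext q
    refine eq_bcfToLp fun z hz => ?_
    rw [(h q z hz).2, hol_mon s m (h q z hz).1]
    rfl
  refine ⟨M, B, hM, hB, hB1, h1, fun v q hs => ?_⟩
  have hsum : Summable fun m => coefL s m v • (M q * B q ^ m) := by
    refine Summable.of_norm_bounded (hs.mul_right ‖M q‖) fun m => ?_
    rw [norm_smul]
    refine mul_le_mul_of_nonneg_left ?_ (norm_nonneg _)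
    refine (norm_mul_le _ _).trans (mul_le_of_le_one_right (norm_nonneg _) ?_)
    exact (norm_pow_le _ _).trans (pow_le_one₀ (norm_nonneg _) (hB1 q))
  have h2 : orbit v q = bcfToLp s (∑' m, coefL s m v • (M q * B q ^ m)) := by
    refine eq_bcfToLp fun z hz => ?_
    rw [(h q z hz).2 v]
    have h3 := hsum.hasSum.mapL (BoundedContinuousFunction.evalCLM ℂ z)
    have h4 := (hasSum_coefL v (h q z hz).1).mul_left (M q z)
    refine h4.unique ?_
    have h5 : (fun m => M q z * (coefL s m v * B q z ^ m)) =
        fun m => BoundedContinuousFunction.evalCLM ℂ z (coefL s m v • (M q * B q ^ m)) := by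
      funext m
      simp
      ring
    rw [h5]
    exact h3
  rw [h2]
  have h3 := hsum.hasSum.mapL (bcfToLp s)
  simpa only [h1, map_smul] using h3

theorem orbit_mon_contDiff (s : ℝ) [Fact (1 < s)] (m : ℕ) : ContDiff ℝ ∞ (orbit (mon s m)) := by
  obtain ⟨M, B, hM, hB, hB1, h1, -⟩ := orbit_mon_aux s
  rw [h1]
  exact ((bcfToLp s).restrictScalars ℝ).contDiff.comp (hM.mul (hB.pow m))

/-- The Leibniz rule applied to `M · B ^ m`: the derivatives of `M` and `B` are bounded on compact
sets, and the powers contribute at most `(m D) ^ i`. -/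
theorem exists_orbit_mon_bound (s : ℝ) [Fact (1 < s)] (n : ℕ) (R : ℝ) : ∃ C, ∀ m : ℕ,
    ∀ q : ℝ × ℝ × ℝ, ‖q‖ ≤ R → ‖iteratedFDeriv ℝ n (orbit (mon s m)) q‖ ≤ C * ((m : ℝ) + 1) ^ n := by
  obtain ⟨M, B, hM, hB, hB1, h1, -⟩ := orbit_mon_aux s
  have hK := isCompact_closedBall (0 : ℝ × ℝ × ℝ) R
  have hbd : ∀ {f : ℝ × ℝ × ℝ → ℂ →ᵇ ℂ}, ContDiff ℝ ∞ f → ∃ D, 1 ≤ D ∧ ∀ i ≤ n, ∀ q,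
      ‖q‖ ≤ R → ‖iteratedFDeriv ℝ i f q‖ ≤ D := by
    intro f hf
    have hD : ∀ i : ℕ, ∃ C, ∀ q ∈ Metric.closedBall (0 : ℝ × ℝ × ℝ) R,
        ‖iteratedFDeriv ℝ i f q‖ ≤ C := fun i =>
      hK.exists_bound_of_continuousOn (hf.continuous_iteratedFDeriv (natCast_le_infty i)).continuousOn
    choose C hC using hD
    refine ⟨1 + ∑ i ∈ Finset.range (n + 1), |C i|,
      le_add_of_nonneg_right (Finset.sum_nonneg fun _ _ => abs_nonneg _), fun i hi q hq => ?_⟩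
    refine (hC i q (by simpa using hq)).trans ((le_abs_self _).trans
      ((Finset.single_le_sum (f := fun i => |C i|) (fun _ _ => abs_nonneg _)
        (Finset.mem_range.mpr (Nat.lt_succ_of_le hi))).trans (by simp)))
  obtain ⟨DM, hDM, hM1⟩ := hbd hM
  obtain ⟨D, hD, hB2⟩ := hbd hB
  have hD0 : 0 ≤ D := zero_le_one.trans hD
  refine ⟨‖(bcfToLp s).restrictScalars ℝ‖ * (DM * 2 ^ n * D ^ n), fun m q hq => ?_⟩
  have hBi : ∀ i ≤ n, ‖iteratedFDeriv ℝ i B q‖ ≤ D ^ i := by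
    intro i hi
    -- For `i > 0` the bound `D ≥ 1` is weakened to `D ^ i`; for `i = 0` the bound must be `1`,
    -- which is `‖B q‖ ≤ 1`.
    rcases Nat.eq_zero_or_pos i with rfl | hi0
    · simpa using hB1 q
    · exact (hB2 i hi q hq).trans (le_self_pow₀ hD hi0.ne')
  have hpow := norm_iteratedFDeriv_pow_le hB hD0 hBi m
  have hE : 1 ≤ ((m : ℝ) + 1) * D := by
    have : (1 : ℝ) ≤ (m : ℝ) + 1 := by simp
    nlinarith
  have hmul : ‖iteratedFDeriv ℝ n (fun q => M q * B q ^ m) q‖ ≤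
      DM * 2 ^ n * D ^ n * ((m : ℝ) + 1) ^ n := by
    refine (norm_iteratedFDeriv_mul_le hM (hB.pow m) q (natCast_le_infty n)).trans ?_
    calc _ ≤ ∑ i ∈ Finset.range (n + 1), (n.choose i : ℝ) * (DM * (((m : ℝ) + 1) * D) ^ n) := by
          refine Finset.sum_le_sum fun i hi => ?_
          have hi' : i ≤ n := Nat.lt_succ_iff.mp (Finset.mem_range.mp hi)
          rw [mul_assoc]
          gcongr
          · exact hM1 i hi' q hq
          · refine (hpow (n - i) (Nat.sub_le _ _)).trans ?_
            refine le_trans ?_ (pow_le_pow_right₀ hE (Nat.sub_le n i))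
            gcongr
            linarith
      _ = _ := by
          rw [← Finset.sum_mul]
          have : (∑ i ∈ Finset.range (n + 1), (n.choose i : ℝ)) = 2 ^ n := by
            exact_mod_cast Nat.sum_range_choose n
          rw [this, mul_pow]
          ring
  rw [h1]
  have h2 := ((bcfToLp s).restrictScalars ℝ).norm_iteratedFDeriv_comp_left (x := q)
    (hM.mul (hB.pow m)).contDiffAt (natCast_le_infty n)
  refine h2.trans ?_
  rw [mul_assoc]
  exact mul_le_mul_of_nonneg_left hmul (norm_nonneg _)

/-! ### Decay of the Taylor coefficients of smooth vectors -/

/-- The coordinates `(θ, 0, 0)` are a pure rotation, under which `z ^ m` is an eigenvector with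
character `exp (-i (s + 2m) θ)`. -/
lemma coefL_orbit {s : ℝ} [Fact (1 < s)] (v : Hilb s) (m : ℕ) (θ : ℝ) :
    coefL s m (orbit v (θ, 0, 0)) =
      Complex.exp (-((s + 2 * m) * Complex.I) * θ) * coefL s m v := by
  refine coefL_eq (hol_ae _)
    (a := fun m => Complex.exp (-((s + 2 * m) * Complex.I) * θ) * coefL s m v) (fun z hz => ?_) m
  have hz' : Complex.exp (-(2 * θ : ℝ) * Complex.I) * z ∈ disc := by
    rw [mem_disc] at hz ⊢
    rwa [norm_mul, ← Complex.ofReal_neg, Complex.norm_exp_ofReal_mul_I, one_mul]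
  rw [hol_rot _ _ hz, hol_rep' _ _ hz']
  have hden : ∀ z, den (G.mk (Real.exp 0) 0 (Real.exp_pos _)).α
      (G.mk (Real.exp 0) 0 (Real.exp_pos _)).β z = 1 := by
    intro z
    simp [den, G.α, G.β]
  have hmob : ∀ z, mob (G.mk (Real.exp 0) 0 (Real.exp_pos _)).α
      (G.mk (Real.exp 0) 0 (Real.exp_pos _)).β z = z := by
    intro z
    rw [mob, hden]
    simp [G.α, G.β]
  have h1 := (hasSum_coefL v hz').mul_left (Complex.exp (-(s * θ : ℝ) * Complex.I))
  rw [hden, hmob, Complex.one_cpow, one_mul]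
  have h2 : (fun m : ℕ => Complex.exp (-((s + 2 * m) * Complex.I) * θ) * coefL s m v * z ^ m) =
      fun m : ℕ => Complex.exp (-(s * θ : ℝ) * Complex.I) *
        (coefL s m v * (Complex.exp (-(2 * θ : ℝ) * Complex.I) * z) ^ m) := by
    funext m
    rw [mul_pow, ← Complex.exp_nat_mul]
    have : Complex.exp (-((s + 2 * m) * Complex.I) * θ) =
        Complex.exp (-(s * θ : ℝ) * Complex.I) *
          Complex.exp (m * (-(2 * θ : ℝ) * Complex.I)) := by
      rw [← Complex.exp_add]
      congr 1
      push_cast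
      ring
    rw [this]
    ring
  rw [h2]
  exact h1

lemma iteratedDeriv_cexp_mul_ofReal (c d : ℂ) (k : ℕ) :
    iteratedDeriv k (fun θ : ℝ => Complex.exp (c * θ) * d) =
      fun θ : ℝ => c ^ k * (Complex.exp (c * θ) * d) := by
  induction k with
  | zero => simp
  | succ k ih =>
    rw [iteratedDeriv_succ, ih]
    funext θ
    have h1 : HasDerivAt (fun θ : ℝ => c * (θ : ℂ)) c θ := by
      simpa using (Complex.ofRealCLM.hasDerivAt (x := θ)).const_mul c
    have h2 := ((h1.cexp.mul_const d).const_mul (c ^ k)).deriv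
    rw [h2]
    ring

/-- Taking `k + N` derivatives along rotations multiplies the coefficient by a number of modulus `(s
+ 2m) ^ (k + N) ≥ (m + 1) ^ (k + N)`. Of these powers, `N` pay for the norm of `coefL` and `k`
remain as decay. -/
lemma coefL_decay (s : ℝ) [hs : Fact (1 < s)] : ∃ C ≥ 0, ∃ N : ℕ, ∀ (k : ℕ) (v : SmoothVec s) (m : ℕ),
    ‖coefL s m v.toHilb‖ * ((m : ℝ) + 1) ^ k ≤ C * smoothSeminorm s (k + N, 0) v := by
  obtain ⟨C, N, hC⟩ := exists_norm_coefL_le s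
  have hC0 : 0 ≤ C := by simpa using (norm_nonneg _).trans (hC 0)
  refine ⟨C, hC0, N, fun k v m => ?_⟩
  let ι : ℝ →L[ℝ] ℝ × ℝ × ℝ := ContinuousLinearMap.inl ℝ ℝ (ℝ × ℝ)
  let L : Lp ℂ 2 (discMeasure s) →L[ℝ] ℂ := (coefL s m).restrictScalars ℝ
  let c : ℂ := -((s + 2 * m) * Complex.I)
  have hg : (fun θ : ℝ => Complex.exp (c * θ) * coefL s m v.toHilb) =
      L ∘ (orbit v.toHilb ∘ ι) := by
    funext θ
    exact (coefL_orbit v.toHilb m θ).symm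
  have hm1 : (0 : ℝ) < (m : ℝ) + 1 := by positivity
  have hc : (m : ℝ) + 1 ≤ ‖c‖ := by
    simp only [c]
    rw [norm_neg, norm_mul, Complex.norm_I, mul_one]
    have : (s + 2 * m : ℂ) = ((s + 2 * m : ℝ) : ℂ) := by push_cast; rfl
    rw [this, Complex.norm_real]
    refine le_trans ?_ (Real.le_norm_self _)
    linarith [hs.out]
  have hsm : ContDiff ℝ ∞ (orbit v.toHilb ∘ ι) := v.contDiff.comp ι.contDiff
  have h1 : ‖iteratedFDeriv ℝ (k + N) (L ∘ (orbit v.toHilb ∘ ι)) 0‖ ≤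
      C * ((m : ℝ) + 1) ^ N * smoothSeminorm s (k + N, 0) v := by
    refine (L.norm_iteratedFDeriv_comp_left hsm.contDiffAt (natCast_le_infty _)).trans ?_
    have hL : ‖L‖ ≤ C * ((m : ℝ) + 1) ^ N := by
      refine le_trans (le_of_eq ?_) (hC m)
      exact ContinuousLinearMap.norm_restrictScalars _
    refine mul_le_mul hL ?_ (norm_nonneg _) (by positivity)
    rw [ι.iteratedFDeriv_comp_right v.contDiff 0 (natCast_le_infty _)]
    refine (ContinuousMultilinearMap.norm_compContinuousLinearMap_le _ _).trans ?_
    -- The ball of radius `0` is a point, so only derivatives at the identity enter.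
    have h3 := smoothSeminorm_bound (k + N) 0 v (q := ι 0) (by simp)
    refine le_trans (mul_le_of_le_one_right (norm_nonneg _) ?_) h3
    rw [Finset.prod_const]
    exact pow_le_one₀ (norm_nonneg _) (ContinuousLinearMap.norm_inl_le_one ℝ ℝ (ℝ × ℝ))
  rw [← hg, norm_iteratedFDeriv_eq_norm_iteratedDeriv, iteratedDeriv_cexp_mul_ofReal] at h1
  simp only [Complex.ofReal_zero, mul_zero, Complex.exp_zero, one_mul, norm_mul, norm_pow] at h1
  have h2 : ((m : ℝ) + 1) ^ (k + N) * ‖coefL s m v.toHilb‖ ≤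
      C * ((m : ℝ) + 1) ^ N * smoothSeminorm s (k + N, 0) v := by
    refine le_trans ?_ h1
    gcongr
  rw [pow_add] at h2
  have hp : (0 : ℝ) < ((m : ℝ) + 1) ^ N := by positivity
  refine le_of_mul_le_mul_right ?_ hp
  linarith

/-! ### Expansion of smooth vectors in monomials -/

/-- The monomial `z ^ m` as a smooth vector. -/
def smoothMon (s : ℝ) [Fact (1 < s)] (m : ℕ) : SmoothVec s := ⟨mon s m, orbit_mon_contDiff s m⟩

lemma smoothMon_toHilb (s : ℝ) [Fact (1 < s)] (m : ℕ) : (smoothMon s m).toHilb = mon s m := rfl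

/-- The `m`-th Taylor coefficient of a smooth vector. -/
def coef {s : ℝ} [Fact (1 < s)] (v : SmoothVec s) (m : ℕ) : ℂ := coefL s m v.toHilb

lemma coef_add {s : ℝ} [Fact (1 < s)] (v w : SmoothVec s) (m : ℕ) :
    coef (v + w) m = coef v m + coef w m := by
  simp [coef]

lemma coef_smul {s : ℝ} [Fact (1 < s)] (c : ℂ) (v : SmoothVec s) (m : ℕ) :
    coef (c • v) m = c * coef v m := by
  simp [coef]

lemma summable_inv_sq : Summable fun m : ℕ => (((m : ℝ) + 1) ^ 2)⁻¹ := by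
  have := (summable_nat_add_iff 1).mpr (Real.summable_nat_pow_inv.mpr one_lt_two)
  simpa using this

/-- Two further orders of decay supply the summable factor. -/
lemma coef_decay (s : ℝ) [Fact (1 < s)] (k : ℕ) : ∃ C ≥ 0, ∃ n : ℕ, ∀ (v : SmoothVec s) (m : ℕ),
    ‖coef v m‖ * ((m : ℝ) + 1) ^ k ≤ C * smoothSeminorm s (n, 0) v * (((m : ℝ) + 1) ^ 2)⁻¹ := by
  obtain ⟨C, hC, N, h⟩ := coefL_decay s
  refine ⟨C, hC, k + 2 + N, fun v m => ?_⟩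
  rw [← div_eq_mul_inv, le_div_iff₀ (by positivity), mul_assoc, ← pow_add]
  exact h (k + 2) v m

lemma summable_coef {s : ℝ} [Fact (1 < s)] (v : SmoothVec s) (k : ℕ) :
    Summable fun m => ‖coef v m‖ * ((m : ℝ) + 1) ^ k := by
  obtain ⟨C, hC, n, h⟩ := coef_decay s k
  exact Summable.of_nonneg_of_le (fun m => by positivity) (h v) (summable_inv_sq.mul_left _)

/-- Rapid decay of the coefficients beats the polynomial growth of the monomial orbits. The majorant
does not depend on `q`, as uniform convergence requires. -/
lemma hasSum_iteratedFDeriv_orbit {s : ℝ} [Fact (1 < s)] (v : SmoothVec s) (n : ℕ) (R : ℝ) :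
    ∃ u : ℕ → ℝ, Summable u ∧ ∀ q : ℝ × ℝ × ℝ, ‖q‖ < R →
      (∀ m, ‖coef v m • iteratedFDeriv ℝ n (orbit (mon s m)) q‖ ≤ u m) ∧
      HasSum (fun m => coef v m • iteratedFDeriv ℝ n (orbit (mon s m)) q)
        (iteratedFDeriv ℝ n (orbit v.toHilb) q) := by
  choose C hC using fun k => exists_orbit_mon_bound s k R
  let u : ℕ → ℕ → ℝ := fun k m => C k * (‖coef v m‖ * ((m : ℝ) + 1) ^ k)
  have hu : ∀ k, Summable (u k) := fun k => (summable_coef v k).mul_left _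
  have hd : ∀ k m q, iteratedFDeriv ℝ k (fun q => coef v m • orbit (mon s m) q) q =
      coef v m • iteratedFDeriv ℝ k (orbit (mon s m)) q := fun k m q =>
    iteratedFDeriv_const_smul_apply (a := coef v m) (x := q)
      ((orbit_mon_contDiff s m).of_le (natCast_le_infty k)).contDiffAt
  have hfu : ∀ k m, ∀ q ∈ Metric.ball (0 : ℝ × ℝ × ℝ) R,
      ‖coef v m • iteratedFDeriv ℝ k (orbit (mon s m)) q‖ ≤ u k m := by
    intro k m q hq
    rw [norm_smul]
    calc _ ≤ ‖coef v m‖ * (C k * ((m : ℝ) + 1) ^ k) := by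
          gcongr
          exact hC k m q (mem_ball_zero_iff.mp hq).le
      _ = _ := by ring
  have hsum : orbit v.toHilb = fun q => ∑' m, coef v m • orbit (mon s m) q := by
    funext q
    obtain ⟨M, B, -, -, -, -, h⟩ := orbit_mon_aux s
    refine (h v.toHilb q ?_).tsum_eq.symm
    simpa [coef] using summable_coef v 0
  refine ⟨u n, hu n, fun q hq => ?_⟩
  have hq' := mem_ball_zero_iff.mpr hq
  refine ⟨fun m => hfu n m q hq', ?_⟩
  have h2 := iteratedFDeriv_tsum_of_isPreconnected Metric.isOpen_ball
    (convex_ball (0 : ℝ × ℝ × ℝ) R).isPreconnected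
    (f := fun m q => coef v m • orbit (mon s m) q)
    (fun m => (orbit_mon_contDiff s m).const_smul (coef v m)) hu
    (fun k m q hq => by rw [hd]; exact hfu k m q hq) n q hq'
  simp only [hd] at h2
  rw [hsum, h2]
  exact (Summable.of_norm_bounded (hu n) fun m => hfu n m q hq').hasSum

lemma iteratedFDeriv_orbit_sum_sub {s : ℝ} [Fact (1 < s)] (v : SmoothVec s) (n : ℕ) (S : Finset ℕ)
    (q : ℝ × ℝ × ℝ) :
    iteratedFDeriv ℝ n (orbit ((∑ m ∈ S, coef v m • smoothMon s m) - v).toHilb) q =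
      ∑ m ∈ S, coef v m • iteratedFDeriv ℝ n (orbit (mon s m)) q -
        iteratedFDeriv ℝ n (orbit v.toHilb) q := by
  have horb : orbit ((∑ m ∈ S, coef v m • smoothMon s m) - v).toHilb =
      (fun q => ∑ m ∈ S, (coef v m • orbit (mon s m)) q) - orbit v.toHilb := by
    funext q
    rw [map_sub, map_sum]
    simp [orbit, smoothMon_toHilb]
  have hf : ∀ m, ContDiff ℝ n (coef v m • orbit (mon s m)) := fun m =>
    ((orbit_mon_contDiff s m).of_le (natCast_le_infty n)).const_smul (coef v m)
  rw [horb, iteratedFDeriv_sub_apply (ContDiff.sum fun m _ => hf m).contDiffAt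
    (v.contDiff.of_le (natCast_le_infty n)).contDiffAt,
    iteratedFDeriv_fun_sum_apply fun m _ => (hf m).contDiffAt]
  congr 1
  refine Finset.sum_congr rfl fun m _ => ?_
  exact iteratedFDeriv_const_smul_apply
    ((orbit_mon_contDiff s m).of_le (natCast_le_infty n)).contDiffAt

lemma norm_sum_sub_le_tsum_compl {E : Type*} [NormedAddCommGroup E] [CompleteSpace E] {f : ℕ → E}
    {a : E} {u : ℕ → ℝ} (hf : HasSum f a) (hu : Summable u) (h : ∀ m, ‖f m‖ ≤ u m) (S : Finset ℕ) :
    ‖∑ m ∈ S, f m - a‖ ≤ ∑' m : { m // m ∉ S }, u m := by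
  rw [← hf.tsum_eq, ← hf.summable.sum_add_tsum_subtype_compl S, sub_add_cancel_left, norm_neg]
  exact tsum_of_norm_bounded (hu.subtype _).hasSum fun m => h m

theorem hasSum_smoothMon {s : ℝ} [Fact (1 < s)] (v : SmoothVec s) :
    HasSum (fun m => coef v m • smoothMon s m) v := by
  rw [HasSum, SummationFilter.unconditional_filter, (withSeminorms s).tendsto_nhds]
  rintro ⟨n, R⟩ ε hε
  -- Termwise differentiation is available on open balls, the seminorm uses a closed one; hence `R +
  -- 1`.
  obtain ⟨u, hu, h⟩ := hasSum_iteratedFDeriv_orbit v n ((R : ℝ) + 1)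
  have htail := tendsto_tsum_compl_atTop_zero u
  rw [Metric.tendsto_nhds] at htail
  filter_upwards [htail (ε / 2) (half_pos hε)] with S hS
  refine lt_of_le_of_lt ?_ (half_lt_self hε)
  have hS0 : ∑' m : { m // m ∉ S }, u m ≤ ε / 2 :=
    (le_abs_self _).trans (by simpa [Real.dist_eq] using hS.le)
  rw [(smoothSeminorm_apply s n R _).2]
  have : Nonempty (Metric.closedBall (0 : ℝ × ℝ × ℝ) R) := ⟨⟨0, by simp⟩⟩
  refine ciSup_le ?_
  rintro ⟨q, hq⟩
  rw [mem_closedBall_zero_iff] at hq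
  obtain ⟨h1, h2⟩ := h q (by linarith)
  rw [iteratedFDeriv_orbit_sum_sub]
  exact (norm_sum_sub_le_tsum_compl h2 hu h1 S).trans hS0

/-- By continuity a functional is determined by its values on monomials; conjugate linearity
conjugates the coefficients. -/
theorem hasSum_distVec {s : ℝ} [Fact (1 < s)] (φ : DistVec s) (v : SmoothVec s) :
    HasSum (fun m => conj (coef v m) * φ (smoothMon s m)) (φ v) := by
  have h := (hasSum_smoothMon v).map φ φ.continuous
  have h1 : φ ∘ (fun m => coef v m • smoothMon s m) =
      fun m => conj (coef v m) * φ (smoothMon s m) := by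
    funext m
    simp
  rwa [h1] at h

/-- The continuous conjugate linear functional with prescribed values on the monomials. -/
theorem exists_distVec {s : ℝ} [Fact (1 < s)] {g : ℕ → ℂ} {C : ℝ} {N : ℕ}
    (hg : ∀ m, ‖g m‖ ≤ C * ((m : ℝ) + 1) ^ N) : ∃ φ : DistVec s, ∀ m, φ (smoothMon s m) = g m := by
  have hC : 0 ≤ C := by simpa using (norm_nonneg _).trans (hg 0)
  have hle : ∀ (v : SmoothVec s) m, ‖conj (coef v m) * g m‖ ≤
      C * (‖coef v m‖ * ((m : ℝ) + 1) ^ N) := by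
    intro v m
    rw [norm_mul, Complex.norm_conj]
    calc _ ≤ ‖coef v m‖ * (C * ((m : ℝ) + 1) ^ N) := by gcongr; exact hg m
      _ = _ := by ring
  have hs : ∀ v : SmoothVec s, Summable fun m => conj (coef v m) * g m := fun v =>
    Summable.of_norm_bounded ((summable_coef v N).mul_left C) (hle v)
  let L : SmoothVec s →ₗ⋆[ℂ] ℂ :=
    { toFun := fun v => ∑' m, conj (coef v m) * g m
      map_add' := fun v w => by
        rw [← (hs v).tsum_add (hs w)]
        simp only [coef_add, map_add, add_mul]
      map_smul' := fun c v => by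
        rw [smul_eq_mul, ← tsum_mul_left]
        simp only [coef_smul, map_mul, mul_assoc] }
  have hL : Continuous L := by
    -- The decay of order `N` absorbs the growth of `g`, so a single seminorm at the identity bounds
    -- the functional.
    obtain ⟨D, hD, n, h⟩ := coef_decay s N
    have hpos : 0 ≤ ∑' m : ℕ, (((m : ℝ) + 1) ^ 2)⁻¹ := tsum_nonneg fun m => by positivity
    refine WithSeminorms.continuous_normedSpace_rng ℂ (withSeminorms s) L
      ⟨{(n, 0)}, ⟨C * D * ∑' m : ℕ, (((m : ℝ) + 1) ^ 2)⁻¹, by positivity⟩, fun v => ?_⟩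
    rw [Finset.sup_singleton]
    change ‖∑' m, conj (coef v m) * g m‖ ≤ (C * D * ∑' m : ℕ, (((m : ℝ) + 1) ^ 2)⁻¹) *
      smoothSeminorm s (n, 0) v
    refine (tsum_of_norm_bounded
      (summable_inv_sq.hasSum.mul_left (C * (D * smoothSeminorm s (n, 0) v)))
      fun m => ?_).trans (le_of_eq (by ring))
    refine (hle v m).trans ?_
    rw [mul_assoc]
    exact mul_le_mul_of_nonneg_left (h v m) hC
  refine ⟨⟨L, hL⟩, fun m => ?_⟩
  change ∑' n, conj (coef (smoothMon s m) n) * g n = g m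
  rw [tsum_eq_single m]
  · simp [coef, smoothMon_toHilb, coefL_mon]
  · intro n hn
    simp [coef, smoothMon_toHilb, coefL_mon, hn]

lemma distVec_ext {s : ℝ} [Fact (1 < s)] {φ ψ : DistVec s}
    (h : ∀ m, φ (smoothMon s m) = ψ (smoothMon s m)) : φ = ψ := by
  ext v
  have h1 := hasSum_distVec φ v
  simp only [h] at h1
  exact h1.unique (hasSum_distVec ψ v)

lemma norm_distVec_le {s : ℝ} [Fact (1 < s)] {φ : DistVec s} {C : ℝ} {N : ℕ}
    (h : ∀ m, ‖φ (smoothMon s m)‖ ≤ C * ((m : ℝ) + 1) ^ N) (v : SmoothVec s) :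
    ‖φ v‖ ≤ C * ∑' m, ‖coef v m‖ * ((m : ℝ) + 1) ^ N := by
  rw [← (hasSum_distVec φ v).tsum_eq]
  refine tsum_of_norm_bounded ((summable_coef v N).hasSum.mul_left C) fun m => ?_
  rw [norm_mul, Complex.norm_conj]
  calc _ ≤ ‖coef v m‖ * (C * ((m : ℝ) + 1) ^ N) := by gcongr; exact h m
    _ = _ := by ring

/-! ### The voice transform -/

/-- The point of the disc to which `x` moves the origin. -/
def G.pt (x : G) : ℂ := conj (conj x.β / x.α)

lemma G.norm_pt (x : G) : ‖x.pt‖ < 1 := by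
  rw [pt, Complex.norm_conj]
  exact x.norm_κ

/-- Since `u = 1`, the vector `π_s(x) u` is the multiplier `α ^ (-s) (1 - conj (pt) z) ^ (-s)`
itself, expanded by the binomial series. -/
lemma coef_rep_one {s : ℝ} [Fact (1 < s)] (x : G) (m : ℕ) :
    coef (smoothRep s x (wavelet s)) m = x.α ^ (-(s : ℂ)) * (binom s m * conj x.pt ^ m) := by
  refine coefL_eq (hol_ae _)
    (a := fun m => x.α ^ (-(s : ℂ)) * (binom s m * conj x.pt ^ m)) (fun z hz => ?_) m
  rw [smoothRep_toHilb, hol_rep' _ _ hz, den_cpow _ _ hz]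
  have h1 : hol (wavelet s).toHilb (mob x.α x.β z) = 1 := hol_one s (mob_mem x.norm_sub hz)
  have h2 : ‖conj x.β / x.α * z‖ < 1 := by
    rw [mem_disc] at hz
    rw [norm_mul]
    exact mul_lt_one_of_nonneg_of_lt_one_left (norm_nonneg _) x.norm_κ hz.le
  have h3 := (hasSum_binom s h2).mul_left (x.α ^ (-(s : ℂ)))
  rw [h1, mul_one]
  simpa only [G.pt, Complex.conj_conj, mul_pow, mul_assoc] using h3

/-- The holomorphic function on the disc that corresponds to a distribution vector. -/
def symbol {s : ℝ} [Fact (1 < s)] (φ : DistVec s) (w : ℂ) : ℂ :=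
  ∑' m, conj (binom s m) * φ (smoothMon s m) * w ^ m

/-- Pairing `φ` with this kernel term by term turns `conj (pt)` into `pt`, so the result is
holomorphic in `pt`. -/
lemma voice_eq {s : ℝ} [Fact (1 < s)] (φ : DistVec s) (x : G) :
    HasSum (fun m => conj (binom s m) * φ (smoothMon s m) * x.pt ^ m) (symbol φ x.pt) ∧
    voice φ x = conj (x.α ^ (-(s : ℂ))) * symbol φ x.pt := by
  have h := hasSum_distVec φ (smoothRep s x (wavelet s))
  -- This factor is non-zero, so convergence of the pairing implies convergence of the symbol's
  -- series.
  have h0 : conj (x.α ^ (-(s : ℂ))) ≠ 0 := by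
    rw [ne_eq, map_eq_zero, Complex.cpow_eq_zero_iff]
    exact fun h => x.α_ne h.1
  have h1 : (fun m => conj (coef (smoothRep s x (wavelet s)) m) * φ (smoothMon s m)) =
      fun m => conj (x.α ^ (-(s : ℂ))) * (conj (binom s m) * φ (smoothMon s m) * x.pt ^ m) := by
    funext m
    rw [coef_rep_one]
    simp only [map_mul, map_pow, Complex.conj_conj]
    ring
  rw [h1] at h
  have h2 : Summable fun m => conj (binom s m) * φ (smoothMon s m) * x.pt ^ m :=
    (summable_mul_left_iff h0).mp h.summable
  exact ⟨h2.hasSum, h.unique (h2.hasSum.mul_left _)⟩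

lemma measurable_a : Measurable G.a := measurable_fst.comp (comap_measurable _)

lemma measurable_b : Measurable G.b := measurable_snd.comp (comap_measurable _)

lemma measurable_α : Measurable G.α := by
  have h1 := measurable_a
  have h2 := measurable_b
  unfold G.α
  fun_prop

lemma measurable_pt : Measurable G.pt := by
  have h1 := measurable_a
  have h2 := measurable_b
  have h3 := measurable_α
  have h4 : Measurable G.β := by
    unfold G.β
    fun_prop
  unfold G.pt
  fun_prop

lemma measurable_voice {s : ℝ} [Fact (1 < s)] (φ : DistVec s) : Measurable (voice φ) := by
  have h1 : Measurable fun x : G => symbol φ x.pt := by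
    have h2 : ∀ n, Measurable fun x : G => ∑ m ∈ Finset.range n,
        conj (binom s m) * φ (smoothMon s m) * x.pt ^ m := fun n =>
      Finset.measurable_fun_sum _ fun m _ => (measurable_pt.pow_const m).const_mul _
    have h3 : ∀ x : G, Filter.Tendsto (fun n => ∑ m ∈ Finset.range n,
        conj (binom s m) * φ (smoothMon s m) * x.pt ^ m) Filter.atTop (nhds (symbol φ x.pt)) :=
      fun x => (voice_eq φ x).1.tendsto_sum_nat
    exact measurable_of_tendsto_metrizable h2 (tendsto_pi_nhds.mpr h3)
  rw [funext fun x => (voice_eq φ x).2]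
  exact (Complex.continuous_conj.measurable.comp (measurable_α.pow_const _)).mul h1

/-! ### The Haar measure in coordinates of the disc -/

/-- The coordinates `(a, b)` of an element of `G` as a complex number. -/
def G.cpt (x : G) : ℂ := ⟨x.a, x.b⟩

lemma G.cpt_injective : Function.Injective G.cpt := fun _ _ h =>
  G.ext (congrArg Complex.re h) (congrArg Complex.im h)

/-- The right half plane. -/
def halfPlane : Set ℂ := {z | 0 < z.re}

lemma measurableSet_halfPlane : MeasurableSet halfPlane :=
  measurableSet_lt measurable_const Complex.measurable_re

lemma measurableEmbedding_coord : MeasurableEmbedding fun x : G => (x.a, x.b) := by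
  refine ⟨fun x y h => G.ext (congrArg Prod.fst h) (congrArg Prod.snd h),
    comap_measurable _, ?_⟩
  rintro _ ⟨t, ht, rfl⟩
  have : (fun x : G => (x.a, x.b)) '' ((fun x : G => (x.a, x.b)) ⁻¹' t) =
      t ∩ {p : ℝ × ℝ | 0 < p.1} := by
    rw [Set.image_preimage_eq_inter_range]
    congr 1
    ext p
    constructor
    · rintro ⟨x, rfl⟩
      exact x.a_pos
    · intro hp
      exact ⟨G.mk p.1 p.2 hp, by simp⟩
  rw [this]
  exact ht.inter (measurableSet_lt measurable_const measurable_fst)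

/-- No measurability of `F` is needed, since the coordinate map is a measurable embedding. -/
theorem lintegral_haar (F : ℂ → ENNReal) : ∫⁻ x, F x.cpt ∂haar =
    ∫⁻ z in halfPlane, ENNReal.ofReal (1 / z.re ^ 2) * F z := by
  have hm : Measurable fun x : G => ENNReal.ofReal (1 / x.a ^ 2) := by
    have := measurable_a
    fun_prop
  have hr : Set.range (fun x : G => (x.a, x.b)) = {p : ℝ × ℝ | 0 < p.1} := by
    ext p
    constructor
    · rintro ⟨x, rfl⟩
      exact x.a_pos
    · intro hp
      exact ⟨G.mk p.1 p.2 hp, by simp⟩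
  rw [haar, lintegral_withDensity_eq_lintegral_mul_non_measurable _ hm
    (Filter.Eventually.of_forall fun _ => ENNReal.ofReal_lt_top)]
  have h1 := measurableEmbedding_coord.lintegral_map
    (μ := Measure.comap (fun x : G => (x.a, x.b)) volume)
    (fun p : ℝ × ℝ => ENNReal.ofReal (1 / p.1 ^ 2) * F ⟨p.1, p.2⟩)
  rw [measurableEmbedding_coord.map_comap, hr] at h1
  refine h1.symm.trans ?_
  exact (Complex.volume_preserving_equiv_real_prod.setLIntegral_comp_preimage_emb
    Complex.measurableEquivRealProd.measurableEmbedding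
    (fun p : ℝ × ℝ => ENNReal.ofReal (1 / p.1 ^ 2) * F ⟨p.1, p.2⟩) {p : ℝ × ℝ | 0 < p.1}).symm

lemma det_complexSmulRight (c : ℂ) :
    (((1 : ℂ →L[ℂ] ℂ).smulRight c).restrictScalars ℝ).det = ‖c‖ ^ 2 := by
  simp [ContinuousLinearMap.det, LinearMap.det_restrictScalars,
    Algebra.norm_complex_eq, Complex.normSq_eq_norm_sq]

/-- The real linear map `z ↦ (p * re z + q * im z) + i * (r * re z + t * im z)`. -/
def realMap (p q r t : ℝ) : ℂ →L[ℝ] ℂ :=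
  Complex.ofRealCLM.comp (p • Complex.reCLM + q • Complex.imCLM) +
    Complex.I • Complex.ofRealCLM.comp (r • Complex.reCLM + t • Complex.imCLM)

lemma det_realMap (p q r t : ℝ) : (realMap p q r t).det = p * t - q * r := by
  rw [ContinuousLinearMap.det, ← LinearMap.det_toMatrix Complex.basisOneI, Matrix.det_fin_two]
  simp [LinearMap.toMatrix_apply, realMap]

/-- The passage from the coordinates `(a, b)` to the upper half plane, `(a, b) ↦ a b + i a²`. -/
def toUpper (z : ℂ) : ℂ := (z.re * z.im : ℝ) + Complex.I * (z.re ^ 2 : ℝ)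

lemma hasFDerivAt_toUpper (z : ℂ) :
    HasFDerivAt toUpper (realMap z.im z.re (2 * z.re) 0) z := by
  have h1 : HasFDerivAt (fun z : ℂ => z.re) Complex.reCLM z := Complex.reCLM.hasFDerivAt
  have h2 : HasFDerivAt (fun z : ℂ => z.im) Complex.imCLM z := Complex.imCLM.hasFDerivAt
  have h3 := Complex.ofRealCLM.hasFDerivAt.comp z (h1.mul h2)
  have h4 := (Complex.ofRealCLM.hasFDerivAt.comp z (h1.pow 2)).const_smul Complex.I
  refine (h3.add h4).congr_fderiv ?_
  ext w
  simp [realMap]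
  ring

/-- The Cayley transform of the upper half plane to the disc. -/
def cayley (τ : ℂ) : ℂ := (τ - Complex.I) / (1 - Complex.I * τ)

lemma cayley_den_ne {τ : ℂ} (h : 0 < τ.im) : 1 - Complex.I * τ ≠ 0 := by
  intro h0
  have := congrArg Complex.re h0
  simp at this
  linarith

lemma hasDerivAt_cayley {τ : ℂ} (h : 0 < τ.im) :
    HasDerivAt cayley (2 / (1 - Complex.I * τ) ^ 2) τ := by
  have h1 : HasDerivAt (fun τ : ℂ => τ - Complex.I) 1 τ := (hasDerivAt_id τ).sub_const _
  have h2 : HasDerivAt (fun τ : ℂ => 1 - Complex.I * τ) (-Complex.I) τ := by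
    simpa using ((hasDerivAt_id τ).const_mul Complex.I).const_sub 1
  refine (h1.div h2 (cayley_den_ne h)).congr_deriv ?_
  congr 1
  ring_nf
  rw [Complex.I_sq]
  ring

lemma one_sub_cayley {τ : ℂ} (h : 0 < τ.im) :
    1 - ‖cayley τ‖ ^ 2 = 4 * τ.im / ‖1 - Complex.I * τ‖ ^ 2 := by
  have h0 : ‖1 - Complex.I * τ‖ ≠ 0 := norm_ne_zero_iff.mpr (cayley_den_ne h)
  rw [cayley, norm_div, div_pow, one_sub_div (pow_ne_zero 2 h0)]
  congr 1
  simp only [← Complex.normSq_eq_norm_sq, Complex.normSq_apply]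
  simp
  ring

lemma toUpper_im (z : ℂ) : (toUpper z).im = z.re ^ 2 := by simp [toUpper, -Complex.ofReal_pow]

lemma toUpper_re (z : ℂ) : (toUpper z).re = z.re * z.im := by simp [toUpper, -Complex.ofReal_pow]

/-- The point `a b + i a²` is the image of `i` under the matrix of `x`, and the Cayley transform
sends `i` to `0` and intertwines the two actions. -/
lemma pt_eq (x : G) : x.pt = cayley (toUpper x.cpt) := by
  have ha : (x.a : ℂ) ≠ 0 := by exact_mod_cast x.a_pos.ne'
  have h1 : 0 < (toUpper x.cpt).im := by
    rw [toUpper_im]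
    exact pow_pos x.a_pos 2
  have h0 : conj x.α ≠ 0 := (map_ne_zero _).mpr x.α_ne
  rw [G.pt, map_div₀, Complex.conj_conj, cayley, div_eq_div_iff h0 (cayley_den_ne h1)]
  simp only [toUpper, G.cpt, G.α, G.β, map_div₀, map_add, map_mul, map_inv₀, Complex.conj_I,
    Complex.conj_ofReal, map_ofNat]
  push_cast
  field_simp
  ring_nf
  simp only [Complex.I_sq, Complex.I_pow_three]
  ring

lemma image_cayley_toUpper : (fun z => cayley (toUpper z)) '' halfPlane = disc := by
  ext w
  constructor
  · rintro ⟨z, hz, rfl⟩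
    have : z = (G.mk z.re z.im hz).cpt :=
      Complex.ext (G.mk_a z.re z.im hz).symm (G.mk_b z.re z.im hz).symm
    simp only
    rw [this, ← pt_eq, mem_disc]
    exact G.norm_pt _
  · intro hw
    have hre := re_pos_of_disc hw
    have h0 : 1 + Complex.I * w ≠ 0 := fun h => by rw [h] at hre; simp at hre
    -- The inverse Cayley transform of `w`; then `a = √(im τ)` and `b = re τ / a`.
    let τ : ℂ := (w + Complex.I) / (1 + Complex.I * w)
    have hτ : 0 < τ.im := by
      rw [mem_disc] at hw
      have h1 : τ.im = (1 - ‖w‖ ^ 2) / Complex.normSq (1 + Complex.I * w) := by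
        have : Complex.normSq (1 + Complex.I * w) ≠ 0 := (Complex.normSq_pos.mpr h0).ne'
        simp only [τ]
        rw [Complex.div_im, ← sub_div]
        congr 1
        rw [← Complex.normSq_eq_norm_sq, Complex.normSq_apply]
        simp
        ring
      rw [h1]
      have := Complex.normSq_pos.mpr h0
      have : 0 < 1 - ‖w‖ ^ 2 := by nlinarith [norm_nonneg w]
      positivity
    have hs : 0 < Real.sqrt τ.im := Real.sqrt_pos.mpr hτ
    refine ⟨⟨Real.sqrt τ.im, τ.re / Real.sqrt τ.im⟩, hs, ?_⟩
    have h2 : toUpper ⟨Real.sqrt τ.im, τ.re / Real.sqrt τ.im⟩ = τ := by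
      apply Complex.ext
      · rw [toUpper_re]
        field_simp
      · rw [toUpper_im]
        exact Real.sq_sqrt hτ.le
    simp only
    rw [h2, cayley, div_eq_iff (cayley_den_ne hτ)]
    have h3 : τ * (1 + Complex.I * w) = w + Complex.I := div_mul_cancel₀ _ h0
    linear_combination h3

lemma injOn_cayley_toUpper : Set.InjOn (fun z => cayley (toUpper z)) halfPlane := by
  intro z hz w hw h
  have hzp : 0 < z.re := hz
  have hwp : 0 < w.re := hw
  have h1 : 0 < (toUpper z).im := by rw [toUpper_im]; positivity
  have h2 : 0 < (toUpper w).im := by rw [toUpper_im]; positivity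
  simp only [cayley] at h
  rw [div_eq_div_iff (cayley_den_ne h1) (cayley_den_ne h2)] at h
  have h3 : toUpper z = toUpper w := by
    have : (2 : ℂ) * toUpper z = 2 * toUpper w := by
      linear_combination h + (toUpper z - toUpper w) * Complex.I_sq
    exact mul_left_cancel₀ two_ne_zero this
  have h4 := congrArg Complex.im h3
  have h5 := congrArg Complex.re h3
  rw [toUpper_im, toUpper_im] at h4
  rw [toUpper_re, toUpper_re] at h5
  have h6 : z.re = w.re := (sq_eq_sq₀ hzp.le hwp.le).mp h4
  rw [h6] at h5
  exact Complex.ext h6 (mul_left_cancel₀ hwp.ne' h5)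

/-- With `τ = a b + i a²` the Jacobian is `2a² · 4 / |1 - iτ|⁴`, while `1 - |w|² = 4a² / |1 - iτ|²`.
Their combination with the density `2 / (1 - |w|²)²` is exactly `1 / a²`. -/
theorem lintegral_haar_pt (g : ℂ → ENNReal) : ∫⁻ x, g x.pt ∂haar =
    ∫⁻ w in disc, ENNReal.ofReal (2 / (1 - ‖w‖ ^ 2) ^ 2) * g w := by
  simp only [pt_eq]
  rw [lintegral_haar fun z => g (cayley (toUpper z)), ← image_cayley_toUpper]
  have hd : ∀ z ∈ halfPlane, HasFDerivWithinAt (fun z => cayley (toUpper z))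
      ((((1 : ℂ →L[ℂ] ℂ).smulRight (2 / (1 - Complex.I * toUpper z) ^ 2)).restrictScalars ℝ).comp
        (realMap z.im z.re (2 * z.re) 0)) halfPlane z := by
    intro z hz
    have h1 : 0 < (toUpper z).im := by rw [toUpper_im]; exact pow_pos hz 2
    exact (((hasDerivAt_cayley h1).hasFDerivAt.restrictScalars ℝ).comp z
      (hasFDerivAt_toUpper z)).hasFDerivWithinAt
  rw [lintegral_image_eq_lintegral_abs_det_fderiv_mul volume measurableSet_halfPlane hd
    injOn_cayley_toUpper]
  refine setLIntegral_congr_fun measurableSet_halfPlane fun z hz => ?_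
  have hzp : 0 < z.re := hz
  have h1 : 0 < (toUpper z).im := by rw [toUpper_im]; positivity
  have h0 : ‖1 - Complex.I * toUpper z‖ ≠ 0 := norm_ne_zero_iff.mpr (cayley_den_ne h1)
  rw [← mul_assoc, ← ENNReal.ofReal_mul (abs_nonneg _), one_sub_cayley h1, toUpper_im]
  congr 2
  have hdet : ((((1 : ℂ →L[ℂ] ℂ).smulRight
      (2 / (1 - Complex.I * toUpper z) ^ 2)).restrictScalars ℝ).comp
      (realMap z.im z.re (2 * z.re) 0)).det =
      ‖2 / (1 - Complex.I * toUpper z) ^ 2‖ ^ 2 * (z.im * 0 - z.re * (2 * z.re)) := by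
    rw [← det_complexSmulRight, ← det_realMap]
    exact LinearMap.det_comp _ _
  rw [hdet, mul_zero, zero_sub, mul_neg, abs_neg, abs_of_nonneg (by positivity), norm_div, norm_pow,
    Complex.norm_ofNat]
  field_simp
  norm_num

/-! ### Left translation and Haar measure. -/

/-- Left translation by `x` has Jacobian `x.a ²` in the coordinates, which cancels the change of `1
/ a²`. An inequality is enough for invariance of the coorbit space, and needs only that translation
maps the half plane into itself. -/
theorem lintegral_haar_mul_left_le (x : G) (f : G → ENNReal) :
    ∫⁻ y, f (x * y) ∂haar ≤ ∫⁻ y, f y ∂haar := by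
  let F : ℂ → ENNReal := Function.extend G.cpt f 0
  have hF : ∀ y : G, F y.cpt = f y := fun y => G.cpt_injective.extend_apply f 0 y
  let T : ℂ → ℂ := fun z => (x.a * z.re : ℝ) + Complex.I * (x.a * z.im + x.b * z.re⁻¹ : ℝ)
  have hTre : ∀ z, (T z).re = x.a * z.re := fun z => by simp only [T]; simp
  have hTim : ∀ z, (T z).im = x.a * z.im + x.b * z.re⁻¹ := fun z => by
    simp only [T]
    rw [Complex.add_im, Complex.ofReal_im, zero_add, Complex.mul_im]
    simp only [Complex.ofReal_re, Complex.ofReal_im, Complex.I_re, Complex.I_im]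
    ring
  have hT : ∀ y : G, (x * y).cpt = T y.cpt := fun y =>
    Complex.ext (by rw [hTre]; exact G.a_mul x y) (by rw [hTim]; exact G.b_mul x y)
  have hd : ∀ z ∈ halfPlane, HasFDerivWithinAt T
      (realMap x.a 0 (-(x.b / z.re ^ 2)) x.a) halfPlane z := by
    intro z hz
    have hzp : z.re ≠ 0 := (show 0 < z.re from hz).ne'
    have h1 : HasFDerivAt (fun z : ℂ => z.re) Complex.reCLM z := Complex.reCLM.hasFDerivAt
    have h2 : HasFDerivAt (fun z : ℂ => z.im) Complex.imCLM z := Complex.imCLM.hasFDerivAt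
    have h3 := Complex.ofRealCLM.hasFDerivAt.comp z (h1.const_mul x.a)
    have h5 : HasFDerivAt (fun z : ℂ => z.re⁻¹) (-(z.re ^ 2)⁻¹ • Complex.reCLM) z :=
      (hasDerivAt_inv hzp).comp_hasFDerivAt z h1
    have h4 := (Complex.ofRealCLM.hasFDerivAt.comp z
      ((h2.const_mul x.a).add (h5.const_mul x.b))).const_smul Complex.I
    refine ((h3.add h4).congr_fderiv ?_).hasFDerivWithinAt
    ext w
    simp [realMap]
    ring
  have hinj : Set.InjOn T halfPlane := by
    intro z _ w _ h
    have h1 := congrArg Complex.re h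
    have h2 := congrArg Complex.im h
    rw [hTre, hTre] at h1
    rw [hTim, hTim] at h2
    have h3 := mul_left_cancel₀ x.a_pos.ne' h1
    rw [h3] at h2
    exact Complex.ext h3 (mul_left_cancel₀ x.a_pos.ne' (add_right_cancel h2))
  simp only [← hF, hT]
  rw [lintegral_haar fun z => F (T z), lintegral_haar]
  calc _ = ∫⁻ z in halfPlane, ENNReal.ofReal |(realMap x.a 0 (-(x.b / z.re ^ 2)) x.a).det| *
        (fun w : ℂ => ENNReal.ofReal (1 / w.re ^ 2) * F w) (T z) := by
        refine setLIntegral_congr_fun measurableSet_halfPlane fun z hz => ?_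
        have hzp : 0 < z.re := hz
        have ha := x.a_pos
        simp only
        rw [← mul_assoc, ← ENNReal.ofReal_mul (abs_nonneg _), hTre, det_realMap]
        congr 2
        rw [zero_mul, sub_zero, abs_of_pos (by positivity)]
        field_simp
    _ = ∫⁻ z in T '' halfPlane, ENNReal.ofReal (1 / z.re ^ 2) * F z :=
        (lintegral_image_eq_lintegral_abs_det_fderiv_mul volume measurableSet_halfPlane hd hinj
          fun z => ENNReal.ofReal (1 / z.re ^ 2) * F z).symm
    _ ≤ _ := by
        refine lintegral_mono_set ?_
        rintro _ ⟨z, hz, rfl⟩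
        change 0 < (T z).re
        rw [hTre]
        exact mul_pos x.a_pos hz

lemma measurable_mul_left (x : G) : Measurable fun y : G => x * y := by
  refine measurable_comap_iff.mpr ?_
  have h1 := measurable_a
  have h2 := measurable_b
  change Measurable fun y : G => ((x * y).a, (x * y).b)
  simp only [G.a_mul, G.b_mul]
  fun_prop

theorem map_mul_left_haar_le (x : G) : Measure.map (fun y => x * y) haar ≤ haar := by
  refine Measure.le_iff.mpr fun t ht => ?_
  rw [Measure.map_apply (measurable_mul_left x) ht, ← lintegral_indicator_one ht,
    ← lintegral_indicator_one (measurable_mul_left x ht)]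
  exact lintegral_haar_mul_left_le x (t.indicator 1)

/-! ### Norms of voice transforms -/

lemma one_sub_norm_pt (x : G) : 1 - ‖x.pt‖ ^ 2 = (‖x.α‖ ^ 2)⁻¹ := by
  have h0 : ‖x.α‖ ≠ 0 := norm_ne_zero_iff.mpr x.α_ne
  rw [G.pt, Complex.norm_conj, norm_div, Complex.norm_conj, div_pow, one_sub_div (pow_ne_zero 2 h0),
    x.norm_sub, one_div]

lemma norm_α_sq (x : G) : (x.a + x.a⁻¹) ^ 2 + x.b ^ 2 = 4 * ‖x.α‖ ^ 2 := by
  have h1 : x.α = ⟨(x.a + x.a⁻¹) / 2, x.b / 2⟩ := by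
    apply Complex.ext <;> simp [G.α, ← Complex.ofReal_inv]
  rw [← Complex.normSq_eq_norm_sq, h1, Complex.normSq_mk]
  ring

lemma weight_eq (r : ℝ) (x : G) : weight r x = 4 ^ r * ‖x.α‖ ^ r := by
  have h : (4 : ℝ) = 2 ^ 2 := by norm_num
  rw [weight, norm_α_sq, h, ← mul_pow, ← Real.rpow_natCast, ← Real.rpow_mul (by positivity),
    Real.mul_rpow (by norm_num) (norm_nonneg _), ← mul_assoc]
  congr 1
  · rw [← Real.rpow_natCast, ← Real.rpow_mul (by norm_num), ← Real.rpow_add (by norm_num)]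
    congr 1
    push_cast
    ring
  · congr 1
    push_cast
    ring

lemma weight_pos (r : ℝ) (x : G) : 0 < weight r x := by
  have := norm_pos_iff.mpr x.α_ne
  rw [weight_eq]
  positivity

lemma measurable_weight (r : ℝ) : Measurable (weight r) := by
  have h1 := measurable_a
  have h2 := measurable_b
  unfold weight
  fun_prop

/-- The factors `|α| ^ (-s)` and `|α| ^ r` combine through `|α|⁻² = 1 - |pt|²`. With
`lintegral_haar_pt` this makes the coorbit norm a weighted Bergman norm of the symbol. -/
lemma norm_voice_mul_weight {s : ℝ} [Fact (1 < s)] (r : ℝ) (φ : DistVec s) (x : G) :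
    ‖voice φ x * weight r x‖ =
      4 ^ r * (1 - ‖x.pt‖ ^ 2) ^ ((s - r) / 2) * ‖symbol φ x.pt‖ := by
  have h0 : 0 < ‖x.α‖ := norm_pos_iff.mpr x.α_ne
  have h1 : ‖x.α ^ (-(s : ℂ))‖ = ‖x.α‖ ^ (-s) := by
    rw [← Complex.ofReal_neg, Complex.norm_cpow_real]
  rw [(voice_eq φ x).2, norm_mul, norm_mul, Complex.norm_conj, h1, Complex.norm_real,
    Real.norm_of_nonneg (weight_pos r x).le, weight_eq, one_sub_norm_pt, ← Real.rpow_natCast,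
    ← Real.rpow_neg h0.le, ← Real.rpow_mul h0.le]
  have h2 : ‖x.α‖ ^ (-((2 : ℕ) : ℝ) * ((s - r) / 2)) = ‖x.α‖ ^ (-s) * ‖x.α‖ ^ r := by
    rw [← Real.rpow_add h0]
    congr 1
    push_cast
    ring
  rw [h2]
  ring

lemma measurable_voice_mul_weight {s : ℝ} [Fact (1 < s)] (r : ℝ) (φ : DistVec s) :
    Measurable fun x => voice φ x * weight r x :=
  (measurable_voice φ).mul (Complex.measurable_ofReal.comp (measurable_weight r))

lemma exists_pt_eq {w : ℂ} (hw : w ∈ disc) : ∃ x : G, x.pt = w := by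
  rw [← image_cayley_toUpper] at hw
  obtain ⟨z, hz, rfl⟩ := hw
  refine ⟨G.mk z.re z.im hz, ?_⟩
  have : (G.mk z.re z.im hz).cpt = z := Complex.ext (G.mk_a z.re z.im hz) (G.mk_b z.re z.im hz)
  rw [pt_eq, this]

/-- Every point of the disc is `x.pt` for some `x`, so convergence is inherited from the voice
transform. -/
lemma hasSum_symbol {s : ℝ} [Fact (1 < s)] (φ : DistVec s) {w : ℂ} (hw : w ∈ disc) :
    HasSum (fun m => conj (binom s m) * φ (smoothMon s m) * w ^ m) (symbol φ w) := by
  obtain ⟨x, rfl⟩ := exists_pt_eq hw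
  exact (voice_eq φ x).1

/-! ### Estimates of the coefficients by the coorbit norm -/

/-- Integrating the symbol against `conj (w ^ n)` over the disc of radius `rad n` isolates its
`n`-th coefficient times `sqInt s n`, and `|w ^ n| ≤ 1` there. -/
lemma enorm_coef_mul_le {s : ℝ} [Fact (1 < s)] (φ : DistVec s) (n : ℕ) :
    ‖conj (binom s n) * φ (smoothMon s n)‖ₑ * ENNReal.ofReal (sqInt s n) ≤
      ∫⁻ w in Metric.closedBall 0 (rad n), ‖symbol φ w‖ₑ ∂discMeasure s := by
  have := isFiniteMeasure_disc s
  have hr : ((rad n : ℝ) : ℂ) ∈ disc := by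
    rw [mem_disc, Complex.norm_real, Real.norm_of_nonneg (rad_pos n).le]
    exact rad_lt_one n
  have hs : Summable fun m => ‖conj (binom s m) * φ (smoothMon s m)‖ * rad n ^ m := by
    refine (hasSum_symbol φ hr).summable.norm.congr fun m => ?_
    rw [norm_mul _ (((rad n : ℝ) : ℂ) ^ m), norm_pow, Complex.norm_real,
      Real.norm_of_nonneg (rad_pos n).le]
  have h1 := ((rotInv_discMeasure s).restrict_closedBall (rad n)).integral_powerSeries
    (ae_norm_le_rad s n) (rad_lt_one n).le hs (H := symbol φ) (by
      filter_upwards [ae_norm_le_rad s n] with z hz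
      exact hasSum_symbol φ (mem_disc.mpr (hz.trans_lt (rad_lt_one n)))) n
  have h2 : ENNReal.ofReal (sqInt s n) = ‖((sqInt s n : ℝ) : ℂ)‖ₑ := by
    rw [← ofReal_norm, Complex.norm_real, Real.norm_of_nonneg (sqInt_pos s n).le]
  rw [h2, ← enorm_mul]
  change ‖_ * ((∫ w in Metric.closedBall 0 (rad n), ‖w‖ ^ (2 * n) ∂discMeasure s : ℝ) : ℂ)‖ₑ ≤ _
  rw [← h1]
  refine (enorm_integral_le_lintegral_enorm _).trans (lintegral_mono_ae ?_)
  filter_upwards [ae_norm_le_rad s n] with z hz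
  rw [enorm_mul]
  refine mul_le_of_le_one_right' ?_
  rw [← ofReal_norm, Complex.norm_conj, norm_pow]
  exact ENNReal.ofReal_le_one.mpr (pow_le_one₀ (norm_nonneg z) (hz.trans (rad_lt_one n).le))

/-- The two sides carry the weights `(1 - |w|²) ^ (s - 2)` and `(1 - |w|²) ^ ((s - r) / 2 - 2)`.
Their quotient has exponent `(s + r) / 2` and is polynomially bounded on this disc. -/
lemma lintegral_symbol_le {s : ℝ} [hs : Fact (1 < s)] (r : ℝ) : ∃ C, 0 ≤ C ∧ ∃ N : ℕ,
    ∀ (φ : DistVec s) (n : ℕ),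
      ∫⁻ w in Metric.closedBall 0 (rad n), ‖symbol φ w‖ₑ ∂discMeasure s ≤
        ENNReal.ofReal (C * ((n : ℝ) + 1) ^ N) *
          ∫⁻ x in G.pt ⁻¹' Metric.closedBall 0 (rad n), ‖voice φ x * weight r x‖ₑ ∂haar := by
  have hs1 : 0 < s - 1 := sub_pos.mpr hs.out
  have hpi := Real.pi_pos
  set k := ⌈|(s + r) / 2|⌉₊
  -- The `1/2` and `(4 ^ r)⁻¹` cancel the constants of the Haar density and of the weight; `8 ^ k`
  -- comes from `rpow_bounds`.
  refine ⟨(s - 1) / Real.pi / 2 * (4 ^ r)⁻¹ * 8 ^ k, by positivity, k, fun φ n => ?_⟩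
  set B := Metric.closedBall (0 : ℂ) (rad n)
  have hB : MeasurableSet B := measurableSet_closedBall
  set K := (s - 1) / Real.pi / 2 * (4 ^ r)⁻¹ * 8 ^ k * ((n : ℝ) + 1) ^ k
  let g : ℂ → ENNReal := B.indicator fun w => ENNReal.ofReal K *
    ENNReal.ofReal (4 ^ r * (1 - ‖w‖ ^ 2) ^ ((s - r) / 2) * ‖symbol φ w‖)
  have h1 : ENNReal.ofReal K *
      ∫⁻ x in G.pt ⁻¹' B, ‖voice φ x * weight r x‖ₑ ∂haar = ∫⁻ x, g x.pt ∂haar := by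
    rw [← lintegral_const_mul' _ _ ENNReal.ofReal_ne_top,
      ← lintegral_indicator (measurable_pt hB)]
    refine lintegral_congr fun x => ?_
    by_cases hx : x.pt ∈ B
    · rw [Set.indicator_of_mem (show x ∈ G.pt ⁻¹' B from hx)]
      simp only [g]
      rw [Set.indicator_of_mem hx, ← norm_voice_mul_weight, ofReal_norm]
    · rw [Set.indicator_of_notMem (show x ∉ G.pt ⁻¹' B from hx)]
      simp only [g]
      rw [Set.indicator_of_notMem hx]
  rw [h1, lintegral_haar_pt, ← lintegral_indicator hB, lintegral_discMeasure]
  refine setLIntegral_mono' isOpen_disc.measurableSet fun w hw => ?_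
  simp only [g]
  by_cases hwB : w ∈ B
  · rw [Set.indicator_of_mem hwB, Set.indicator_of_mem hwB, ← ofReal_norm]
    have hw1 : ‖w‖ ≤ rad n := by simpa [B] using hwB
    have ht : 0 < 1 - ‖w‖ ^ 2 := lt_of_lt_of_le (by positivity) (one_sub_sq_mem hw1).1
    have hb := (rpow_bounds hw1 ((s + r) / 2)).2
    set t := 1 - ‖w‖ ^ 2
    rw [← ENNReal.ofReal_mul (by positivity), ← ENNReal.ofReal_mul (by positivity),
      ← ENNReal.ofReal_mul (by positivity)]
    refine ENNReal.ofReal_le_ofReal ?_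
    have h4 : (0 : ℝ) < 4 ^ r := by positivity
    have e1 : t ^ (s - 2) = t ^ ((s + r) / 2) * (t ^ ((s - r) / 2) / t ^ 2) := by
      rw [← Real.rpow_natCast, ← Real.rpow_sub ht, ← Real.rpow_add ht]
      congr 1
      push_cast
      ring
    have e2 : 2 / t ^ 2 * (K * (4 ^ r * t ^ ((s - r) / 2) * ‖symbol φ w‖)) =
        (s - 1) / Real.pi * ((8 * ((n : ℝ) + 1)) ^ k * (t ^ ((s - r) / 2) / t ^ 2)) *
          ‖symbol φ w‖ := by
      simp only [K]
      rw [mul_pow]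
      field_simp
    rw [e1, e2]
    gcongr
  · rw [Set.indicator_of_notMem hwB, mul_zero]
    exact zero_le

/-- The Haar density is at most `2 (8 (n + 1))²` on this disc, and the area is at most `π`. -/
lemma haar_pt_preimage_le (n : ℕ) : haar (G.pt ⁻¹' Metric.closedBall 0 (rad n)) ≤
    ENNReal.ofReal (2 * Real.pi * (8 * ((n : ℝ) + 1)) ^ 2) := by
  have hB : MeasurableSet (Metric.closedBall (0 : ℂ) (rad n)) := measurableSet_closedBall
  rw [← lintegral_indicator_one (measurable_pt hB)]
  have h1 := lintegral_haar_pt ((Metric.closedBall (0 : ℂ) (rad n)).indicator 1)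
  refine (le_of_eq h1).trans ?_
  have h2 : ∀ w ∈ disc, ENNReal.ofReal (2 / (1 - ‖w‖ ^ 2) ^ 2) *
      (Metric.closedBall (0 : ℂ) (rad n)).indicator 1 w ≤
      ENNReal.ofReal (2 * (8 * ((n : ℝ) + 1)) ^ 2) := by
    intro w _
    by_cases hw : w ∈ Metric.closedBall (0 : ℂ) (rad n)
    · rw [Set.indicator_of_mem hw, Pi.one_apply, mul_one]
      refine ENNReal.ofReal_le_ofReal ?_
      have h3 := (one_sub_sq_mem (mem_closedBall_zero_iff.mp hw)).1
      have ht : 0 < 1 - ‖w‖ ^ 2 := lt_of_lt_of_le (by positivity) h3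
      rw [div_eq_mul_inv]
      gcongr
      rw [← inv_pow]
      gcongr
      rw [inv_le_comm₀ ht (by positivity), ← one_div]
      exact h3
    · rw [Set.indicator_of_notMem hw, mul_zero]
      exact zero_le
  refine (setLIntegral_mono' isOpen_disc.measurableSet h2).trans ?_
  rw [setLIntegral_const, disc, Complex.volume_ball, ENNReal.ofReal_one, one_pow, one_mul,
    ← ENNReal.ofReal_coe_nnreal, NNReal.coe_real_pi, ← ENNReal.ofReal_mul (by positivity)]
  exact ENNReal.ofReal_le_ofReal (le_of_eq (by ring))

/-- The coefficient is bounded by an `L¹` norm over a set of polynomially bounded Haar measure,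
hence by Hölder's inequality by the `L^p` norm. Every constant is polynomial in `n`, so the coorbit
norm controls a functional within the growth that `exists_distVec` allows. -/
theorem norm_distVec_smoothMon_le (s p r : ℝ) [Fact (1 < s)] (hp : 1 ≤ p) : ∃ C, 0 ≤ C ∧ ∃ N : ℕ,
    ∀ (φ : DistVec s), MemLpr p r (voice φ) → ∀ n : ℕ,
      ‖φ (smoothMon s n)‖ ≤ C * ((n : ℝ) + 1) ^ N * lprNorm p r (voice φ) := by
  obtain ⟨C₁, hC₁, N₁, h₁⟩ := lintegral_symbol_le (s := s) r
  obtain ⟨C₂, hC₂, N₂, h₂⟩ := exists_le_sqInt s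
  have hpi := Real.pi_pos
  refine ⟨C₂⁻¹ * (C₁ * (2 * Real.pi * 8 ^ 2)), by positivity, N₂ + (N₁ + 2), fun φ hφ n => ?_⟩
  have hp1 : 1 ≤ ENNReal.ofReal p := ENNReal.one_le_ofReal.mpr hp
  set f : G → ℂ := fun x => voice φ x * weight r x
  set S := G.pt ⁻¹' Metric.closedBall (0 : ℂ) (rad n)
  set V := 2 * Real.pi * (8 * ((n : ℝ) + 1)) ^ 2
  have hn1 : (1 : ℝ) ≤ (n : ℝ) + 1 := by simp
  -- This permits replacing the Hölder exponent `1 - 1/p` by `1`.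
  have hV1 : 1 ≤ V := by
    have h3 := Real.pi_gt_three
    have : 1 ≤ (8 * ((n : ℝ) + 1)) ^ 2 := one_le_pow₀ (by linarith)
    simp only [V]
    nlinarith
  have hHolder : ∫⁻ x in S, ‖f x‖ₑ ∂haar ≤ ENNReal.ofReal (V * lprNorm p r (voice φ)) := by
    rw [← eLpNorm_one_eq_lintegral_enorm]
    refine (eLpNorm_le_eLpNorm_mul_rpow_measure_univ hp1
      (measurable_voice_mul_weight r φ).aestronglyMeasurable).trans ?_
    rw [ENNReal.ofReal_mul (by positivity), mul_comm, lprNorm, ENNReal.ofReal_toReal hφ.2.ne]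
    refine mul_le_mul' ?_ (eLpNorm_restrict_le _ _ _ _)
    rw [Measure.restrict_apply_univ, ENNReal.toReal_one, ENNReal.toReal_ofReal (by linarith)]
    have he0 : 0 ≤ 1 / 1 - 1 / p := by
      rw [div_one, sub_nonneg, div_le_one (by linarith)]
      exact hp
    have he1 : 1 / 1 - 1 / p ≤ 1 := by
      have : 0 ≤ 1 / p := by positivity
      linarith
    calc haar S ^ (1 / 1 - 1 / p) ≤ ENNReal.ofReal V ^ (1 / 1 - 1 / p) :=
          ENNReal.rpow_le_rpow (haar_pt_preimage_le n) he0
      _ ≤ ENNReal.ofReal V ^ (1 : ℝ) :=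
          ENNReal.rpow_le_rpow_of_exponent_le (ENNReal.one_le_ofReal.mpr hV1) he1
      _ = _ := ENNReal.rpow_one _
  have hL0 : 0 ≤ lprNorm p r (voice φ) := ENNReal.toReal_nonneg
  have h3 : ‖conj (binom s n) * φ (smoothMon s n)‖ * sqInt s n ≤
      C₁ * ((n : ℝ) + 1) ^ N₁ * (V * lprNorm p r (voice φ)) := by
    refine (ENNReal.ofReal_le_ofReal_iff (by positivity)).mp ?_
    rw [ENNReal.ofReal_mul (norm_nonneg _), ofReal_norm, ENNReal.ofReal_mul (by positivity)]
    exact ((enorm_coef_mul_le φ n).trans (h₁ φ n)).trans (mul_le_mul_right hHolder _)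
  have h4 : ‖φ (smoothMon s n)‖ ≤ ‖conj (binom s n) * φ (smoothMon s n)‖ := by
    rw [norm_mul, Complex.norm_conj]
    exact le_mul_of_one_le_left (norm_nonneg _) (one_le_norm_binom Fact.out n)
  have h5 : ‖φ (smoothMon s n)‖ * (C₂ * ((n : ℝ) + 1)⁻¹ ^ N₂) ≤
      C₁ * ((n : ℝ) + 1) ^ N₁ * (V * lprNorm p r (voice φ)) :=
    (mul_le_mul h4 (h₂ n) (by positivity) (norm_nonneg _)).trans h3
  rw [← le_div_iff₀ (by positivity)] at h5
  refine h5.trans (le_of_eq ?_)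
  simp only [V]
  rw [inv_pow, pow_add, pow_add, mul_pow]
  field_simp

/-! ### The coorbit norm -/

lemma voice_add {s : ℝ} [Fact (1 < s)] (φ ψ : DistVec s) (x : G) :
    voice (φ + ψ) x = voice φ x + voice ψ x := rfl

lemma voice_sub {s : ℝ} [Fact (1 < s)] (φ ψ : DistVec s) (x : G) :
    voice (φ - ψ) x = voice φ x - voice ψ x := rfl

lemma voice_smul {s : ℝ} [Fact (1 < s)] (c : ℂ) (φ : DistVec s) (x : G) :
    voice (c • φ) x = c * voice φ x := rfl

lemma lprNorm_add_le {s p r : ℝ} [Fact (1 < s)] (hp : 1 ≤ p) {φ ψ : DistVec s}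
    (hφ : MemLpr p r (voice φ)) (hψ : MemLpr p r (voice ψ)) :
    lprNorm p r (voice (φ + ψ)) ≤ lprNorm p r (voice φ) + lprNorm p r (voice ψ) := by
  have h := eLpNorm_add_le hφ.1 hψ.1 (ENNReal.one_le_ofReal.mpr hp)
  rw [lprNorm, lprNorm, lprNorm, ← ENNReal.toReal_add hφ.2.ne hψ.2.ne]
  refine ENNReal.toReal_mono (ENNReal.add_ne_top.mpr ⟨hφ.2.ne, hψ.2.ne⟩) (le_trans (le_of_eq ?_) h)
  congr 1
  funext x
  simp only [Pi.add_apply, voice_add, add_mul]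

lemma lprNorm_smul {s p r : ℝ} [Fact (1 < s)] (c : ℂ) (φ : DistVec s) :
    lprNorm p r (voice (c • φ)) = ‖c‖ * lprNorm p r (voice φ) := by
  have h := eLpNorm_const_smul c (fun x => voice φ x * weight r x) (ENNReal.ofReal p) haar
  have h1 : (c • fun x => voice φ x * (weight r x : ℂ)) =
      fun x => voice (c • φ) x * (weight r x : ℂ) := by
    funext x
    simp only [Pi.smul_apply, voice_smul, smul_eq_mul, mul_assoc]
  rw [h1] at h
  rw [lprNorm, lprNorm, h, ENNReal.toReal_mul, toReal_enorm]

/-- The values on each monomial converge, with an error polynomial in the degree. The limits define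
a functional, the voice transforms converge pointwise to its voice transform, and Fatou's lemma
gives convergence in norm. -/
theorem coorbit_complete {s p r : ℝ} [Fact (1 < s)] (hp : 1 ≤ p) (f : ℕ → Coorbit s p r)
    (hf : ∀ ε > 0, ∃ k, ∀ m ≥ k, ∀ n ≥ k, coorbitNorm (f m - f n) < ε) :
    ∃ v, Filter.Tendsto (fun n => coorbitNorm (f n - v)) Filter.atTop (nhds 0) := by
  obtain ⟨C, hC, N, hCN⟩ := norm_distVec_smoothMon_le s p r hp
  have hdiff : ∀ j k n, ‖(f j : DistVec s) (smoothMon s n) - (f k : DistVec s) (smoothMon s n)‖ ≤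
      C * ((n : ℝ) + 1) ^ N * coorbitNorm (f j - f k) := fun j k n =>
    hCN _ (f j - f k).2 n
  have hcauchy : ∀ n, CauchySeq fun j => (f j : DistVec s) (smoothMon s n) := by
    intro n
    refine Metric.cauchySeq_iff.mpr fun ε hε => ?_
    -- Adding `1` keeps the divisor positive even if `C = 0`.
    have hA : 0 < C * ((n : ℝ) + 1) ^ N + 1 := by positivity
    obtain ⟨k, hk⟩ := hf (ε / (C * ((n : ℝ) + 1) ^ N + 1)) (by positivity)
    refine ⟨k, fun i hi j hj => ?_⟩
    rw [dist_eq_norm]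
    refine (hdiff i j n).trans_lt ?_
    have h1 := hk i hi j hj
    have h0 : 0 ≤ coorbitNorm (f i - f j) := ENNReal.toReal_nonneg
    rw [lt_div_iff₀ hA] at h1
    nlinarith
  choose g hg using fun n => cauchySeq_tendsto_of_complete (hcauchy n)
  have hlim : ∀ ε > 0, ∃ k, ∀ j ≥ k, ∀ n, ‖(f j : DistVec s) (smoothMon s n) - g n‖ ≤
      C * ε * ((n : ℝ) + 1) ^ N := by
    intro ε hε
    obtain ⟨k, hk⟩ := hf ε hε
    refine ⟨k, fun j hj n => ?_⟩
    refine le_of_tendsto (tendsto_const_nhds.sub (hg n)).norm ?_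
    filter_upwards [Filter.eventually_ge_atTop k] with i hi
    refine (hdiff j i n).trans ?_
    have := (hk j hj i hi).le
    calc _ ≤ C * ((n : ℝ) + 1) ^ N * ε := by gcongr
      _ = _ := by ring
  obtain ⟨φ, hφ⟩ : ∃ φ : DistVec s, ∀ n, φ (smoothMon s n) = g n := by
    obtain ⟨k, hk⟩ := hlim 1 one_pos
    -- The limit lies within `C · 1` of one term `f k`, whose own values are bounded by its norm.
    refine exists_distVec (C := C * 1 + C * coorbitNorm (f k)) (N := N) fun n => ?_
    have h1 := hk k le_rfl n
    have h2 := hCN _ (f k).2 n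
    have h3 := norm_sub_norm_le (g n) ((f k : DistVec s) (smoothMon s n))
    rw [norm_sub_rev] at h3
    change _ ≤ C * ((n : ℝ) + 1) ^ N * coorbitNorm (f k) at h2
    linarith
  have hpt : ∀ x, Filter.Tendsto (fun j => voice (f j : DistVec s) x) Filter.atTop
      (nhds (voice φ x)) := by
    intro x
    set T := ∑' m, ‖coef (smoothRep s x (wavelet s)) m‖ * ((m : ℝ) + 1) ^ N
    have hT : 0 ≤ T := tsum_nonneg fun m => by positivity
    refine Metric.tendsto_atTop.mpr fun ε hε => ?_
    have hA : 0 < C * T + 1 := by positivity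
    obtain ⟨k, hk⟩ := hlim (ε / (C * T + 1)) (by positivity)
    refine ⟨k, fun j hj => ?_⟩
    rw [dist_eq_norm, ← voice_sub]
    refine (norm_distVec_le (φ := (f j : DistVec s) - φ) (C := C * (ε / (C * T + 1))) (N := N)
      (fun m => ?_) _).trans_lt ?_
    · change ‖(f j : DistVec s) (smoothMon s m) - φ (smoothMon s m)‖ ≤ _
      rw [hφ]
      exact hk j hj m
    · change C * (ε / (C * T + 1)) * T < ε
      rw [mul_div_assoc', div_mul_eq_mul_div, div_lt_iff₀ hA]
      nlinarith
  have hFatou : ∀ ε > 0, ∃ k, ∀ j ≥ k, eLpNorm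
      (fun x => voice ((f j : DistVec s) - φ) x * (weight r x : ℂ)) (ENNReal.ofReal p) haar ≤
        ENNReal.ofReal ε := by
    intro ε hε
    obtain ⟨k, hk⟩ := hf ε hε
    refine ⟨k, fun j hj => ?_⟩
    -- Here `j` is fixed and the second index tends to infinity.
    refine (Lp.eLpNorm_lim_le_liminf_eLpNorm
      (f := fun i x => voice ((f j : DistVec s) - (f i : DistVec s)) x * (weight r x : ℂ))
      (fun i => (measurable_voice_mul_weight r _).aestronglyMeasurable) _
      (Filter.Eventually.of_forall fun x => ?_)).trans ?_
    · simp only [voice_sub]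
      exact (tendsto_const_nhds.sub (hpt x)).mul_const _
    · refine Filter.liminf_le_of_frequently_le' (Filter.Eventually.frequently ?_)
      filter_upwards [Filter.eventually_ge_atTop k] with i hi
      have h1 := (hk j hj i hi).le
      refine (ENNReal.ofReal_toReal (f j - f i).2.2.ne).symm.trans_le ?_
      exact ENNReal.ofReal_le_ofReal h1
  have hmem : φ ∈ Coorbit s p r := by
    obtain ⟨k, hk⟩ := hFatou 1 one_pos
    have h1 : (f k : DistVec s) - φ ∈ Coorbit s p r :=
      ⟨(measurable_voice_mul_weight r _).aestronglyMeasurable,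
        (hk k le_rfl).trans_lt ENNReal.ofReal_lt_top⟩
    have h2 := (Coorbit s p r).sub_mem (f k).2 h1
    rwa [sub_sub_cancel] at h2
  refine ⟨⟨φ, hmem⟩, Metric.tendsto_atTop.mpr fun ε hε => ?_⟩
  obtain ⟨k, hk⟩ := hFatou (ε / 2) (half_pos hε)
  refine ⟨k, fun j hj => ?_⟩
  have h0 : 0 ≤ coorbitNorm (f j - ⟨φ, hmem⟩) := ENNReal.toReal_nonneg
  rw [Real.dist_eq, sub_zero, abs_of_nonneg h0]
  refine lt_of_le_of_lt ?_ (half_lt_self hε)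
  exact ENNReal.toReal_le_of_le_ofReal (half_pos hε).le (hk j hj)

theorem isBanachNorm_coorbitNorm (s p r : ℝ) [Fact (1 < s)] (hp : 1 ≤ p) :
    IsBanachNorm (coorbitNorm : Coorbit s p r → ℝ) where
  add_le v w := lprNorm_add_le hp v.2 w.2
  smul c v := lprNorm_smul c (v : DistVec s)
  eq_zero v hv := by
    obtain ⟨C, hC, N, h⟩ := norm_distVec_smoothMon_le s p r hp
    refine Subtype.ext (distVec_ext fun m => ?_)
    have h1 := h _ v.2 m
    rw [show lprNorm p r (voice (v : DistVec s)) = 0 from hv, mul_zero] at h1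
    exact norm_le_zero_iff.mp h1
  complete := coorbit_complete hp

/-! ### The coorbit space is non-zero -/

/-- The conjugate of the constant Taylor coefficient is a functional with constant symbol. Its norm
is finite because the measure `discMeasure σ` has finite total mass for `σ > 1`. -/
theorem coorbit_ne_bot (s p r : ℝ) [Fact (1 < s)] (hp : 1 ≤ p) (h : r + 2 / p < s) :
    Coorbit s p r ≠ ⊥ := by
  have hp0 : 0 < p := by linarith
  obtain ⟨φ, hφ⟩ := exists_distVec (s := s) (g := fun m => if m = 0 then 1 else 0) (C := 1)
    (N := 0) (fun m => by split_ifs <;> simp)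
  have hsym : ∀ w ∈ disc, symbol φ w = conj (binom s 0) := by
    intro w hw
    rw [← (hasSum_symbol φ hw).tsum_eq, tsum_eq_single 0]
    · simp [hφ]
    · intro m hm
      simp [hφ, hm]
  -- The exponent of `1 - |w|²` in the `p`-th power of the weighted voice transform; `σ > 1` amounts
  -- to `r + 2 / p < s`.
  set σ := (s - r) * p / 2
  have hσ : 1 < σ := by
    have h1 : 2 / p < s - r := by linarith
    rw [div_lt_iff₀ hp0] at h1
    simp only [σ]
    linarith
  have : Fact (1 < σ) := ⟨hσ⟩
  have hfin := isFiniteMeasure_disc σ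
  have hσ1 : 0 < σ - 1 := sub_pos.mpr hσ
  have hpi := Real.pi_pos
  have hmem : φ ∈ Coorbit s p r := by
    refine ⟨(measurable_voice_mul_weight r _).aestronglyMeasurable, ?_⟩
    rw [eLpNorm_lt_top_iff_lintegral_rpow_enorm_lt_top (by simpa using hp0) ENNReal.ofReal_ne_top,
      ENNReal.toReal_ofReal hp0.le]
    set c := 4 ^ r * ‖conj (binom s 0)‖
    have hc : 0 ≤ c := by positivity
    have h1 : ∀ x : G, ‖voice φ x * (weight r x : ℂ)‖ₑ ^ p =
        (fun w : ℂ => ENNReal.ofReal (c ^ p * (1 - ‖w‖ ^ 2) ^ σ)) x.pt := by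
      intro x
      have ht : 0 ≤ 1 - ‖x.pt‖ ^ 2 := by
        rw [one_sub_norm_pt]
        positivity
      rw [← ofReal_norm, norm_voice_mul_weight, hsym _ (mem_disc.mpr x.norm_pt),
        ENNReal.ofReal_rpow_of_nonneg (by positivity) hp0.le]
      congr 1
      rw [mul_right_comm, Real.mul_rpow hc (by positivity), ← Real.rpow_mul ht]
      congr 2
      simp only [σ]
      ring
    simp only [h1]
    rw [lintegral_haar_pt fun w : ℂ => ENNReal.ofReal (c ^ p * (1 - ‖w‖ ^ 2) ^ σ)]
    -- The factor `π / (σ - 1)` undoes the normalisation in `discMeasure σ`.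
    have h2 : ∫⁻ w in disc, ENNReal.ofReal (2 / (1 - ‖w‖ ^ 2) ^ 2) *
        ENNReal.ofReal (c ^ p * (1 - ‖w‖ ^ 2) ^ σ) =
        ∫⁻ w, ENNReal.ofReal (2 * c ^ p * (Real.pi / (σ - 1))) ∂discMeasure σ := by
      rw [lintegral_discMeasure]
      refine setLIntegral_congr_fun isOpen_disc.measurableSet fun w hw => ?_
      have ht : 0 < 1 - ‖w‖ ^ 2 := by
        rw [mem_disc] at hw
        nlinarith [norm_nonneg w]
      rw [← ENNReal.ofReal_mul (by positivity), ← ENNReal.ofReal_mul (by positivity),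
        Real.rpow_sub ht, Real.rpow_ofNat]
      congr 1
      field_simp
    rw [h2, lintegral_const]
    exact ENNReal.mul_lt_top ENNReal.ofReal_lt_top (measure_lt_top _ _)
  intro hbot
  rw [hbot, Submodule.mem_bot] at hmem
  have := hφ 0
  rw [hmem] at this
  simp at this

/-! ### Invariance -/

lemma norm_α_mul_le (x y : G) : ‖(x * y).α‖ ≤ 2 * ‖x.α‖ * ‖y.α‖ := by
  have hβ : ∀ x : G, ‖x.β‖ ≤ ‖x.α‖ := fun x => by
    nlinarith [x.norm_sub, norm_nonneg x.α, norm_nonneg x.β]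
  rw [G.α_mul]
  refine (norm_add_le _ _).trans ?_
  rw [norm_mul, norm_mul, Complex.norm_conj]
  have := mul_le_mul (hβ x) (hβ y) (norm_nonneg _) (norm_nonneg _)
  linarith

/-- The weight is a power of `|α|`, which is submultiplicative up to a factor `2`. For negative `r`
the power reverses inequalities, so the estimate is applied to `y = x⁻¹ (x y)`. -/
lemma exists_weight_mul_le (r : ℝ) (x : G) : ∃ C, ∀ y, weight r (x * y) ≤ C * weight r y := by
  have hpos : ∀ x : G, 0 < ‖x.α‖ := fun x => norm_pos_iff.mpr x.α_ne
  rcases le_total 0 r with hr | hr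
  · refine ⟨(2 * ‖x.α‖) ^ r, fun y => ?_⟩
    have h1 := Real.rpow_le_rpow (norm_nonneg _) (norm_α_mul_le x y) hr
    rw [Real.mul_rpow (by positivity) (norm_nonneg _)] at h1
    rw [weight_eq, weight_eq, mul_left_comm]
    exact mul_le_mul_of_nonneg_left h1 (by positivity)
  · refine ⟨((2 * ‖x⁻¹.α‖)⁻¹) ^ r, fun y => ?_⟩
    have h1 := norm_α_mul_le x⁻¹ (x * y)
    have h0 := hpos x⁻¹
    rw [inv_mul_cancel_left, ← inv_mul_le_iff₀ (by positivity)] at h1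
    have h2 := Real.rpow_le_rpow_of_nonpos (mul_pos (by positivity) (hpos y)) h1 hr
    rw [Real.mul_rpow (by positivity) (norm_nonneg _)] at h2
    rw [weight_eq, weight_eq, mul_left_comm]
    exact mul_le_mul_of_nonneg_left h2 (by positivity)

lemma voice_distRep {s : ℝ} [Fact (1 < s)] (x : G) (φ : DistVec s) (y : G) :
    voice (distRep x φ) y = voice φ (x⁻¹ * y) := by
  have h : smoothRep s x⁻¹ (smoothRep s y (wavelet s)) = smoothRep s (x⁻¹ * y) (wavelet s) :=
    Subtype.ext (rep_mul x⁻¹ y (one s)).symm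
  change φ (smoothRep s x⁻¹ (smoothRep s y (wavelet s))) = _
  rw [h]
  rfl

/-- The voice transform of `distRep x φ` is the translate by `x⁻¹`. Translation does not increase
the Haar integral, and moving it past the weight costs a constant. -/
theorem distRep_mem_coorbit {s p r : ℝ} [Fact (1 < s)] (x : G) {φ : DistVec s}
    (hφ : φ ∈ Coorbit s p r) : distRep x φ ∈ Coorbit s p r := by
  obtain ⟨C, hC⟩ := exists_weight_mul_le r x
  have h1 : MemLp (fun y => voice φ y * (weight r y : ℂ)) (ENNReal.ofReal p)
      (Measure.map (fun y => x⁻¹ * y) haar) :=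
    MemLp.mono_measure (map_mul_left_haar_le x⁻¹) hφ
  have h2 := h1.comp_of_map (measurable_mul_left x⁻¹).aemeasurable
  refine MemLp.of_le_mul (c := C) h2
    (measurable_voice_mul_weight r (distRep x φ)).aestronglyMeasurable
    (Filter.Eventually.of_forall fun y => ?_)
  have h3 := hC (x⁻¹ * y)
  rw [mul_inv_cancel_left] at h3
  simp only [Function.comp_apply]
  rw [voice_distRep, norm_mul, norm_mul, Complex.norm_real, Complex.norm_real,
    Real.norm_of_nonneg (weight_pos r _).le, Real.norm_of_nonneg (weight_pos r _).le]
  calc _ ≤ ‖voice φ (x⁻¹ * y)‖ * (C * weight r (x⁻¹ * y)) := by gcongr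
    _ = _ := by ring

/-! ### The coefficient of the wavelet -/

/-- Against the constant function only the constant Taylor coefficient `α ^ (-s)` of `π_s(x) 1`
survives. -/
lemma norm_inner_rep_one (s : ℝ) [Fact (1 < s)] (x : G) :
    ‖inner ℂ (rep s x (one s)) (one s)‖ = ‖x.α‖ ^ (-s) * (discMeasure s).real Set.univ := by
  have := isFiniteMeasure_disc s
  have hae : ∀ᵐ z ∂discMeasure s, z ∈ disc :=
    (ae_discMeasure_iff s).mpr (ae_restrict_mem isOpen_disc.measurableSet)
  have h1 : inner ℂ (rep s x (one s)) (one s) =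
      conj (∫ z, hol (rep s x (one s)) z * conj (z ^ 0) ∂discMeasure s) := by
    rw [Submodule.coe_inner, L2.inner_def, ← integral_conj]
    refine integral_congr_ae ?_
    filter_upwards [hol_ae (rep s x (one s)), hol_ae (one s), hae] with z h2 h3 hz
    rw [h2, h3, hol_one s hz, RCLike.inner_apply]
    simp
  have hw : ‖conj x.pt‖ < 1 := by
    rw [Complex.norm_conj]
    exact x.norm_pt
  have hsum : Summable fun m => ‖x.α ^ (-(s : ℂ)) * (binom s m * conj x.pt ^ m)‖ * 1 ^ m := by
    simpa only [one_pow, mul_one] using ((hasSum_binom s hw).summable.mul_left (x.α ^ (-(s : ℂ)))).norm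
  -- As `|pt| < 1`, the series converges absolutely even on the closed disc, so `ρ = 1` is allowed.
  have h2 := (rotInv_discMeasure s).integral_powerSeries (ρ := 1)
    (by filter_upwards [hae] with z hz using (mem_disc.mp hz).le) le_rfl hsum
    (H := hol (rep s x (one s))) (by
      filter_upwards [hae] with z hz
      have h3 := hasSum_coefL (rep s x (one s)) hz
      have h4 : ∀ m, coefL s m (rep s x (one s)) = _ := fun m => coef_rep_one x m
      simpa only [h4] using h3) 0
  have hb : binom s 0 = 1 := by
    simp [binom]
  rw [h1, Complex.norm_conj, h2, hb, norm_mul, pow_zero, mul_one, mul_one, ← Complex.ofReal_neg,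
    Complex.norm_cpow_real, Complex.norm_real]
  simp [measureReal_nonneg]

/-- The area is the divergent integral of `2 / a` over `(0, 1)`. -/
lemma volume_hyperbolic_region :
    volume {z : ℂ | 0 < z.re ∧ z.re < 1 ∧ |z.im| < z.re⁻¹} = ⊤ := by
  have h1 := volume_regionBetween_eq_lintegral (μ := (volume : Measure ℝ))
    (f := fun a : ℝ => -a⁻¹) (g := fun a : ℝ => a⁻¹) (s := Set.Ioo 0 1)
    (by fun_prop) (by fun_prop) measurableSet_Ioo
  have h2 : {z : ℂ | 0 < z.re ∧ z.re < 1 ∧ |z.im| < z.re⁻¹} = Complex.measurableEquivRealProd ⁻¹'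
      regionBetween (fun a : ℝ => -a⁻¹) (fun a : ℝ => a⁻¹) (Set.Ioo 0 1) := by
    ext z
    simp [regionBetween, Complex.measurableEquivRealProd_apply, abs_lt, and_assoc]
  rw [h2, Complex.volume_preserving_equiv_real_prod.measure_preimage_equiv]
  refine h1.trans ?_
  by_contra hne
  have h3 : IntegrableOn (fun a : ℝ => a⁻¹) (Set.Ioo 0 1) := by
    refine ⟨by fun_prop, ?_⟩
    refine lt_of_le_of_lt (setLIntegral_mono' measurableSet_Ioo fun a ha => ?_) (Ne.lt_top hne)
    have ha0 : 0 < a⁻¹ := inv_pos.mpr ha.1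
    rw [← ofReal_norm, Real.norm_of_nonneg ha0.le]
    refine ENNReal.ofReal_le_ofReal ?_
    simp only [Pi.sub_apply]
    linarith
  have h4 := (intervalIntegrable_iff_integrableOn_Ioo_of_le zero_le_one).mpr h3
  rw [intervalIntegrable_inv_iff] at h4
  simp at h4

/-- For `s ≤ 2` and `|α| ≥ 1` one has `|α| ^ (-s) ≥ |α|⁻²`. On the region `a < 1`, `|b| < 1/a` this
is at least `(4/5) a²`, since `4|α|² = (a + 1/a)² + b² ≤ 5 / a²`. The factor `a²` cancels the Haar
density, leaving a positive constant on a region of infinite area. -/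
theorem not_integrable_inner_rep_one (s : ℝ) [Fact (1 < s)] (hs : s ≤ 2) :
    ¬ Integrable (fun x : G => inner ℂ (rep s x (one s)) (one s)) haar := by
  intro hint
  have := isFiniteMeasure_disc s
  set c := (discMeasure s).real Set.univ
  have hc : 0 < c := by
    have h1 := sqInt_pos s 0
    have h2 : sqInt s 0 ≤ c := by
      simp only [sqInt, mul_zero, pow_zero, integral_const, smul_eq_mul, mul_one]
      rw [measureReal_restrict_apply_univ]
      exact measureReal_mono (Set.subset_univ _)
    exact h1.trans_le h2
  have h1 := hint.2
  rw [HasFiniteIntegral] at h1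
  set R := {z : ℂ | 0 < z.re ∧ z.re < 1 ∧ |z.im| < z.re⁻¹}
  have hR : MeasurableSet R := by
    have e1 := Complex.measurable_re
    have e2 := Complex.measurable_im
    refine (measurableSet_lt measurable_const e1).inter ((measurableSet_lt e1 measurable_const).inter
      (measurableSet_lt (continuous_abs.measurable.comp e2) e1.inv))
  let F : ℂ → ENNReal := R.indicator fun z => ENNReal.ofReal (c * (4 / 5 * z.re ^ 2))
  have h2 : ∀ x : G, F x.cpt ≤ ‖inner ℂ (rep s x (one s)) (one s)‖ₑ := by
    intro x
    simp only [F]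
    by_cases hx : x.cpt ∈ R
    · rw [Set.indicator_of_mem hx, ← ofReal_norm, norm_inner_rep_one, mul_comm c]
      refine ENNReal.ofReal_le_ofReal (mul_le_mul_of_nonneg_right ?_ hc.le)
      obtain ⟨ha, ha1, hb⟩ : 0 < x.a ∧ x.a < 1 ∧ |x.b| < x.a⁻¹ := hx
      change 4 / 5 * x.a ^ 2 ≤ _
      have h3 := norm_α_sq x
      have h4 : x.b ^ 2 ≤ (x.a⁻¹) ^ 2 := sq_le_sq' (by linarith [(abs_lt.mp hb).1]) (abs_lt.mp hb).2.le
      have h5 : 1 < x.a⁻¹ := (one_lt_inv₀ ha).mpr ha1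
      have h6 : ‖x.α‖ ^ 2 ≤ 5 / 4 * (x.a⁻¹) ^ 2 := by nlinarith
      have h7 : 1 ≤ ‖x.α‖ := by nlinarith [x.norm_sub, sq_nonneg ‖x.β‖, norm_nonneg x.α]
      have h8 : ‖x.α‖ ^ (-(2 : ℝ)) ≤ ‖x.α‖ ^ (-s) :=
        Real.rpow_le_rpow_of_exponent_le h7 (by linarith)
      refine le_trans ?_ h8
      rw [Real.rpow_neg (norm_nonneg _), Real.rpow_two]
      have h9 := inv_anti₀ (by positivity) h6
      refine le_trans (le_of_eq ?_) h9
      field_simp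
    · rw [Set.indicator_of_notMem hx]
      exact zero_le
  have h3 : ∫⁻ x, F x.cpt ∂haar = ⊤ := by
    rw [lintegral_haar]
    refine top_le_iff.mp ?_
    calc (⊤ : ENNReal) = ENNReal.ofReal (c * (4 / 5)) * volume R := by
          rw [volume_hyperbolic_region, ENNReal.mul_top]
          simpa using hc
      _ = ∫⁻ z in R, ENNReal.ofReal (c * (4 / 5)) := (setLIntegral_const _ _).symm
      _ = ∫⁻ z in R, ENNReal.ofReal (1 / z.re ^ 2) * F z := by
          refine setLIntegral_congr_fun hR fun z hz => ?_
          have hz0 : 0 < z.re := hz.1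
          simp only [F]
          rw [Set.indicator_of_mem hz, ← ENNReal.ofReal_mul (by positivity)]
          congr 1
          field_simp
      _ ≤ _ := lintegral_mono_set fun z hz => hz.1
  exact absurd ((lintegral_mono h2).trans_lt h1) (by rw [h3]; exact lt_irrefl _)

end

end BergmanCoorbit

open BergmanCoorbit

theorem mainTheorem5 (s p r : ℝ) [Fact (1 < s)] (hp : 1 ≤ p)
    (h₁ : 2 - s < r + 2 / p) (h₂ : r + 2 / p < s) :
    IsBanachNorm (coorbitNorm : Coorbit s p r → ℝ) ∧
    Coorbit s p r ≠ ⊥ ∧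
    (∀ (x : G) (φ : DistVec s), φ ∈ Coorbit s p r → distRep x φ ∈ Coorbit s p r) ∧
    (s ≤ 2 → ¬ MeasureTheory.Integrable (fun x : G => inner ℂ (rep s x (one s)) (one s)) haar) :=
  ⟨isBanachNorm_coorbitNorm s p r hp, coorbit_ne_bot s p r hp h₂,
    fun x _ hφ => distRep_mem_coorbit x hφ, not_integrable_inner_rep_one s⟩
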